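/- Let $X=\{X(t)\}_{t\in\mathbb R}$ be a real Gaussian process with constant mean and stationary covariance $\operatorname{Cov}\{X(x),X(y)\}=\tilde K(x-y)$, $x,y\in\mathbb R$, where $$\tilde K(t)=\sum_{j=0}^{\lfloor\nu\rfloor}\beta_j|t|^{2j}+\beta_\nu^*G_\nu(|t|)+r(t),\qquad r(t)=O(|t|^{2\nu+\tau})\ \text{ as } t\to0,$$ for some constants $\nu>0$, $\tau>0$, $\beta_\nu^*\neq0$, $\beta_0,\dots,\beta_{\lfloor\nu\rfloor}\in\mathbb R$. Here $G_\nu(0)=0$ and, for $s>0$, $G_\nu(s)=s^{2\nu}$ if $\nu\notin\mathbb Z$ and $G_\nu(s)=s^{2\nu}\log s$ if $\nu\in\mathbb Z$. Let $\varphi:\mathbb R\to\mathbb R$ be twice continuously differentiable with $\varphi(0)=0$, $\varphi(1)=1$ and $\min_{0\le s\le1}\varphi'(s)>0$. For $n\ge2$ put $t_i=t_{n,i}=\varphi((i-1)/(n-1))$ and $X_i=X(t_i)$, $1\le i\le n$. Fix $\theta\in\{1,2\}$ and an integer $\ell\ge1$. For $n>\theta\ell$ and $1\le i\le n-\theta\ell$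 let $$a_{\theta,\ell;i,k}=\frac{\ell!}{\prod_{0\le j\le\ell,\,j\ne k}(t_{i+\theta k}-t_{i+\theta j})}\quad(0\le k\le\ell),\qquad \nabla_{\theta,\ell}X_i=\sum_{k=0}^{\ell}a_{\theta,\ell;i,k}X_{i+\theta k},$$ $$V_{\theta,\ell}=\sum_{i=1}^{n-\theta\ell}(\nabla_{\theta,\ell}X_i)^2,\qquad f_{\theta,\ell}(\nu)=2\beta_\nu^*\sum_{i=1}^{n-\theta\ell}\ \sum_{0\le k_1<k_2\le\ell}a_{\theta,\ell;i,k_1}a_{\theta,\ell;i,k_2}G_\nu(t_{i+\theta k_2}-t_{i+\theta k_1}).$$ Write $a_n\sim b_n$ if $a_n/b_n\to1$, and $a_n\asymp b_n$ if $0<\liminf a_n/b_n\le\limsup a_n/b_n<\infty$. All asymptotic statements are for $n\to\infty$ with everything else fixed. In each part, "$\tilde K^{(2\ell)}$ is continuous on an interval" means that $\tilde K$ has derivatives up to order $2\ell$ there and that the last one is continuous. (a) Suppose $0<\nu<\ell\le10$. Then $E(V_{\theta,\ell})\sim f_{\theta,\ell}(\nu)\asymp n^{2\ell+1-2\nu}$.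 If, in addition, $\tilde K^{(2\ell)}$ is continuous on an open interval containing $(0,1]$ and $|\tilde K^{(2\ell)}(t)|\le C_\ell t^{2\nu-2\ell}$ for all $t\in(0,1]$ and some constant $C_\ell$, then $$\operatorname{Var}\{V_{\theta,\ell}/E(V_{\theta,\ell})\}=\begin{cases}O(n^{-1}),&\nu<(4\ell-1)/4,\\ O(n^{-1}\log n),&\nu=(4\ell-1)/4,\\ O(n^{-4\ell+4\nu}),&\nu>(4\ell-1)/4,\end{cases}$$ and $V_{\theta,\ell}/E(V_{\theta,\ell})\to1$ almost surely. (b) Suppose $\nu=\ell$. Then $E(V_{\theta,\ell})\sim(-1)^{\ell+1}\beta_\ell^*(2\ell)!\,n\log n$. If, in addition, $\tilde K^{(2\ell)}$ is continuous on an open interval containing $(0,1]$ and $|\tilde K^{(2\ell)}(t)|\le C_\ell\log(2/t)$ for all $t\in(0,1]$ and some constant $C_\ell$, then $\operatorname{Var}\{V_{\theta,\ell}/E(V_{\theta,\ell})\}=O(\log^{-2}n)$. (c) Suppose $\nu>\ell$. Then $E(V_{\theta,\ell})\sim(-1)^{\ell}\beta_\ell(2\ell)!\,n$. If, in addition, $\tilde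 K^{(2\ell)}$ is continuous and not identically $0$ on an open interval containing $(0,1]$, then $\liminf_{n\to\infty}\operatorname{Var}\{V_{\theta,\ell}/E(V_{\theta,\ell})\}>0$. -/

import Mathlib

open MeasureTheory ProbabilityTheory Filter Asymptotics Topology

noncomputable section

namespace LineTransect

/-- The principal irregular function `G_ν` on `[0, ∞)`: `G_ν(0) = 0` and, for `s > 0`,
`G_ν(s) = s^{2ν} log s` if `ν` is an integer and `G_ν(s) = s^{2ν}` otherwise. -/
def G (ν s : ℝ) : ℝ :=
  open Classical in
  if s = 0 then 0
  else if ∃ m : ℤ, (m : ℝ) = ν then s ^ (2 * ν) * Real.log s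
  else s ^ (2 * ν)

/-- The stationary covariance `x, y ↦ K (x - y)` has smoothness `ν > 0`, regular coefficients
`β 0, …, β ⌊ν⌋` and irregular coefficient `βs ≠ 0`:
`K t = ∑_{j ≤ ⌊ν⌋} β j |t|^{2j} + βs G_ν(|t|) + r t` with `r t = O(|t|^{2ν+τ})` as `t → 0`, for some
`τ > 0`. (The remainder is the difference of the two sides, so it is a function of `t` alone.) -/
structure HasSmoothness (K : ℝ → ℝ) (ν : ℝ) (β : ℕ → ℝ) (βs : ℝ) : Prop where
  pos : 0 < ν
  irregular_ne_zero : βs ≠ 0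
  expansion : ∃ τ : ℝ, 0 < τ ∧
    (fun t : ℝ => K t -
        (∑ j ∈ Finset.range (⌊ν⌋₊ + 1), β j * |t| ^ (2 * j) + βs * G ν |t|))
      =O[𝓝 0] fun t : ℝ => |t| ^ (2 * ν + τ)

/-- `φ` generates the design: it is `C²`, `φ 0 = 0`, `φ 1 = 1`, and `φ' > 0` on `[0, 1]`
(equivalently, by compactness, the minimum of `φ'` over `[0, 1]` is positive). -/
structure IsDesign (φ : ℝ → ℝ) : Prop where
  contDiff : ContDiff ℝ 2 φ
  map_zero : φ 0 = 0
  map_one : φ 1 = 1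
  deriv_pos : ∀ s ∈ Set.Icc (0 : ℝ) 1, 0 < deriv φ s

/-- The observation sites `t_{n,i} = φ ((i - 1) / (n - 1))`, for `n ≥ 2` and `1 ≤ i ≤ n`. -/
def site (φ : ℝ → ℝ) (n i : ℕ) : ℝ := φ (((i : ℝ) - 1) / ((n : ℝ) - 1))

/-- The coefficient `a_{θ,ℓ;i,k} = ℓ! / ∏_{0 ≤ j ≤ ℓ, j ≠ k} (t_{i+θk} - t_{i+θj})`. -/
def coeff (t : ℕ → ℝ) (θ ℓ i k : ℕ) : ℝ :=
  (ℓ.factorial : ℝ) /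
    ∏ j ∈ (Finset.range (ℓ + 1)).erase k, (t (i + θ * k) - t (i + θ * j))

/-- The generalized increment `∇_{θ,ℓ} x_i = ∑_{k=0}^ℓ a_{θ,ℓ;i,k} x_{i+θk}` of the values
`x_i = x (t_i)` of a path `x` at the sites. -/
def nabla (t : ℕ → ℝ) (θ ℓ : ℕ) (x : ℝ → ℝ) (i : ℕ) : ℝ :=
  ∑ k ∈ Finset.range (ℓ + 1), coeff t θ ℓ i k * x (t (i + θ * k))

/-- The `ℓ`-th order quadratic variation `V_{θ,ℓ} = ∑_{i=1}^{n-θℓ} (∇_{θ,ℓ} X_i)²` based on the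
`n` observations `X (t_{n,1}), …, X (t_{n,n})`. (For `n ≤ θℓ` the sum is empty.) -/
def quadVar {Ω : Type*} (φ : ℝ → ℝ) (X : ℝ → Ω → ℝ) (θ ℓ n : ℕ) (ω : Ω) : ℝ :=
  ∑ i ∈ Finset.Icc 1 (n - θ * ℓ), nabla (site φ n) θ ℓ (fun s => X s ω) i ^ 2

/-- `f_{θ,ℓ}(ν) = 2 βs ∑_{i=1}^{n-θℓ} ∑_{0 ≤ k₁ < k₂ ≤ ℓ} a_{θ,ℓ;i,k₁} a_{θ,ℓ;i,k₂}
G_ν(t_{i+θk₂} - t_{i+θk₁})`, for sample size `n`. -/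
def f (φ : ℝ → ℝ) (βs : ℝ) (θ ℓ : ℕ) (ν : ℝ) (n : ℕ) : ℝ :=
  2 * βs * ∑ i ∈ Finset.Icc 1 (n - θ * ℓ),
    ∑ k₂ ∈ Finset.range (ℓ + 1), ∑ k₁ ∈ Finset.range k₂,
      coeff (site φ n) θ ℓ i k₁ * coeff (site φ n) θ ℓ i k₂ *
        G ν (site φ n (i + θ * k₂) - site φ n (i + θ * k₁))

/-- `a_n ∼ b_n`: `a_n / b_n → 1`. -/
def SimAsymp (a b : ℕ → ℝ) : Prop := Tendsto (fun n => a n / b n) atTop (𝓝 1)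

/-- `a_n ≍ b_n`: `0 < liminf a_n / b_n ≤ limsup a_n / b_n < ∞`, taken in the extended reals. -/
def OrderAsymp (a b : ℕ → ℝ) : Prop :=
  0 < liminf (fun n => ((a n / b n : ℝ) : EReal)) atTop ∧
    limsup (fun n => ((a n / b n : ℝ) : EReal)) atTop < ⊤

/-- `(a, b)` is an open interval containing `(0, 1]` on which the derivatives of `K` up to order `m`
exist and the `m`-th one is continuous. -/
def SmoothOnInterval (K : ℝ → ℝ) (m : ℕ) (a b : ℝ) : Prop :=
  Set.Ioc (0 : ℝ) 1 ⊆ Set.Ioo a b ∧ ContDiffOn ℝ m K (Set.Ioo a b)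

/-- The variance of the normalized quadratic variation `V_{θ,ℓ} / E V_{θ,ℓ}`. -/
def normVar {Ω : Type*} [MeasurableSpace Ω] (P : Measure Ω) (φ : ℝ → ℝ) (X : ℝ → Ω → ℝ)
    (θ ℓ n : ℕ) : ℝ :=
  Var[fun ω => quadVar φ X θ ℓ n ω / P[quadVar φ X θ ℓ n]; P]

end LineTransect

end

open LineTransect

/-!
The increments `∇ X_i` are centred jointly Gaussian, because divided differences annihilate the
constant mean. Their covariance is the double divided difference `ddKernel` of
`(x, y) ↦ K (x - y)`, so that `E V = ∑ i, Cov (∇ X_i, ∇ X_i)` and, diagonalizing the covariance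
matrix (`exists_indep_sum_sq_eq`), `Var V = 2 ∑ i j, Cov (∇ X_i, ∇ X_j) ^ 2`. The theorem is thus a
statement about `K` and the design, up to the almost sure convergence.

*Means.* The nodes of an increment, measured in units of the local spacing `h_i ≍ 1 / n`, converge
to `0, 1, …, ℓ` uniformly in `i` (`IsDesign.tendsto_shape`). A double divided difference of order
`ℓ` kills the powers `|t| ^ (2 j)` with `j < ℓ` and maps `|t| ^ (2 ℓ)` to the constant
`(-1) ^ ℓ (2 ℓ)!`; hence `Var (∇ X_i)` is asymptotically

* `βs Q h_i ^ (2 ν - 2 ℓ)` if `ν < ℓ`, where `Q` is the double divided difference of `G ν |t|` at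
  the nodes `0, …, ℓ`,
* `βs (-1) ^ ℓ (2 ℓ)! log h_i` if `ν = ℓ`, since rescaling `t ^ (2 ℓ) log t` produces a polynomial
  times a logarithm,
* `β ℓ (-1) ^ ℓ (2 ℓ)!` if `ν > ℓ`.

It matters that these constants do not vanish. For `Q` this is an analytic fact
(`ddKernel_G_ne_zero`). For `β ℓ` it comes from positive definiteness
(`HasSmoothness.coeff_ne_zero`): were the mean square `ℓ`-th derivative to vanish, the covariance
would be constant, contradicting `βs ≠ 0`. The signs are then right because variances are
nonnegative.

*Variances.* A covariance of increments with disjoint ranges is, by an iterated Rolle theorem, a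
value of `K^(2ℓ)` at a point comparable to their distance, and the remaining `O(n)` pairs are
handled by the Cauchy–Schwarz inequality. This gives `IsDesign.sumCovSq_le`, and the three regimes
of the rate are those of `∑ m ≤ n, m ^ (-(4 ℓ - 4 ν))`. If `ν > ℓ`, then `K^(2ℓ)` is bounded away
from zero near some point of `(0, 1)`, so a positive proportion of the `n ^ 2` covariances is
bounded below (`IsDesign.exists_le_sumCovSq`).

*Almost sure convergence.* The variance bound alone is not summable in all regimes. A centred
Gaussian quadratic form has exponential moments on the scale of its standard deviation
(`mgf_sum_sq_sub_of_gaussian`), and any polynomial rate for the variance then yields summable tail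
probabilities, so the Borel–Cantelli lemma applies.
-/

noncomputable section

namespace LineTransect

/-! ### Divided differences -/

/-- The weight of the node `u k` in the `ℓ`-th divided difference at the nodes `u 0, …, u ℓ`,
normalized by `ℓ!` so that the divided difference of a smooth function is a value of its `ℓ`-th
derivative. -/
def ddWeight (ℓ : ℕ) (u : ℕ → ℝ) (k : ℕ) : ℝ :=
  (ℓ.factorial : ℝ) / ∏ j ∈ (Finset.range (ℓ + 1)).erase k, (u k - u j)

/-- The double divided difference of `(x, y) ↦ F (x - y)`, at the nodes `u` in `x` and `v` in `y`.
For the covariance function `F` of a stationary process it is the covariance of two generalized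
increments. -/
def ddKernel (ℓ : ℕ) (u v : ℕ → ℝ) (F : ℝ → ℝ) : ℝ :=
  ∑ k ∈ Finset.range (ℓ + 1), ∑ l ∈ Finset.range (ℓ + 1),
    ddWeight ℓ u k * ddWeight ℓ v l * F (u k - v l)

lemma coeff_eq_ddWeight (t : ℕ → ℝ) (θ ℓ i k : ℕ) :
    coeff t θ ℓ i k = ddWeight ℓ (fun m => t (i + θ * m)) k := rfl

/-- Iterated Rolle theorem. -/
theorem exists_iteratedDeriv_eq_zero (n : ℕ) (u : ℕ → ℝ) (hu : ∀ k ≤ n, u k < u (k + 1))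
    (F : ℝ → ℝ) (hc : ContinuousOn F (Set.Icc (u 0) (u (n + 1))))
    (hF : ContDiffOn ℝ (n + 1 : ℕ) F (Set.Ioo (u 0) (u (n + 1))))
    (h0 : ∀ k ≤ n + 1, F (u k) = 0) :
    ∃ ξ ∈ Set.Ioo (u 0) (u (n + 1)), iteratedDeriv (n + 1) F ξ = 0 := by
  have hle : ∀ n : ℕ, ∀ u : ℕ → ℝ, (∀ k ≤ n, u k < u (k + 1)) → ∀ i j, i ≤ j → j ≤ n + 1 →
      u i ≤ u j := by
    intro n u hu i j hij
    induction j, hij using Nat.le_induction with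
    | base => intro _; exact le_rfl
    | succ m hm ih => intro hj; exact (ih (by omega)).trans (hu m (by omega)).le
  induction n generalizing u F with
  | zero =>
    obtain ⟨ξ, hξ, h⟩ := exists_deriv_eq_zero (hu 0 le_rfl) hc
      (by rw [h0 0 (by omega), h0 (0 + 1) le_rfl])
    exact ⟨ξ, hξ, by rw [zero_add, iteratedDeriv_one]; exact h⟩
  | succ n ih =>
    have hv : ∀ k : ℕ, ∃ v, k ≤ n + 1 → v ∈ Set.Ioo (u k) (u (k + 1)) ∧ deriv F v = 0 := by
      intro k
      by_cases hk : k ≤ n + 1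
      · obtain ⟨ξ, hξ, h⟩ := exists_deriv_eq_zero (hu k hk)
          (hc.mono (Set.Icc_subset_Icc (hle _ u hu 0 k (by omega) (by omega))
            (hle _ u hu (k + 1) (n + 1 + 1) (by omega) (by omega))))
          (by rw [h0 k (by omega), h0 (k + 1) (by omega)])
        exact ⟨ξ, fun _ => ⟨hξ, h⟩⟩
      · exact ⟨0, fun h => absurd h hk⟩
    choose v hv using hv
    have hlo : u 0 < v 0 := (hv 0 (by omega)).1.1
    have hhi : v (n + 1) < u (n + 1 + 1) := (hv (n + 1) (by omega)).1.2
    have hderiv : ContDiffOn ℝ (n + 1 : ℕ) (deriv F) (Set.Ioo (u 0) (u (n + 1 + 1))) :=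
      hF.deriv_of_isOpen isOpen_Ioo (by norm_cast)
    obtain ⟨ξ, hξ, h⟩ := ih v (fun k hk => (hv k (by omega)).1.2.trans (hv (k + 1) (by omega)).1.1)
      (deriv F)
      (hderiv.continuousOn.mono fun x hx => ⟨hlo.trans_le hx.1, hx.2.trans_lt hhi⟩)
      (hderiv.mono (Set.Ioo_subset_Ioo hlo.le hhi.le))
      (fun k hk => (hv k hk).2)
    exact ⟨ξ, ⟨hlo.trans hξ.1, hξ.2.trans hhi⟩, by rw [iteratedDeriv_succ']; exact h⟩

lemma iteratedDeriv_polynomial_eval (p : Polynomial ℝ) (k : ℕ) :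
    iteratedDeriv k (fun x => p.eval x) = fun x => (Polynomial.derivative^[k] p).eval x := by
  induction k generalizing p with
  | zero => simp
  | succ k ih =>
    rw [iteratedDeriv_succ', Function.iterate_succ_apply, ← ih]
    congr 1
    ext x
    exact p.deriv

/-- The mean value theorem for divided differences. Only continuity is asked for at the two extreme
nodes: this is needed for functions such as `x ↦ x ^ ν` at the node `0`. -/
theorem exists_sum_ddWeight_eq_iteratedDeriv (ℓ : ℕ) (hℓ : 1 ≤ ℓ) (u : ℕ → ℝ)
    (hu : ∀ k < ℓ, u k < u (k + 1)) (F : ℝ → ℝ) (hc : ContinuousOn F (Set.Icc (u 0) (u ℓ)))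
    (hF : ContDiffOn ℝ ℓ F (Set.Ioo (u 0) (u ℓ))) :
    ∃ ξ ∈ Set.Ioo (u 0) (u ℓ),
      ∑ k ∈ Finset.range (ℓ + 1), ddWeight ℓ u k * F (u k) = iteratedDeriv ℓ F ξ := by
  obtain ⟨n, rfl⟩ : ∃ n, ℓ = n + 1 := ⟨ℓ - 1, by omega⟩
  have hmono : StrictMonoOn u (Set.Icc 0 (n + 1)) := by
    refine strictMonoOn_of_lt_succ Set.ordConnected_Icc ?_
    intro a _ ha ha'
    exact hu a (by simpa using ha'.2)
  have hinj : Set.InjOn u (Finset.range (n + 1 + 1)) := by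
    refine hmono.injOn.mono fun k hk => ?_
    simp only [Finset.coe_range, Set.mem_Iio] at hk
    exact ⟨Nat.zero_le _, by omega⟩
  set p := Lagrange.interpolate (Finset.range (n + 1 + 1)) u (fun k => F (u k)) with hp
  have hpc : ContDiff ℝ (n + 1 : ℕ) fun x => p.eval x := by
    simpa [Polynomial.coe_aeval_eq_eval] using p.contDiff_aeval (𝕜 := ℝ) (n + 1 : ℕ)
  obtain ⟨ξ, hξ, h⟩ := exists_iteratedDeriv_eq_zero n u (fun k hk => hu k (by omega))
    (F - fun x => p.eval x) (hc.sub p.continuous.continuousOn)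
    (hF.sub hpc.contDiffOn) (fun k hk => by
      rw [Pi.sub_apply, hp, Lagrange.eval_interpolate_at_node _ hinj
        (Finset.mem_range.2 (by omega)), sub_self])
  refine ⟨ξ, hξ, ?_⟩
  rw [iteratedDeriv_sub (hF.contDiffAt (isOpen_Ioo.mem_nhds hξ)) hpc.contDiffAt,
    iteratedDeriv_polynomial_eval, sub_eq_zero] at h
  rw [h, hp, Lagrange.iterate_derivative_interpolate _ hinj (by simp)]
  simp only [ddWeight, Finset.card_range, Nat.sub_self, Finset.powersetCard_zero,
    Finset.sum_singleton, Finset.prod_empty, mul_one, Polynomial.eval_mul,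
    Polynomial.eval_natCast, Polynomial.eval_finsetSum, Polynomial.eval_C, Finset.mul_sum]
  exact Finset.sum_congr rfl fun k _ => by ring

/-- The mean value theorem for double divided differences: the double divided difference of
`(x, y) ↦ F (x - y)` is `(-1) ^ ℓ` times a value of the `2ℓ`-th derivative of `F`. -/
theorem exists_ddKernel_eq_iteratedDeriv (ℓ : ℕ) (hℓ : 1 ≤ ℓ) (u v : ℕ → ℝ)
    (hu : ∀ k < ℓ, u k < u (k + 1)) (hv : ∀ k < ℓ, v k < v (k + 1)) (F : ℝ → ℝ) (a b : ℝ)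
    (hF : ContDiffOn ℝ (2 * ℓ : ℕ) F (Set.Ioo a b)) (ha : a < u 0 - v ℓ) (hb : u ℓ - v 0 < b) :
    ∃ ξ ∈ Set.Ioo (u 0) (u ℓ), ∃ η ∈ Set.Ioo (v 0) (v ℓ),
      ddKernel ℓ u v F = (-1) ^ ℓ * iteratedDeriv (2 * ℓ) F (ξ - η) := by
  have hle : ∀ w : ℕ → ℝ, (∀ k < ℓ, w k < w (k + 1)) → ∀ k ≤ ℓ, w 0 ≤ w k ∧ w k ≤ w ℓ := by
    intro w hw
    have hmono : StrictMonoOn w (Set.Icc 0 ℓ) := by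
      refine strictMonoOn_of_lt_succ Set.ordConnected_Icc ?_
      intro a _ ha ha'
      exact hw a (by simpa using ha'.2)
    exact fun k hk => ⟨hmono.monotoneOn ⟨le_rfl, Nat.zero_le _⟩ ⟨Nat.zero_le _, hk⟩ (Nat.zero_le _),
      hmono.monotoneOn ⟨Nat.zero_le _, hk⟩ ⟨Nat.zero_le _, le_rfl⟩ hk⟩
  have hFl : ContDiffOn ℝ ℓ F (Set.Ioo a b) := hF.of_le (by norm_cast; omega)
  have hD : ContDiffOn ℝ ℓ (iteratedDeriv ℓ F) (Set.Ioo a b) := by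
    have h2 : ∀ m k : ℕ, ∀ F : ℝ → ℝ, ContDiffOn ℝ (m + k : ℕ) F (Set.Ioo a b) →
        ContDiffOn ℝ m (iteratedDeriv k F) (Set.Ioo a b) := by
      intro m k
      induction k with
      | zero => intro F h; simpa using h
      | succ k ih =>
        intro F h
        rw [iteratedDeriv_succ']
        exact ih _ (h.deriv_of_isOpen isOpen_Ioo (by norm_cast))
    exact h2 ℓ ℓ F (by rwa [← two_mul])
  set g : ℝ → ℝ := fun x => ∑ l ∈ Finset.range (ℓ + 1), ddWeight ℓ v l * F (x - v l) with hg
  have hmem : ∀ x ∈ Set.Icc (u 0) (u ℓ), ∀ l ∈ Finset.range (ℓ + 1), x - v l ∈ Set.Ioo a b := by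
    intro x hx l hl
    have := hle v hv l (by simpa [Nat.lt_succ_iff] using hl)
    exact ⟨by linarith [hx.1, this.2], by linarith [hx.2, this.1]⟩
  have hshift : ∀ x ∈ Set.Icc (u 0) (u ℓ), ∀ l ∈ Finset.range (ℓ + 1),
      ContDiffAt ℝ ℓ (fun x => ddWeight ℓ v l * F (x - v l)) x := by
    intro x hx l hl
    exact contDiffAt_const.mul ((hFl.contDiffAt (isOpen_Ioo.mem_nhds (hmem x hx l hl))).comp x
      (contDiffAt_id.sub contDiffAt_const))
  have hgc : ∀ x ∈ Set.Icc (u 0) (u ℓ), ContDiffAt ℝ ℓ g x := fun x hx =>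
    ContDiffAt.sum fun l hl => hshift x hx l hl
  obtain ⟨ξ, hξ, h1⟩ := exists_sum_ddWeight_eq_iteratedDeriv ℓ hℓ u hu g
    (fun x hx => (hgc x hx).continuousAt.continuousWithinAt)
    (fun x hx => (hgc x (Set.Ioo_subset_Icc_self hx)).contDiffWithinAt)
  have hξ' := Set.Ioo_subset_Icc_self hξ
  have h2 : iteratedDeriv ℓ g ξ
      = ∑ l ∈ Finset.range (ℓ + 1), ddWeight ℓ v l * iteratedDeriv ℓ F (ξ - v l) := by
    rw [hg, iteratedDeriv_fun_sum (fun l hl => hshift ξ hξ' l hl)]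
    refine Finset.sum_congr rfl fun l hl => ?_
    rw [iteratedDeriv_const_mul_field, iteratedDeriv_comp_sub_const]
  have hcs : ∀ y ∈ Set.Icc (v 0) (v ℓ), ξ - y ∈ Set.Ioo a b := fun y hy =>
    ⟨by linarith [hξ.1, hy.2], by linarith [hξ.2, hy.1]⟩
  have hgc2 : ∀ y ∈ Set.Icc (v 0) (v ℓ), ContDiffAt ℝ ℓ (fun y => iteratedDeriv ℓ F (ξ - y)) y :=
    fun y hy => (hD.contDiffAt (isOpen_Ioo.mem_nhds (hcs y hy))).comp y
      (contDiffAt_const.sub contDiffAt_id)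
  obtain ⟨η, hη, h3⟩ := exists_sum_ddWeight_eq_iteratedDeriv ℓ hℓ v hv
    (fun y => iteratedDeriv ℓ F (ξ - y))
    (fun x hx => (hgc2 x hx).continuousAt.continuousWithinAt)
    (fun x hx => (hgc2 x (Set.Ioo_subset_Icc_self hx)).contDiffWithinAt)
  refine ⟨ξ, hξ, η, hη, ?_⟩
  rw [h2, h3, iteratedDeriv_comp_const_sub] at h1
  have h4 : iteratedDeriv ℓ (iteratedDeriv ℓ F) = iteratedDeriv (2 * ℓ) F := by
    rw [iteratedDeriv_eq_iterate, iteratedDeriv_eq_iterate, iteratedDeriv_eq_iterate,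
      ← Function.iterate_add_apply, two_mul]
  simp only [h4, smul_eq_mul] at h1
  rw [← h1, ddKernel]
  refine Finset.sum_congr rfl fun k _ => ?_
  rw [hg, Finset.mul_sum]
  exact Finset.sum_congr rfl fun l _ => by ring

/-- Double divided differences see an even power `|t| ^ (2j)` only if `j ≥ ℓ`; for `j = ℓ` the value
does not depend on the nodes. -/
theorem ddKernel_abs_pow (ℓ : ℕ) (hℓ : 1 ≤ ℓ) (u v : ℕ → ℝ)
    (hu : ∀ k < ℓ, u k < u (k + 1)) (hv : ∀ k < ℓ, v k < v (k + 1)) (j : ℕ) (hj : j ≤ ℓ) :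
    ddKernel ℓ u v (fun t => |t| ^ (2 * j)) =
      if j = ℓ then (-1) ^ ℓ * ((2 * ℓ).factorial : ℝ) else 0 := by
  have habs : (fun t : ℝ => |t| ^ (2 * j)) = fun t => t ^ (2 * j) := by
    ext t; rw [pow_mul, pow_mul, sq_abs]
  obtain ⟨ξ, -, η, -, h⟩ := exists_ddKernel_eq_iteratedDeriv ℓ hℓ u v hu hv
    (fun t => |t| ^ (2 * j)) (u 0 - v ℓ - 1) (u ℓ - v 0 + 1)
    (by rw [habs]; fun_prop) (by linarith) (by linarith)
  rw [h, habs, show (fun t : ℝ => t ^ (2 * j)) = (· ^ (2 * j)) from rfl, iteratedDeriv_pow]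
  split_ifs with hjl
  · subst hjl
    simp [Nat.descFactorial_self]
  · rw [Nat.descFactorial_of_lt (by omega)]
    simp

lemma ddWeight_scale (ℓ : ℕ) (u : ℕ → ℝ) (c h : ℝ) (hh : h ≠ 0) (k : ℕ) (hk : k ≤ ℓ) :
    ddWeight ℓ (fun m => c + h * u m) k = (h ^ ℓ)⁻¹ * ddWeight ℓ u k := by
  unfold ddWeight
  have h1 : ∀ j ∈ (Finset.range (ℓ + 1)).erase k,
      (c + h * u k - (c + h * u j)) = h * (u k - u j) := fun j _ => by ring
  rw [Finset.prod_congr rfl h1, Finset.prod_mul_distrib, Finset.prod_const,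
    Finset.card_erase_of_mem (Finset.mem_range.2 (by omega)), Finset.card_range,
    Nat.add_sub_cancel]
  field_simp

lemma ddKernel_scale (ℓ : ℕ) (u : ℕ → ℝ) (c h : ℝ) (hh : h ≠ 0) (F : ℝ → ℝ) :
    ddKernel ℓ (fun m => c + h * u m) (fun m => c + h * u m) F =
      (h ^ (2 * ℓ))⁻¹ * ddKernel ℓ u u (fun x => F (h * x)) := by
  unfold ddKernel
  simp only [Finset.mul_sum]
  refine Finset.sum_congr rfl fun k hk => Finset.sum_congr rfl fun l hl => ?_
  rw [ddWeight_scale ℓ u c h hh k (by have := Finset.mem_range.1 hk; omega),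
    ddWeight_scale ℓ u c h hh l (by have := Finset.mem_range.1 hl; omega),
    show c + h * u k - (c + h * u l) = h * (u k - u l) by ring]
  rw [two_mul, pow_add, mul_inv]
  ring

lemma tendsto_ddWeight {α : Type*} {L : Filter α} (ℓ : ℕ) (U : α → ℕ → ℝ) (u : ℕ → ℝ)
    (hu : ∀ k ≤ ℓ, ∀ j ≤ ℓ, k ≠ j → u k ≠ u j)
    (hU : ∀ k ≤ ℓ, Tendsto (fun p => U p k) L (𝓝 (u k))) (k : ℕ) (hk : k ≤ ℓ) :
    Tendsto (fun p => ddWeight ℓ (U p) k) L (𝓝 (ddWeight ℓ u k)) := by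
  unfold ddWeight
  refine tendsto_const_nhds.div (tendsto_finsetProd _ fun j hj => ?_) ?_
  · exact (hU k hk).sub (hU j (by
      have := Finset.mem_range.1 (Finset.mem_of_mem_erase hj); omega))
  · refine Finset.prod_ne_zero_iff.2 fun j hj => sub_ne_zero.2 ?_
    exact hu k hk j (by have := Finset.mem_range.1 (Finset.mem_of_mem_erase hj); omega)
      (Finset.ne_of_mem_erase hj).symm

lemma ddKernel_add (ℓ : ℕ) (u v : ℕ → ℝ) (F G : ℝ → ℝ) :
    ddKernel ℓ u v (fun t => F t + G t) = ddKernel ℓ u v F + ddKernel ℓ u v G := by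
  simp only [ddKernel, mul_add, Finset.sum_add_distrib]

lemma ddKernel_const_mul (ℓ : ℕ) (u v : ℕ → ℝ) (c : ℝ) (F : ℝ → ℝ) :
    ddKernel ℓ u v (fun t => c * F t) = c * ddKernel ℓ u v F := by
  simp only [ddKernel, Finset.mul_sum]
  exact Finset.sum_congr rfl fun _ _ => Finset.sum_congr rfl fun _ _ => by ring

lemma ddKernel_sum {ι : Type*} (s : Finset ι) (ℓ : ℕ) (u v : ℕ → ℝ) (F : ι → ℝ → ℝ) :
    ddKernel ℓ u v (fun t => ∑ j ∈ s, F j t) = ∑ j ∈ s, ddKernel ℓ u v (F j) := by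
  classical
  induction s using Finset.induction_on with
  | empty => simp [ddKernel]
  | insert a s ha ih => simp only [Finset.sum_insert ha, ddKernel_add, ih]

/-! ### The principal irregular function -/

lemma G_zero (ν : ℝ) : G ν 0 = 0 := by simp [G]

lemma G_of_natCast (m : ℕ) (s : ℝ) :
    G (m : ℝ) s = s ^ (2 * m) * Real.log s := by
  unfold G
  split_ifs with h1 h2
  · simp [h1]
  · rw [show (2 * (m : ℝ)) = ((2 * m : ℕ) : ℝ) by push_cast; ring, Real.rpow_natCast]
  · exact absurd ⟨(m : ℤ), by simp⟩ h2

lemma G_of_not_int {ν : ℝ} (hν : 0 < ν) (h : ¬ ∃ m : ℤ, (m : ℝ) = ν) (s : ℝ) :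
    G ν s = s ^ (2 * ν) := by
  unfold G
  split_ifs with h1
  · rw [h1, Real.zero_rpow (by positivity)]
  · rfl

/-- A positive real is either a positive natural number or not an integer. -/
lemma natCast_or_not_int {ν : ℝ} (hν : 0 < ν) :
    (∃ m : ℕ, 1 ≤ m ∧ ν = m) ∨ ¬ ∃ m : ℤ, (m : ℝ) = ν := by
  by_cases h : ∃ m : ℤ, (m : ℝ) = ν
  · left
    obtain ⟨m, hm⟩ := h
    have hm0 : 0 < m := by rw [← hm] at hν; exact_mod_cast hν
    refine ⟨m.toNat, by omega, ?_⟩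
    rw [← hm]
    have : ((m.toNat : ℤ) : ℝ) = m := by rw [Int.toNat_of_nonneg hm0.le]
    exact_mod_cast this.symm
  · exact Or.inr h

lemma continuousAt_G {ν s : ℝ} (hν : 0 < ν) (hs : 0 < s) : ContinuousAt (G ν) s := by
  rcases natCast_or_not_int hν with ⟨m, hm, rfl⟩ | h
  · have : G (m : ℝ) =ᶠ[𝓝 s] fun s => s ^ (2 * m) * Real.log s := by
      exact Eventually.of_forall (G_of_natCast m)
    refine ContinuousAt.congr ?_ this.symm
    exact (continuousAt_id.pow _).mul (Real.continuousAt_log hs.ne')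
  · have : G ν = fun s => s ^ (2 * ν) := funext (G_of_not_int hν h)
    rw [this]
    exact Real.continuousAt_rpow_const _ _ (Or.inl hs.ne')

/-- Rescaling the nodes rescales the irregular part of a double divided difference of order above
`ν`: the logarithmic term produced by the scaling is a polynomial, which is annihilated. -/
lemma ddKernel_G_scale_of_lt {ν : ℝ} (hν : 0 < ν) (ℓ : ℕ) (hνℓ : ν < ℓ) (u : ℕ → ℝ)
    (hu : ∀ k < ℓ, u k < u (k + 1)) (h : ℝ) (hh : 0 < h) :
    ddKernel ℓ u u (fun x => G ν |h * x|) = h ^ (2 * ν) * ddKernel ℓ u u (fun x => G ν |x|) := by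
  have hℓ : 1 ≤ ℓ := by
    have : (0 : ℝ) < ℓ := hν.trans hνℓ
    exact_mod_cast this
  rw [← ddKernel_const_mul]
  rcases natCast_or_not_int hν with ⟨m, hm, rfl⟩ | hint
  · have : (fun x => G (m : ℝ) |h * x|) = fun x => h ^ (2 * (m : ℝ)) * G (m : ℝ) |x| +
        (h ^ (2 * m) * Real.log h) * |x| ^ (2 * m) := by
      ext x
      rw [G_of_natCast m, G_of_natCast m,
        show (2 * (m : ℝ)) = ((2 * m : ℕ) : ℝ) by push_cast; ring, Real.rpow_natCast, abs_mul,
        abs_of_pos hh]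
      by_cases hx : x = 0
      · simp [hx, show m ≠ 0 by omega]
      · rw [Real.log_mul hh.ne' (abs_ne_zero.2 hx)]
        ring
    rw [this, ddKernel_add, ddKernel_const_mul ℓ u u (h ^ (2 * m) * Real.log h),
      ddKernel_abs_pow ℓ hℓ u u hu hu m (by exact_mod_cast hνℓ.le),
      if_neg (by rintro rfl; exact lt_irrefl _ hνℓ), mul_zero, add_zero]
  · congr 1
    ext x
    rw [G_of_not_int hν hint, G_of_not_int hν hint, abs_mul, abs_of_pos hh,
      Real.mul_rpow hh.le (abs_nonneg _)]

/-- At the critical order `ℓ = ν` the scaling leaves a logarithm behind. -/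
lemma ddKernel_G_scale_of_eq (ℓ : ℕ) (hℓ : 1 ≤ ℓ) (u : ℕ → ℝ)
    (hu : ∀ k < ℓ, u k < u (k + 1)) (h : ℝ) (hh : 0 < h) :
    ddKernel ℓ u u (fun x => G (ℓ : ℝ) |h * x|) = h ^ (2 * ℓ) *
      (ddKernel ℓ u u (fun x => G (ℓ : ℝ) |x|) +
        Real.log h * ((-1) ^ ℓ * ((2 * ℓ).factorial : ℝ))) := by
  have : (fun x => G (ℓ : ℝ) |h * x|) = fun x => h ^ (2 * ℓ) * (G (ℓ : ℝ) |x| +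
      Real.log h * |x| ^ (2 * ℓ)) := by
    ext x
    rw [G_of_natCast ℓ, G_of_natCast ℓ, abs_mul,
      abs_of_pos hh]
    by_cases hx : x = 0
    · simp [hx, show ℓ ≠ 0 by omega]
    · rw [Real.log_mul hh.ne' (abs_ne_zero.2 hx)]
      ring
  rw [this, ddKernel_const_mul, ddKernel_add, ddKernel_const_mul ℓ u u (Real.log h),
    ddKernel_abs_pow ℓ hℓ u u hu hu ℓ le_rfl, if_pos rfl]

lemma tendsto_ddKernel_G {α : Type*} {L : Filter α} {ν : ℝ} (hν : 0 < ν) (ℓ : ℕ)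
    (U : α → ℕ → ℝ) (hU : ∀ k ≤ ℓ, Tendsto (fun p => U p k) L (𝓝 (k : ℝ))) :
    Tendsto (fun p => ddKernel ℓ (U p) (U p) (fun x => G ν |x|)) L
      (𝓝 (ddKernel ℓ (fun k => (k : ℝ)) (fun k => (k : ℝ)) (fun x => G ν |x|))) := by
  have hw := tendsto_ddWeight ℓ U (fun k => (k : ℝ))
    (fun k _ j _ hkj => by exact_mod_cast hkj) hU
  unfold ddKernel
  refine tendsto_finsetSum _ fun k hk => tendsto_finsetSum _ fun l hl => ?_
  have hk' : k ≤ ℓ := by have := Finset.mem_range.1 hk; omega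
  have hl' : l ≤ ℓ := by have := Finset.mem_range.1 hl; omega
  refine ((hw k hk').mul (hw l hl')).mul ?_
  by_cases hkl : k = l
  · subst hkl
    simpa [G_zero] using tendsto_const_nhds
  · have h0 : 0 < |(k : ℝ) - l| := abs_pos.2 (sub_ne_zero.2 (by exact_mod_cast hkl))
    exact (continuousAt_G hν h0).tendsto.comp ((hU k hk').sub (hU l hl')).abs

/-! ### The leading constant does not vanish -/

lemma iteratedDeriv_pow_mul_log_ne_zero (m n : ℕ) (hmn : m < n) (x : ℝ) (hx : 0 < x) :
    iteratedDeriv n (fun x => x ^ m * Real.log x) x ≠ 0 := by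
  induction m generalizing n with
  | zero =>
    obtain ⟨n, rfl⟩ : ∃ k, n = k + 1 := ⟨n - 1, by omega⟩
    have : deriv (fun x : ℝ => x ^ 0 * Real.log x) = Inv.inv := by
      simp only [pow_zero, one_mul]
      exact Real.deriv_log'
    rw [iteratedDeriv_succ', this, iteratedDeriv_eq_iterate, iter_deriv_inv']
    have : x ^ (-1 - n : ℤ) ≠ 0 := zpow_ne_zero _ hx.ne'
    have h2 : (n.factorial : ℝ) ≠ 0 := by exact_mod_cast n.factorial_ne_zero
    simp [this, h2]
  | succ m ih =>
    obtain ⟨n, rfl⟩ : ∃ k, n = k + 1 := ⟨n - 1, by omega⟩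
    have h1 : deriv (fun x : ℝ => x ^ (m + 1) * Real.log x) =ᶠ[𝓝 x]
        (fun x => ((m : ℝ) + 1) * (x ^ m * Real.log x)) + fun x => x ^ m := by
      filter_upwards [lt_mem_nhds hx] with y hy
      have := ((hasDerivAt_pow (m + 1) y).mul (Real.hasDerivAt_log hy.ne')).deriv
      rw [show (fun x : ℝ => x ^ (m + 1) * Real.log x) = (fun x => x ^ (m + 1)) * Real.log from rfl,
        this]
      simp only [Nat.cast_add, Nat.cast_one, Nat.add_sub_cancel, Pi.add_apply]
      field_simp
      ring
    have hlog : ContDiffAt ℝ n (fun x : ℝ => x ^ m * Real.log x) x :=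
      (contDiffAt_id.pow m).mul (Real.contDiffAt_log.2 hx.ne')
    have hpow : ContDiffAt ℝ n (fun x : ℝ => x ^ m) x := contDiffAt_id.pow m
    rw [iteratedDeriv_succ', h1.iteratedDeriv_eq, iteratedDeriv_add
      (contDiffAt_const.mul hlog) hpow, iteratedDeriv_const_mul_field,
      show (fun x : ℝ => x ^ m) = (· ^ m) from rfl, iteratedDeriv_pow,
      Nat.descFactorial_of_lt (by omega)]
    have := ih n (by omega)
    have hm : (m : ℝ) + 1 ≠ 0 := by positivity
    simp only [Nat.cast_zero, zero_mul, add_zero]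
    exact mul_ne_zero hm this

lemma iteratedDeriv_rpow_ne_zero {ν : ℝ} (h : ¬ ∃ m : ℤ, (m : ℝ) = ν) (n : ℕ) (x : ℝ)
    (hx : 0 < x) : iteratedDeriv n (fun x => x ^ ν) x ≠ 0 := by
  rw [iteratedDeriv_eq_iterate, Real.iter_deriv_rpow_const]
  refine mul_ne_zero ?_ (Real.rpow_pos_of_pos hx _).ne'
  rw [descPochhammer_eval_eq_prod_range]
  refine Finset.prod_ne_zero_iff.2 fun j _ hj => h ⟨j, ?_⟩
  push_cast
  linarith

/-- There is a function `g` of `x = t²`, smooth and with non-vanishing `ℓ`-th derivative on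
`(0, ∞)`, such that `G_ν(|t|) = g (t²)`. -/
lemma exists_G_eq_comp_sq {ν : ℝ} (hν : 0 < ν) (ℓ : ℕ) (hνℓ : ν < ℓ) :
    ∃ g : ℝ → ℝ, (∀ t, G ν |t| = g (t ^ 2)) ∧ ContinuousOn g (Set.Ici 0) ∧
      ContDiffOn ℝ ℓ g (Set.Ioi 0) ∧ ∀ x, 0 < x → iteratedDeriv ℓ g x ≠ 0 := by
  rcases natCast_or_not_int hν with ⟨m, hm, rfl⟩ | hint
  · refine ⟨fun x => (1 / 2) * (x ^ m * Real.log x), fun t => ?_, ?_, ?_, fun x hx => ?_⟩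
    · simp only [G_of_natCast m, Real.log_pow, pow_mul, sq_abs, Real.log_abs]
      push_cast
      ring
    · obtain ⟨k, rfl⟩ : ∃ k, m = k + 1 := ⟨m - 1, by omega⟩
      have : (fun x : ℝ => (1 / 2) * (x ^ (k + 1) * Real.log x)) =
          fun x => (1 / 2) * (x ^ k * (x * Real.log x)) := by ext x; ring
      rw [this]
      exact (continuous_const.mul ((continuous_pow k).mul Real.continuous_mul_log)).continuousOn
    · exact fun x hx => (contDiffAt_const.mul ((contDiffAt_id.pow m).mul
        (Real.contDiffAt_log.2 (ne_of_gt hx)))).contDiffWithinAt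
    · rw [iteratedDeriv_const_mul_field]
      exact mul_ne_zero (by norm_num)
        (iteratedDeriv_pow_mul_log_ne_zero m ℓ (by exact_mod_cast hνℓ) x hx)
  · refine ⟨fun x => x ^ ν, fun t => ?_, ?_, ?_, fun x hx => ?_⟩
    · rw [G_of_not_int hν hint, Real.rpow_mul (abs_nonneg _), ← sq_abs]
      norm_cast
    · exact (Real.continuous_rpow_const hν.le).continuousOn
    · exact fun x hx =>
        (Real.contDiffAt_rpow_const_of_ne (ne_of_gt hx)).contDiffWithinAt
    · exact iteratedDeriv_rpow_ne_zero hint ℓ x hx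

/-- For `0 < ν < ℓ` the double divided difference of `G_ν(|t|)` at the nodes `0, 1, …, ℓ` is not
zero. As a functional of a function `g` of `x = t²` it depends on the values of `g` at the `ℓ + 1`
points `0, 1, 4, …, ℓ²` and annihilates polynomials of degree less than `ℓ`; hence it is a nonzero
multiple of the divided difference of `g` at these points, which is a value of the `ℓ`-th
derivative of `g`. -/
theorem ddKernel_G_ne_zero {ν : ℝ} (hν : 0 < ν) (ℓ : ℕ) (hνℓ : ν < ℓ) :
    ddKernel ℓ (fun k => (k : ℝ)) (fun k => (k : ℝ)) (fun x => G ν |x|) ≠ 0 := by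
  have hℓ : 1 ≤ ℓ := by
    have : (0 : ℝ) < ℓ := hν.trans hνℓ
    exact_mod_cast this
  obtain ⟨g, hg, hgc, hgd, hg0⟩ := exists_G_eq_comp_sq hν ℓ hνℓ
  set v : ℕ → ℝ := fun d => (d : ℝ) ^ 2 with hv
  have hvlt : ∀ k < ℓ, v k < v (k + 1) := fun k _ => by
    simp only [hv]; push_cast; nlinarith [(Nat.cast_nonneg k : (0 : ℝ) ≤ k)]
  have hinj : Set.InjOn v (Finset.range (ℓ + 1)) := by
    intro i _ j _ hij
    have := (sq_eq_sq₀ (Nat.cast_nonneg i) (Nat.cast_nonneg j)).1 hij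
    exact_mod_cast this
  set p := Lagrange.interpolate (Finset.range (ℓ + 1)) v (fun d => g (v d)) with hp
  have hdeg : p.degree < (Finset.range (ℓ + 1)).card := Lagrange.degree_interpolate_lt _ hinj
  have hpe : ∀ d ≤ ℓ, p.eval (v d) = g (v d) := fun d hd =>
    Lagrange.eval_interpolate_at_node _ hinj (Finset.mem_range.2 (by omega))
  have hcoeff := Lagrange.coeff_eq_sum hinj hdeg
  rw [Finset.card_range, Nat.add_sub_cancel] at hcoeff
  have hnat : p.natDegree < ℓ + 1 := by
    rw [Finset.card_range] at hdeg
    rcases eq_or_ne p 0 with h | h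
    · simp [h]
    · exact (Polynomial.natDegree_lt_iff_degree_lt h).2 (by exact_mod_cast hdeg)
  have h1 : ddKernel ℓ (fun k => (k : ℝ)) (fun k => (k : ℝ)) (fun x => G ν |x|) =
      ddKernel ℓ (fun k => (k : ℝ)) (fun k => (k : ℝ))
        (fun x => ∑ j ∈ Finset.range (ℓ + 1), p.coeff j * |x| ^ (2 * j)) := by
    unfold ddKernel
    refine Finset.sum_congr rfl fun k hk => Finset.sum_congr rfl fun l hl => ?_
    congr 1
    have hk' : k ≤ ℓ := by have := Finset.mem_range.1 hk; omega
    have hl' : l ≤ ℓ := by have := Finset.mem_range.1 hl; omega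
    obtain ⟨d, hd, hdv⟩ : ∃ d ≤ ℓ, ((k : ℝ) - l) ^ 2 = v d := by
      rcases le_total k l with hkl | hkl
      · refine ⟨l - k, by omega, ?_⟩
        simp only [hv, Nat.cast_sub hkl]; ring
      · refine ⟨k - l, by omega, ?_⟩
        simp only [hv, Nat.cast_sub hkl]
    simp only []
    rw [hg, hdv, ← hpe d hd, Polynomial.eval_eq_sum_range' hnat]
    refine Finset.sum_congr rfl fun j _ => ?_
    rw [pow_mul, sq_abs, hdv]
  have hk : ∀ k < ℓ, ((k : ℕ) : ℝ) < ((k + 1 : ℕ) : ℝ) := fun k _ => by push_cast; linarith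
  have h2 : ∀ j ∈ Finset.range (ℓ + 1),
      ddKernel ℓ (fun k => (k : ℝ)) (fun k => (k : ℝ)) (fun x => p.coeff j * |x| ^ (2 * j)) =
        if j = ℓ then p.coeff ℓ * ((-1) ^ ℓ * ((2 * ℓ).factorial : ℝ)) else 0 := by
    intro j hj
    rw [ddKernel_const_mul, ddKernel_abs_pow ℓ hℓ _ _ hk hk j
      (by have := Finset.mem_range.1 hj; omega)]
    split_ifs with hjl
    · rw [hjl]
    · simp
  rw [h1, ddKernel_sum, Finset.sum_congr rfl h2, Finset.sum_ite_eq' , if_pos (by simp)]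
  have hv0 : v 0 = 0 := by simp [hv]
  obtain ⟨ξ, hξ, h3⟩ := exists_sum_ddWeight_eq_iteratedDeriv ℓ hℓ v hvlt g
    (hgc.mono fun x hx => hv0.symm.le.trans hx.1) (hgd.mono fun x hx => hv0.symm.le.trans_lt hx.1)
  have h4 : (ℓ.factorial : ℝ) * p.coeff ℓ = iteratedDeriv ℓ g ξ := by
    rw [← h3, hcoeff, Finset.mul_sum]
    refine Finset.sum_congr rfl fun k hk => ?_
    rw [hpe k (by have := Finset.mem_range.1 hk; omega), ddWeight]
    ring
  have h5 := hg0 ξ (hv0.symm.le.trans_lt hξ.1)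
  rw [← h4] at h5
  have h6 : ((2 * ℓ).factorial : ℝ) ≠ 0 := by exact_mod_cast Nat.factorial_ne_zero _
  exact mul_ne_zero (right_ne_zero_of_mul h5) (mul_ne_zero (by simp) h6)

/-! ### The irregular term is not a polynomial -/

lemma tendsto_G_div_rpow {ν q : ℝ} (hν : 0 < ν) (hq : q < 2 * ν) :
    Tendsto (fun t => G ν t / t ^ q) (𝓝[>] 0) (𝓝 0) := by
  have hpow : Tendsto (fun t : ℝ => t ^ (2 * ν - q)) (𝓝[>] 0) (𝓝 0) := by
    have := (Real.continuousAt_rpow_const 0 (2 * ν - q) (Or.inr (by linarith))).tendsto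
    rw [Real.zero_rpow (by linarith)] at this
    exact this.mono_left nhdsWithin_le_nhds
  rcases natCast_or_not_int hν with ⟨m, hm, rfl⟩ | hint
  · refine (tendsto_log_mul_rpow_nhdsGT_zero (sub_pos.2 hq)).congr' ?_
    filter_upwards [self_mem_nhdsWithin] with t ht
    have ht : (0 : ℝ) < t := ht
    rw [G_of_natCast m, Real.rpow_sub ht,
      show (2 * (m : ℝ)) = ((2 * m : ℕ) : ℝ) by push_cast; ring, Real.rpow_natCast]
    ring
  · refine hpow.congr' ?_
    filter_upwards [self_mem_nhdsWithin] with t ht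
    rw [G_of_not_int hν hint, Real.rpow_sub ht]

/-- A polynomial of degree at most `2⌊ν⌋` does not have an expansion at `0+` with principal
irregular term `βs G_ν`, unless `βs = 0`. -/
theorem eq_zero_of_polynomial_sub_G_isLittleO {ν : ℝ} (hν : 0 < ν) (p : Polynomial ℝ)
    (hdeg : p.natDegree ≤ 2 * ⌊ν⌋₊) (βs : ℝ)
    (h : (fun t => p.eval t - βs * G ν t) =o[𝓝[>] 0] fun t => t ^ (2 * ν)) : βs = 0 := by
  have hpos : ∀ᶠ t in 𝓝[>] (0 : ℝ), 0 < t := self_mem_nhdsWithin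
  have hlim : Tendsto (fun t => (p.eval t - βs * G ν t) / t ^ (2 * ν)) (𝓝[>] 0) (𝓝 0) :=
    h.tendsto_div_nhds_zero
  have hν2 : (2 * ⌊ν⌋₊ : ℝ) ≤ 2 * ν := by linarith [Nat.floor_le hν.le]
  -- In the critical case the logarithm would have to converge at `0+`.
  have hcrit : ∀ (m : ℕ) (c : ℝ), 1 ≤ m → ν = m →
      Tendsto (fun t => c - βs * Real.log t) (𝓝[>] 0) (𝓝 0) → βs = 0 := by
    intro m c _ _ hc
    by_contra hβ
    have h1 : Tendsto (fun t => (c - (c - βs * Real.log t)) / βs) (𝓝[>] 0) (𝓝 ((c - 0) / βs)) :=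
      (tendsto_const_nhds.sub hc).div_const _
    have h2 : (fun t => (c - (c - βs * Real.log t)) / βs) = Real.log := by
      ext t; field_simp; ring
    rw [h2] at h1
    exact not_tendsto_nhds_of_tendsto_atBot Real.tendsto_log_nhdsGT_zero _ h1
  by_cases hp : p = 0
  · rcases natCast_or_not_int hν with ⟨m, hm, hνm⟩ | hint
    · refine hcrit m 0 hm hνm (hlim.congr' ?_)
      filter_upwards [hpos] with t ht
      rw [hνm, G_of_natCast m, hp,
        show (2 * (m : ℝ)) = ((2 * m : ℕ) : ℝ) by push_cast; ring, Real.rpow_natCast]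
      have := (pow_pos ht (2 * m)).ne'
      simp only [Polynomial.eval_zero]
      field_simp
      ring
    · have h1 : Tendsto (fun _ : ℝ => -βs) (𝓝[>] 0) (𝓝 0) := by
        refine hlim.congr' ?_
        filter_upwards [hpos] with t ht
        have := (Real.rpow_pos_of_pos ht (2 * ν)).ne'
        rw [G_of_not_int hν hint, hp]
        simp only [Polynomial.eval_zero]
        field_simp
        ring
      have := tendsto_nhds_unique tendsto_const_nhds h1
      linarith
  · obtain ⟨q, hq, hq0⟩ := Polynomial.exists_eq_pow_rootMultiplicity_mul_and_not_dvd p hp 0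
    set m := p.rootMultiplicity 0 with hmdef
    rw [Polynomial.dvd_iff_isRoot, Polynomial.IsRoot.def] at hq0
    have hm : m ≤ 2 * ⌊ν⌋₊ := le_trans (by
      rw [hmdef, ← Polynomial.count_roots]
      exact (Multiset.count_le_card _ _).trans p.card_roots') hdeg
    have hm' : (m : ℝ) ≤ 2 * ν := le_trans (by exact_mod_cast hm) hν2
    have hpq : ∀ t, p.eval t = t ^ m * q.eval t := fun t => by
      conv_lhs => rw [hq]
      simp
    have hqc : Tendsto (fun t => q.eval t) (𝓝[>] 0) (𝓝 (q.eval 0)) :=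
      q.continuous.continuousAt.tendsto.mono_left nhdsWithin_le_nhds
    rcases hm'.lt_or_eq with hlt | heq
    · exfalso
      have hpow : Tendsto (fun t : ℝ => t ^ (2 * ν - m)) (𝓝[>] 0) (𝓝 0) := by
        have := (Real.continuousAt_rpow_const 0 (2 * ν - m) (Or.inr (by linarith))).tendsto
        rw [Real.zero_rpow (by linarith)] at this
        exact this.mono_left nhdsWithin_le_nhds
      have h1 := (hlim.mul hpow).add ((tendsto_G_div_rpow hν hlt).const_mul βs)
      have h2 : Tendsto (fun t => q.eval t) (𝓝[>] 0) (𝓝 0) := by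
        refine (h1.congr' ?_).trans (by simp)
        filter_upwards [hpos] with t ht
        have h3 := (Real.rpow_pos_of_pos ht (2 * ν)).ne'
        have h4 := (pow_pos ht m).ne'
        rw [Real.rpow_sub ht, Real.rpow_natCast, hpq]
        field_simp
        ring
      exact hq0 (tendsto_nhds_unique hqc h2)
    · have hfl : ν = ⌊ν⌋₊ := by
        have h1 : (m : ℝ) ≤ 2 * ⌊ν⌋₊ := by exact_mod_cast hm
        linarith [Nat.floor_le hν.le]
      have h1 : 1 ≤ ⌊ν⌋₊ := by
        have : (0 : ℝ) < ⌊ν⌋₊ := hfl ▸ hν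
        exact_mod_cast this
      have hm2 : m = 2 * ⌊ν⌋₊ := by
        have : (m : ℝ) = 2 * ⌊ν⌋₊ := by rw [heq, ← hfl]
        exact_mod_cast this
      refine hcrit ⌊ν⌋₊ (q.eval 0) h1 hfl ?_
      have h2 := hlim.add (tendsto_const_nhds.sub hqc : Tendsto (fun t => q.eval 0 - q.eval t)
        (𝓝[>] 0) (𝓝 (q.eval 0 - q.eval 0)))
      rw [sub_self, add_zero] at h2
      refine h2.congr' ?_
      filter_upwards [hpos] with t ht
      have hG : G ν t = t ^ m * Real.log t := by
        rw [hfl, G_of_natCast, hm2]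
      have h4 := (pow_pos ht m).ne'
      rw [hG, ← heq, Real.rpow_natCast, hpq]
      field_simp
      ring

/-! ### Geometry of the design -/

/-- The filter on pairs `(n, i)` for statements that hold uniformly in the index
`1 ≤ i ≤ n - θℓ` of an increment as the sample size `n` tends to infinity. -/
def cells (θ ℓ : ℕ) : Filter (ℕ × ℕ) :=
  comap Prod.fst atTop ⊓ 𝓟 {p | p.2 ∈ Finset.Icc 1 (p.1 - θ * ℓ)}

lemma eventually_cells {θ ℓ : ℕ} {p : ℕ × ℕ → Prop} :
    (∀ᶠ x in cells θ ℓ, p x) ↔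
      ∀ᶠ n in atTop, ∀ i ∈ Finset.Icc 1 (n - θ * ℓ), p (n, i) := by
  rw [cells, eventually_inf_principal, eventually_comap]
  refine eventually_congr (Eventually.of_forall fun n => ?_)
  constructor
  · intro h i hi
    exact h (n, i) rfl hi
  · rintro h ⟨n', i⟩ rfl hi
    exact h i hi

lemma tendsto_fst_cells (θ ℓ : ℕ) : Tendsto Prod.fst (cells θ ℓ) atTop :=
  tendsto_comap.mono_left inf_le_left

/-- Positively weighted averages over the increments inherit uniform limits. -/
lemma tendsto_weighted_average {θ ℓ : ℕ} (w g : ℕ × ℕ → ℝ) (c : ℝ)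
    (hw : ∀ᶠ x in cells θ ℓ, 0 < w x) (hg : Tendsto g (cells θ ℓ) (𝓝 c)) :
    Tendsto (fun n => (∑ i ∈ Finset.Icc 1 (n - θ * ℓ), w (n, i) * g (n, i)) /
      ∑ i ∈ Finset.Icc 1 (n - θ * ℓ), w (n, i)) atTop (𝓝 c) := by
  rw [Metric.tendsto_nhds] at hg ⊢
  intro ε hε
  filter_upwards [eventually_cells.1 hw, eventually_cells.1 (hg (ε / 2) (by positivity)),
    eventually_gt_atTop (θ * ℓ)] with n h1 h2 h3
  have hpos : 0 < ∑ i ∈ Finset.Icc 1 (n - θ * ℓ), w (n, i) :=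
    Finset.sum_pos h1 ⟨1, Finset.mem_Icc.2 ⟨le_rfl, by omega⟩⟩
  rw [Real.dist_eq]
  have h4 : (∑ i ∈ Finset.Icc 1 (n - θ * ℓ), w (n, i) * g (n, i)) /
      (∑ i ∈ Finset.Icc 1 (n - θ * ℓ), w (n, i)) - c =
      (∑ i ∈ Finset.Icc 1 (n - θ * ℓ), w (n, i) * (g (n, i) - c)) /
        ∑ i ∈ Finset.Icc 1 (n - θ * ℓ), w (n, i) := by
    rw [div_sub' hpos.ne']
    congr 1
    simp only [mul_sub, Finset.sum_sub_distrib, Finset.sum_mul]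
  rw [h4, abs_div, abs_of_pos hpos, div_lt_iff₀ hpos]
  calc |∑ i ∈ Finset.Icc 1 (n - θ * ℓ), w (n, i) * (g (n, i) - c)|
      ≤ ∑ i ∈ Finset.Icc 1 (n - θ * ℓ), |w (n, i) * (g (n, i) - c)| :=
        Finset.abs_sum_le_sum_abs _ _
    _ ≤ ∑ i ∈ Finset.Icc 1 (n - θ * ℓ), w (n, i) * (ε / 2) := by
        refine Finset.sum_le_sum fun i hi => ?_
        rw [abs_mul, abs_of_pos (h1 i hi)]
        have := h2 i hi
        rw [Real.dist_eq] at this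
        exact mul_le_mul_of_nonneg_left this.le (h1 i hi).le
    _ = (ε / 2) * ∑ i ∈ Finset.Icc 1 (n - θ * ℓ), w (n, i) := by
        rw [← Finset.sum_mul, mul_comm]
    _ < ε * ∑ i ∈ Finset.Icc 1 (n - θ * ℓ), w (n, i) :=
        mul_lt_mul_of_pos_right (by linarith) hpos

lemma IsDesign.continuous_deriv {φ : ℝ → ℝ} (hφ : IsDesign φ) : Continuous (deriv φ) :=
  hφ.contDiff.continuous_deriv (by norm_num)

lemma IsDesign.exists_bounds {φ : ℝ → ℝ} (hφ : IsDesign φ) :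
    ∃ c C : ℝ, 0 < c ∧ 0 < C ∧ ∀ s ∈ Set.Icc (0 : ℝ) 1, c ≤ deriv φ s ∧ deriv φ s ≤ C := by
  obtain ⟨x, hx, hmin⟩ := isCompact_Icc.exists_isMinOn (Set.nonempty_Icc.2 (zero_le_one (α := ℝ)))
    hφ.continuous_deriv.continuousOn
  obtain ⟨y, hy, hmax⟩ := isCompact_Icc.exists_isMaxOn (Set.nonempty_Icc.2 (zero_le_one (α := ℝ)))
    hφ.continuous_deriv.continuousOn
  exact ⟨deriv φ x, deriv φ y, hφ.deriv_pos x hx, hφ.deriv_pos y hy,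
    fun s hs => ⟨hmin hs, hmax hs⟩⟩

/-- The parameter value `(i - 1) / (n - 1)` of the `i`-th site. -/
def param (n i : ℕ) : ℝ := ((i : ℝ) - 1) / ((n : ℝ) - 1)

lemma param_mem {n i : ℕ} (hn : 2 ≤ n) (hi : 1 ≤ i) (hin : i ≤ n) :
    param n i ∈ Set.Icc (0 : ℝ) 1 := by
  have h1 : (2 : ℝ) ≤ n := by exact_mod_cast hn
  have h2 : (1 : ℝ) ≤ i := by exact_mod_cast hi
  have h3 : (i : ℝ) ≤ n := by exact_mod_cast hin
  exact ⟨div_nonneg (by linarith) (by linarith), (div_le_one (by linarith)).2 (by linarith)⟩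

lemma param_sub (n i j : ℕ) : param n j - param n i = ((j : ℝ) - i) / ((n : ℝ) - 1) := by
  unfold param
  ring

lemma IsDesign.exists_site_sub_eq {φ : ℝ → ℝ} (hφ : IsDesign φ) {n i j : ℕ} (hn : 2 ≤ n)
    (hi : 1 ≤ i) (hij : i ≤ j) (hj : j ≤ n) :
    ∃ s ∈ Set.Icc (param n i) (param n j), s ∈ Set.Icc (0 : ℝ) 1 ∧
      site φ n j - site φ n i = deriv φ s * (((j : ℝ) - i) / ((n : ℝ) - 1)) := by
  have hmi := param_mem hn hi (hij.trans hj)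
  have hmj := param_mem hn (hi.trans hij) hj
  rcases hij.eq_or_lt with rfl | hlt
  · exact ⟨param n i, ⟨le_rfl, le_rfl⟩, hmi, by simp⟩
  · have hn' : (2 : ℝ) ≤ n := by exact_mod_cast hn
    have hlt' : param n i < param n j := by
      rw [← sub_pos, param_sub]
      have : (i : ℝ) < j := by exact_mod_cast hlt
      exact div_pos (by linarith) (by linarith)
    have hd : Differentiable ℝ φ := hφ.contDiff.differentiable (by norm_num)
    obtain ⟨s, hs, h⟩ := exists_deriv_eq_slope φ hlt' hd.continuous.continuousOn
      hd.differentiableOn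
    refine ⟨s, Set.Ioo_subset_Icc_self hs, ⟨hmi.1.trans hs.1.le, hs.2.le.trans hmj.2⟩, ?_⟩
    rw [h, ← param_sub, div_mul_cancel₀ _ (sub_pos.2 hlt').ne']
    rfl

lemma IsDesign.site_sub_bounds {φ : ℝ → ℝ} (hφ : IsDesign φ) :
    ∃ c C : ℝ, 0 < c ∧ 0 < C ∧ ∀ n i j : ℕ, 2 ≤ n → 1 ≤ i → i ≤ j → j ≤ n →
      c * (((j : ℝ) - i) / n) ≤ site φ n j - site φ n i ∧
        site φ n j - site φ n i ≤ C * (((j : ℝ) - i) / n) := by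
  obtain ⟨c, C, hc, hC, h⟩ := hφ.exists_bounds
  refine ⟨c, 2 * C, hc, by positivity, fun n i j hn hi hij hj => ?_⟩
  obtain ⟨s, -, hs, heq⟩ := hφ.exists_site_sub_eq hn hi hij hj
  have hn' : (2 : ℝ) ≤ n := by exact_mod_cast hn
  have hij' : (0 : ℝ) ≤ (j : ℝ) - i := sub_nonneg.2 (by exact_mod_cast hij)
  have h1 : ((j : ℝ) - i) / n ≤ ((j : ℝ) - i) / (n - 1) :=
    div_le_div_of_nonneg_left hij' (by linarith) (by linarith)
  have h2 : ((j : ℝ) - i) / (n - 1) ≤ 2 * (((j : ℝ) - i) / n) := by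
    rw [div_le_iff₀ (by linarith)]
    have : 2 * (((j : ℝ) - i) / n) * (n - 1) = ((j : ℝ) - i) * (2 * (n - 1) / n) := by
      field_simp
    rw [this]
    exact le_mul_of_one_le_right hij' ((one_le_div (by linarith)).2 (by linarith))
  have h3 : 0 ≤ ((j : ℝ) - i) / n := div_nonneg hij' (by linarith)
  rw [heq]
  constructor
  · exact mul_le_mul (h s hs).1 h1 h3 (hc.le.trans (h s hs).1)
  · calc deriv φ s * (((j : ℝ) - i) / (n - 1)) ≤ C * (2 * (((j : ℝ) - i) / n)) :=
        mul_le_mul (h s hs).2 h2 (h3.trans h1) hC.le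
      _ = 2 * C * (((j : ℝ) - i) / n) := by ring

lemma IsDesign.site_lt {φ : ℝ → ℝ} (hφ : IsDesign φ) {n i j : ℕ} (hn : 2 ≤ n) (hi : 1 ≤ i)
    (hij : i < j) (hj : j ≤ n) : site φ n i < site φ n j := by
  obtain ⟨c, C, hc, -, h⟩ := hφ.site_sub_bounds
  have h1 : (0 : ℝ) < (j : ℝ) - i := sub_pos.2 (by exact_mod_cast hij)
  have h2 : (0 : ℝ) < n := by exact_mod_cast (show 0 < n by omega)
  have := (h n i j hn hi hij.le hj).1
  have h3 : 0 < c * (((j : ℝ) - i) / n) := by positivity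
  linarith

lemma IsDesign.site_le {φ : ℝ → ℝ} (hφ : IsDesign φ) {n i j : ℕ} (hn : 2 ≤ n) (hi : 1 ≤ i)
    (hij : i ≤ j) (hj : j ≤ n) : site φ n i ≤ site φ n j := by
  rcases hij.eq_or_lt with rfl | h
  · exact le_rfl
  · exact (hφ.site_lt hn hi h hj).le

lemma IsDesign.site_one {φ : ℝ → ℝ} (hφ : IsDesign φ) (n : ℕ) : site φ n 1 = 0 := by
  simp [site, hφ.map_zero]

lemma IsDesign.site_self {φ : ℝ → ℝ} (hφ : IsDesign φ) {n : ℕ} (hn : 2 ≤ n) :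
    site φ n n = 1 := by
  have : (2 : ℝ) ≤ n := by exact_mod_cast hn
  rw [site, div_self (by linarith), hφ.map_one]

/-- The nodes of the `i`-th increment for sample size `n`, where `x = (n, i)`. -/
def node (φ : ℝ → ℝ) (θ : ℕ) (x : ℕ × ℕ) (k : ℕ) : ℝ := site φ x.1 (x.2 + θ * k)

/-- The local spacing `φ'(s_i) θ / (n - 1)` of the nodes of an increment. -/
def spacing (φ : ℝ → ℝ) (θ : ℕ) (x : ℕ × ℕ) : ℝ :=
  deriv φ (param x.1 x.2) * (θ / ((x.1 : ℝ) - 1))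

/-- The nodes of an increment, shifted to start at `0` and measured in units of `spacing`. -/
def shape (φ : ℝ → ℝ) (θ : ℕ) (x : ℕ × ℕ) (k : ℕ) : ℝ :=
  (node φ θ x k - node φ θ x 0) / spacing φ θ x

lemma IsDesign.node_lt {φ : ℝ → ℝ} (hφ : IsDesign φ) {θ ℓ : ℕ} (hθ : 1 ≤ θ) {n i : ℕ}
    (hn : 2 ≤ n) (hi : i ∈ Finset.Icc 1 (n - θ * ℓ)) :
    ∀ k < ℓ, node φ θ (n, i) k < node φ θ (n, i) (k + 1) := by
  intro k hk
  rw [Finset.mem_Icc] at hi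
  have h1 : θ * (k + 1) ≤ θ * ℓ := Nat.mul_le_mul_left _ hk
  have h2 : θ * (k + 1) = θ * k + θ := by ring
  exact hφ.site_lt hn (by dsimp only; omega) (by dsimp only; omega) (by dsimp only; omega)

lemma IsDesign.spacing_bounds {φ : ℝ → ℝ} (hφ : IsDesign φ) {θ : ℕ} (hθ : 1 ≤ θ) (ℓ : ℕ) :
    ∃ c C : ℝ, 0 < c ∧ 0 < C ∧ ∀ n i : ℕ, 2 ≤ n → i ∈ Finset.Icc 1 (n - θ * ℓ) →
      c / n ≤ spacing φ θ (n, i) ∧ spacing φ θ (n, i) ≤ C / n := by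
  obtain ⟨c, C, hc, hC, h⟩ := hφ.exists_bounds
  have hθ' : (1 : ℝ) ≤ θ := by exact_mod_cast hθ
  refine ⟨c, 2 * C * θ, hc, by positivity, fun n i hn hi => ?_⟩
  rw [Finset.mem_Icc] at hi
  have hb := h (param n i) (param_mem hn hi.1 (by omega))
  have hn' : (2 : ℝ) ≤ n := by exact_mod_cast hn
  constructor
  · calc c / n = c * (1 / n) := by ring
      _ ≤ deriv φ (param n i) * (θ / (n - 1)) :=
        mul_le_mul hb.1 (div_le_div₀ (by linarith) hθ' (by linarith) (by linarith))
          (by positivity) (hc.le.trans hb.1)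
  · have h2 : (θ : ℝ) / (n - 1) ≤ 2 * θ / n := by
      rw [div_le_div_iff₀ (by linarith) (by linarith)]
      nlinarith
    calc deriv φ (param n i) * (θ / (n - 1)) ≤ C * (2 * θ / n) :=
        mul_le_mul hb.2 h2 (div_nonneg (by linarith) (by linarith)) hC.le
      _ = 2 * C * θ / n := by ring

lemma IsDesign.spacing_pos {φ : ℝ → ℝ} (hφ : IsDesign φ) {θ : ℕ} (hθ : 1 ≤ θ) (ℓ : ℕ) :
    ∀ᶠ x in cells θ ℓ, 0 < spacing φ θ x := by
  obtain ⟨c, C, hc, -, h⟩ := hφ.spacing_bounds hθ ℓ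
  rw [eventually_cells]
  filter_upwards [eventually_ge_atTop 2] with n hn i hi
  have : (0 : ℝ) < n := by exact_mod_cast (show 0 < n by omega)
  exact (div_pos hc this).trans_le (h n i hn hi).1

lemma IsDesign.tendsto_spacing {φ : ℝ → ℝ} (hφ : IsDesign φ) {θ : ℕ} (hθ : 1 ≤ θ) (ℓ : ℕ) :
    Tendsto (spacing φ θ) (cells θ ℓ) (𝓝[>] 0) := by
  obtain ⟨c, C, hc, -, h⟩ := hφ.spacing_bounds hθ ℓ
  refine tendsto_nhdsWithin_iff.2 ⟨?_, hφ.spacing_pos hθ ℓ⟩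
  have h1 : Tendsto (fun x : ℕ × ℕ => C / (x.1 : ℝ)) (cells θ ℓ) (𝓝 0) :=
    (tendsto_const_div_atTop_nhds_zero_nat C).comp (tendsto_fst_cells θ ℓ)
  refine squeeze_zero' ((hφ.spacing_pos hθ ℓ).mono fun x hx => hx.le) ?_ h1
  rw [eventually_cells]
  filter_upwards [eventually_ge_atTop 2] with n hn i hi
  exact (h n i hn hi).2

lemma node_eq_shape (φ : ℝ → ℝ) (θ : ℕ) (x : ℕ × ℕ) (hx : spacing φ θ x ≠ 0) :
    node φ θ x = fun k => node φ θ x 0 + spacing φ θ x * shape φ θ x k := by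
  ext k
  rw [shape]
  field_simp
  ring

lemma shape_lt {φ : ℝ → ℝ} {θ : ℕ} {x : ℕ × ℕ} (hx : 0 < spacing φ θ x) {k : ℕ}
    (h : node φ θ x k < node φ θ x (k + 1)) : shape φ θ x k < shape φ θ x (k + 1) :=
  div_lt_div_of_pos_right (by linarith) hx

/-- Since `φ'` is uniformly continuous and positive, the nodes of an increment are
asymptotically equally spaced. -/
lemma IsDesign.tendsto_shape {φ : ℝ → ℝ} (hφ : IsDesign φ) {θ : ℕ} (hθ : 1 ≤ θ) (ℓ : ℕ) :
    ∀ k ≤ ℓ, Tendsto (fun x => shape φ θ x k) (cells θ ℓ) (𝓝 (k : ℝ)) := by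
  intro k hk
  obtain ⟨c, C, hc, hC, hb⟩ := hφ.exists_bounds
  have huc := isCompact_Icc.uniformContinuousOn_of_continuous
    (hφ.continuous_deriv.continuousOn (s := Set.Icc (0 : ℝ) 1))
  rw [Metric.uniformContinuousOn_iff] at huc
  rw [Metric.tendsto_nhds]
  intro ε hε
  obtain ⟨δ, hδ, h⟩ := huc (ε * c / (k + 1)) (by positivity)
  rw [eventually_cells]
  have hlim : Tendsto (fun n : ℕ => ((θ * k : ℕ) : ℝ) / ((n : ℝ) - 1)) atTop (𝓝 0) :=
    tendsto_const_nhds.div_atTop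
      (tendsto_atTop_add_const_right _ _ tendsto_natCast_atTop_atTop)
  filter_upwards [eventually_ge_atTop 2, hlim.eventually (gt_mem_nhds hδ)] with n hn hnδ i hi
  rw [Finset.mem_Icc] at hi
  have h1 : θ * k ≤ θ * ℓ := Nat.mul_le_mul_left _ hk
  have hi0 := param_mem hn hi.1 (show i ≤ n by omega)
  obtain ⟨s, hs, hs1, heq⟩ := hφ.exists_site_sub_eq hn hi.1 (show i ≤ i + θ * k by omega)
    (by omega)
  have hn' : (2 : ℝ) ≤ n := by exact_mod_cast hn
  have hθ' : (0 : ℝ) < θ := by exact_mod_cast (show 0 < θ by omega)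
  have hd0 := (hb _ hi0).1
  have hpos : 0 < deriv φ (param n i) := hc.trans_le hd0
  have hcast : (((i + θ * k : ℕ) : ℝ) - i) = θ * k := by push_cast; ring
  have hdist : dist (deriv φ s) (deriv φ (param n i)) < ε * c / (k + 1) := by
    refine h s hs1 _ hi0 ?_
    rw [Real.dist_eq, abs_of_nonneg (sub_nonneg.2 hs.1)]
    have := param_sub n i (i + θ * k)
    rw [hcast] at this
    push_cast at hnδ
    linarith [hs.2]
  have hshape : shape φ θ (n, i) k - k =
      k * ((deriv φ s - deriv φ (param n i)) / deriv φ (param n i)) := by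
    simp only [shape, node, spacing, mul_zero, add_zero]
    rw [heq, hcast]
    have : (n : ℝ) - 1 ≠ 0 := by linarith
    field_simp
  rw [Real.dist_eq, hshape, abs_mul, abs_div, Nat.abs_cast, abs_of_pos hpos]
  rw [Real.dist_eq] at hdist
  have h5 : |deriv φ s - deriv φ (param n i)| / deriv φ (param n i) ≤ ε / (k + 1) := by
    rw [div_le_iff₀ hpos]
    calc |deriv φ s - deriv φ (param n i)| ≤ ε / (k + 1) * c := by
          rw [div_mul_eq_mul_div]; exact hdist.le
      _ ≤ ε / (k + 1) * deriv φ (param n i) := by gcongr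
  calc (k : ℝ) * (|deriv φ s - deriv φ (param n i)| / deriv φ (param n i))
      ≤ k * (ε / (k + 1)) := by gcongr
    _ = ε * (k / (k + 1)) := by ring
    _ < ε * 1 := by
        refine mul_lt_mul_of_pos_left ?_ hε
        rw [div_lt_one (by positivity)]
        linarith
    _ = ε := mul_one ε

/-! ### Double divided differences of the covariance over small grids -/

lemma isLittleO_comp_abs {g : ℝ → ℝ} {q : ℝ} (h0 : g 0 = 0)
    (hg : Tendsto (fun t => g t / t ^ q) (𝓝[>] 0) (𝓝 0)) :
    (fun t : ℝ => g |t|) =o[𝓝 0] fun t => |t| ^ q := by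
  have h1 : g =o[𝓝[>] 0] fun t => t ^ q := by
    refine (isLittleO_iff_tendsto' ?_).2 hg
    filter_upwards [self_mem_nhdsWithin] with t ht h
    exact absurd h (Real.rpow_pos_of_pos ht q).ne'
  have h2 : Tendsto (fun t : ℝ => |t|) (𝓝[≠] 0) (𝓝[>] 0) := tendsto_abs_nhdsNE_zero
  have h3 : (fun t : ℝ => g |t|) =o[𝓝[≠] 0] fun t => |t| ^ q := h1.comp_tendsto h2
  have h4 : (fun t : ℝ => g |t|) =o[𝓝[insert 0 {0}ᶜ] 0] fun t => |t| ^ q :=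
    (isLittleO_insert (by simp [h0])).2 h3
  rwa [Set.insert_eq, Set.union_compl_self, nhdsWithin_univ] at h4

lemma abs_rpow_isLittleO {a b : ℝ} (ha : 0 < a) (hab : b < a) :
    (fun t : ℝ => |t| ^ a) =o[𝓝 0] fun t => |t| ^ b := by
  refine isLittleO_comp_abs (g := fun t => t ^ a) (Real.zero_rpow ha.ne') ?_
  have := (Real.continuousAt_rpow_const 0 (a - b) (Or.inr (by linarith))).tendsto
  rw [Real.zero_rpow (by linarith)] at this
  refine (this.mono_left nhdsWithin_le_nhds).congr' ?_
  filter_upwards [self_mem_nhdsWithin] with t ht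
  exact Real.rpow_sub ht _ _

/-- The remainder in the expansion of the covariance. -/
def remainder (K : ℝ → ℝ) (ν : ℝ) (β : ℕ → ℝ) (βs : ℝ) (t : ℝ) : ℝ :=
  K t - (∑ j ∈ Finset.range (⌊ν⌋₊ + 1), β j * |t| ^ (2 * j) + βs * G ν |t|)

lemma HasSmoothness.remainder_isLittleO {K : ℝ → ℝ} {ν βs : ℝ} {β : ℕ → ℝ}
    (hK : HasSmoothness K ν β βs) :
    remainder K ν β βs =o[𝓝 0] fun t => |t| ^ (2 * ν) := by
  obtain ⟨τ, hτ, h⟩ := hK.expansion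
  exact h.trans_isLittleO (abs_rpow_isLittleO (by linarith [hK.pos]) (by linarith))

lemma ddKernel_expansion (K : ℝ → ℝ) (ν : ℝ) (β : ℕ → ℝ) (βs : ℝ) (ℓ : ℕ) (u v : ℕ → ℝ) :
    ddKernel ℓ u v K = ∑ j ∈ Finset.range (⌊ν⌋₊ + 1), β j * ddKernel ℓ u v (fun t => |t| ^ (2 * j))
      + βs * ddKernel ℓ u v (fun t => G ν |t|) + ddKernel ℓ u v (remainder K ν β βs) := by
  have : K = fun t => (∑ j ∈ Finset.range (⌊ν⌋₊ + 1), β j * |t| ^ (2 * j) + βs * G ν |t|)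
      + remainder K ν β βs t := by
    ext t; simp [remainder]
  conv_lhs => rw [this]
  rw [ddKernel_add, ddKernel_add, ddKernel_sum, ddKernel_const_mul]
  simp only [ddKernel_const_mul]

section grid

/- A family of grids `c p + h p * U p k`, `0 ≤ k ≤ ℓ`, with mesh `h p` tending to zero and
asymptotically equal spacing. -/
variable {α : Type*} {L : Filter α} {ℓ : ℕ} {c h : α → ℝ} {U : α → ℕ → ℝ}

lemma tendsto_ddKernel_of_isLittleO (hh : Tendsto h L (𝓝[>] 0))
    (hU : ∀ k ≤ ℓ, Tendsto (fun p => U p k) L (𝓝 (k : ℝ))) {ρ : ℝ → ℝ} {q : ℝ} (hq : 0 < q)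
    (hρ : ρ =o[𝓝 0] fun t => |t| ^ q) :
    Tendsto (fun p => h p ^ (2 * (ℓ : ℝ) - q) *
      ddKernel ℓ (fun k => c p + h p * U p k) (fun k => c p + h p * U p k) ρ) L (𝓝 0) := by
  have hpos : ∀ᶠ p in L, 0 < h p := hh.eventually self_mem_nhdsWithin
  have hh0 : Tendsto h L (𝓝 0) := hh.mono_right nhdsWithin_le_nhds
  have hw := tendsto_ddWeight ℓ U (fun k => (k : ℝ))
    (fun k _ j _ hkj => by exact_mod_cast hkj) hU
  have hterm : ∀ k ≤ ℓ, ∀ l ≤ ℓ,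
      Tendsto (fun p => ρ (h p * (U p k - U p l)) / h p ^ q) L (𝓝 0) := by
    intro k hk l hl
    have hd := (hU k hk).sub (hU l hl)
    have h0 : Tendsto (fun p => h p * (U p k - U p l)) L (𝓝 0) := by
      simpa using hh0.mul hd
    have h1 := hρ.comp_tendsto h0
    have h2 : (fun p => |h p * (U p k - U p l)| ^ q) =O[L] fun p => h p ^ q := by
      have h3 : (fun p => |U p k - U p l| ^ q) =O[L] fun _ => (1 : ℝ) :=
        ((Real.continuousAt_rpow_const _ q (Or.inr hq.le)).tendsto.comp hd.abs).isBigO_one ℝ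
      have h4 := (isBigO_refl (fun p => h p ^ q) L).mul h3
      refine IsBigO.congr' h4 ?_ (by simp)
      filter_upwards [hpos] with p hp
      rw [abs_mul, abs_of_pos hp, Real.mul_rpow hp.le (abs_nonneg _)]
    exact (h1.trans_isBigO h2).tendsto_div_nhds_zero
  have hsum : Tendsto (fun p => ∑ k ∈ Finset.range (ℓ + 1), ∑ l ∈ Finset.range (ℓ + 1),
      ddWeight ℓ (U p) k * ddWeight ℓ (U p) l * (ρ (h p * (U p k - U p l)) / h p ^ q)) L (𝓝 0) := by
    have : (0 : ℝ) = ∑ k ∈ Finset.range (ℓ + 1), ∑ l ∈ Finset.range (ℓ + 1),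
        ddWeight ℓ (fun k => (k : ℝ)) k * ddWeight ℓ (fun k => (k : ℝ)) l * 0 := by simp
    rw [this]
    refine tendsto_finsetSum _ fun k hk => tendsto_finsetSum _ fun l hl => ?_
    have hk' : k ≤ ℓ := by have := Finset.mem_range.1 hk; omega
    have hl' : l ≤ ℓ := by have := Finset.mem_range.1 hl; omega
    exact ((hw k hk').mul (hw l hl')).mul (hterm k hk' l hl')
  refine hsum.congr' ?_
  filter_upwards [hpos] with p hp
  rw [ddKernel_scale ℓ (U p) (c p) (h p) hp.ne', ddKernel, Real.rpow_sub hp,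
    show (2 * (ℓ : ℝ)) = ((2 * ℓ : ℕ) : ℝ) by push_cast; ring, Real.rpow_natCast]
  have h1 := (pow_pos hp (2 * ℓ)).ne'
  have h2 := (Real.rpow_pos_of_pos hp q).ne'
  simp only [Finset.mul_sum]
  refine Finset.sum_congr rfl fun k _ => Finset.sum_congr rfl fun l _ => ?_
  field_simp

lemma grid_lt {p : α} (hp : 0 < h p) (hlt : ∀ k < ℓ, U p k < U p (k + 1)) :
    ∀ k < ℓ, c p + h p * U p k < c p + h p * U p (k + 1) := fun k hk => by
  have := mul_lt_mul_of_pos_left (hlt k hk) hp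
  linarith

/-- Order above the smoothness: the irregular term dominates. -/
lemma HasSmoothness.tendsto_ddKernel_of_lt {K : ℝ → ℝ} {ν βs : ℝ} {β : ℕ → ℝ}
    (hK : HasSmoothness K ν β βs) (hνℓ : ν < ℓ) (hh : Tendsto h L (𝓝[>] 0))
    (hU : ∀ k ≤ ℓ, Tendsto (fun p => U p k) L (𝓝 (k : ℝ)))
    (hlt : ∀ᶠ p in L, ∀ k < ℓ, U p k < U p (k + 1)) :
    Tendsto (fun p => h p ^ (2 * (ℓ : ℝ) - 2 * ν) *
      ddKernel ℓ (fun k => c p + h p * U p k) (fun k => c p + h p * U p k) K) L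
      (𝓝 (βs * ddKernel ℓ (fun k => (k : ℝ)) (fun k => (k : ℝ)) (fun x => G ν |x|))) := by
  have hℓ : 1 ≤ ℓ := by
    have : (0 : ℝ) < ℓ := hK.pos.trans hνℓ
    exact_mod_cast this
  have h1 := tendsto_ddKernel_of_isLittleO (c := c) hh hU (q := 2 * ν) (by linarith [hK.pos])
    hK.remainder_isLittleO
  have h2 := ((tendsto_ddKernel_G hK.pos ℓ U hU).const_mul βs).add h1
  rw [add_zero] at h2
  refine h2.congr' ?_
  filter_upwards [hh.eventually self_mem_nhdsWithin, hlt] with p hp hl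
  have hp : 0 < h p := hp
  have hg := grid_lt (c := c) hp hl
  have hfl : ⌊ν⌋₊ < ℓ := (Nat.floor_lt hK.pos.le).2 hνℓ
  have hz : ∑ j ∈ Finset.range (⌊ν⌋₊ + 1), β j * ddKernel ℓ (fun k => c p + h p * U p k)
      (fun k => c p + h p * U p k) (fun t => |t| ^ (2 * j)) = 0 := by
    refine Finset.sum_eq_zero fun j hj => ?_
    have hj := Finset.mem_range.1 hj
    rw [ddKernel_abs_pow ℓ hℓ _ _ hg hg j (by omega), if_neg (by omega), mul_zero]
  rw [ddKernel_expansion K ν β βs, hz, zero_add, mul_add, add_left_inj,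
    ddKernel_scale ℓ (U p) (c p) (h p) hp.ne',
    ddKernel_G_scale_of_lt hK.pos ℓ hνℓ (U p) hl (h p) hp, Real.rpow_sub hp,
    show (2 * (ℓ : ℝ)) = ((2 * ℓ : ℕ) : ℝ) by push_cast; ring, Real.rpow_natCast]
  have h3 := (pow_pos hp (2 * ℓ)).ne'
  have h4 := (Real.rpow_pos_of_pos hp (2 * ν)).ne'
  field_simp

/-- Order equal to the smoothness: a logarithm appears. -/
lemma HasSmoothness.tendsto_ddKernel_of_eq {K : ℝ → ℝ} {βs : ℝ} {β : ℕ → ℝ}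
    (hK : HasSmoothness K ℓ β βs) (hh : Tendsto h L (𝓝[>] 0))
    (hU : ∀ k ≤ ℓ, Tendsto (fun p => U p k) L (𝓝 (k : ℝ)))
    (hlt : ∀ᶠ p in L, ∀ k < ℓ, U p k < U p (k + 1)) :
    Tendsto (fun p =>
      ddKernel ℓ (fun k => c p + h p * U p k) (fun k => c p + h p * U p k) K / Real.log (h p)) L
      (𝓝 (βs * ((-1) ^ ℓ * ((2 * ℓ).factorial : ℝ)))) := by
  have hℓ : 1 ≤ ℓ := by
    have : (0 : ℝ) < ℓ := hK.pos
    exact_mod_cast this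
  have hlog : Tendsto (fun p => Real.log (h p)) L atBot := Real.tendsto_log_nhdsGT_zero.comp hh
  have h1 := tendsto_ddKernel_of_isLittleO (c := c) hh hU (q := 2 * ℓ) (by linarith [hK.pos])
    hK.remainder_isLittleO
  set A : ℝ := (-1) ^ ℓ * ((2 * ℓ).factorial : ℝ)
  have h2 := ((((tendsto_ddKernel_G hK.pos ℓ U hU).const_mul βs).add h1).const_add
    (β ℓ * A)).div_atBot hlog
  have h3 := h2.add_const (βs * A)
  rw [zero_add] at h3
  refine h3.congr' ?_
  filter_upwards [hh.eventually self_mem_nhdsWithin, hlt,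
    hlog.eventually (eventually_lt_atBot 0)] with p hp hl hlog0
  have hp : 0 < h p := hp
  have hg := grid_lt (c := c) hp hl
  have hz : ∑ j ∈ Finset.range (⌊(ℓ : ℝ)⌋₊ + 1), β j * ddKernel ℓ (fun k => c p + h p * U p k)
      (fun k => c p + h p * U p k) (fun t => |t| ^ (2 * j)) = β ℓ * A := by
    rw [Nat.floor_natCast, Finset.sum_range_succ, Finset.sum_eq_zero, zero_add,
      ddKernel_abs_pow ℓ hℓ _ _ hg hg ℓ le_rfl, if_pos rfl]
    intro j hj
    have hj := Finset.mem_range.1 hj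
    rw [ddKernel_abs_pow ℓ hℓ _ _ hg hg j (by omega), if_neg (by omega), mul_zero]
  rw [ddKernel_expansion K ℓ β βs, hz, ddKernel_scale ℓ (U p) (c p) (h p) hp.ne' (fun t => G ℓ |t|),
    ddKernel_G_scale_of_eq ℓ hℓ (U p) hl (h p) hp, sub_self, Real.rpow_zero, one_mul]
  have h3 := (pow_pos hp (2 * ℓ)).ne'
  have h4 : Real.log (h p) ≠ 0 := hlog0.ne
  simp only [A]
  field_simp
  ring

lemma HasSmoothness.sub_isLittleO {K : ℝ → ℝ} {ν βs : ℝ} {β : ℕ → ℝ}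
    (hK : HasSmoothness K ν β βs) {m : ℕ} (hm : (m : ℝ) < ν) :
    (fun t => K t - ∑ j ∈ Finset.range (m + 1), β j * |t| ^ (2 * j)) =o[𝓝 0]
      fun t => |t| ^ (2 * (m : ℝ)) := by
  have hfl : m ≤ ⌊ν⌋₊ := Nat.le_floor hm.le
  have h1 : (fun t => K t - ∑ j ∈ Finset.range (m + 1), β j * |t| ^ (2 * j)) = fun t =>
      (∑ j ∈ Finset.Ico (m + 1) (⌊ν⌋₊ + 1), β j * |t| ^ (2 * j)) + βs * G ν |t| +
        remainder K ν β βs t := by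
    ext t
    rw [remainder, ← Finset.sum_range_add_sum_Ico (fun j => β j * |t| ^ (2 * j))
      (show m + 1 ≤ ⌊ν⌋₊ + 1 by omega)]
    ring
  rw [h1]
  have hsum : (fun t => ∑ j ∈ Finset.Ico (m + 1) (⌊ν⌋₊ + 1), β j * |t| ^ (2 * j)) =o[𝓝 0]
      fun t : ℝ => |t| ^ (2 * (m : ℝ)) := by
    refine IsLittleO.fun_sum fun j hj => ?_
    rw [Finset.mem_Ico] at hj
    have h2 := (abs_rpow_isLittleO (a := ((2 * j : ℕ) : ℝ)) (b := 2 * (m : ℝ))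
      (by exact_mod_cast (show 0 < 2 * j by omega))
      (by exact_mod_cast (show 2 * m < 2 * j by omega))).const_mul_left (β j)
    simpa only [Real.rpow_natCast] using h2
  refine (hsum.add ?_).add ?_
  · exact (isLittleO_comp_abs (G_zero ν)
      (tendsto_G_div_rpow hK.pos (by linarith))).const_mul_left βs
  · exact hK.remainder_isLittleO.trans
      (abs_rpow_isLittleO (by linarith [hK.pos]) (by linarith))

/-- Order below the smoothness: the leading coefficient is that of the covariance of the mean
square derivative. -/
lemma HasSmoothness.tendsto_ddKernel_of_gt {K : ℝ → ℝ} {ν βs : ℝ} {β : ℕ → ℝ}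
    (hK : HasSmoothness K ν β βs) (hℓ : 1 ≤ ℓ) (hνℓ : ℓ < ν) (hh : Tendsto h L (𝓝[>] 0))
    (hU : ∀ k ≤ ℓ, Tendsto (fun p => U p k) L (𝓝 (k : ℝ)))
    (hlt : ∀ᶠ p in L, ∀ k < ℓ, U p k < U p (k + 1)) :
    Tendsto (fun p => ddKernel ℓ (fun k => c p + h p * U p k) (fun k => c p + h p * U p k) K) L
      (𝓝 (β ℓ * ((-1) ^ ℓ * ((2 * ℓ).factorial : ℝ)))) := by
  have hℓ0 : (0 : ℝ) < ℓ := by exact_mod_cast hℓ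
  have h1 := (tendsto_ddKernel_of_isLittleO (c := c) hh hU (q := 2 * ℓ) (by linarith)
    (hK.sub_isLittleO hνℓ)).const_add (β ℓ * ((-1) ^ ℓ * ((2 * ℓ).factorial : ℝ)))
  rw [add_zero] at h1
  refine h1.congr' ?_
  filter_upwards [hh.eventually self_mem_nhdsWithin, hlt] with p hp hl
  have hg := grid_lt (c := c) hp hl
  have hz : ∑ j ∈ Finset.range (ℓ + 1), ddKernel ℓ (fun k => c p + h p * U p k)
      (fun k => c p + h p * U p k) (fun t => β j * |t| ^ (2 * j)) =
        β ℓ * ((-1) ^ ℓ * ((2 * ℓ).factorial : ℝ)) := by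
    rw [Finset.sum_range_succ, Finset.sum_eq_zero, zero_add, ddKernel_const_mul,
      ddKernel_abs_pow ℓ hℓ _ _ hg hg ℓ le_rfl, if_pos rfl]
    intro j hj
    have hj := Finset.mem_range.1 hj
    rw [ddKernel_const_mul, ddKernel_abs_pow ℓ hℓ _ _ hg hg j (by omega), if_neg (by omega),
      mul_zero]
  rw [sub_self, Real.rpow_zero, one_mul, ← hz, ← ddKernel_sum, ← ddKernel_add]
  congr 1
  ext t
  ring

end grid

lemma HasSmoothness.eq_zero_of_polynomial {K : ℝ → ℝ} {ν βs : ℝ} {β : ℕ → ℝ}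
    (hK : HasSmoothness K ν β βs) (p : Polynomial ℝ) (hdeg : p.natDegree ≤ 2 * ⌊ν⌋₊)
    (h : ∀ᶠ t in 𝓝[>] (0 : ℝ), K t = p.eval t) : βs = 0 := by
  set s : Polynomial ℝ := ∑ j ∈ Finset.range (⌊ν⌋₊ + 1), Polynomial.C (β j) * Polynomial.X ^ (2 * j)
    with hs
  have hsdeg : s.natDegree ≤ 2 * ⌊ν⌋₊ := by
    refine Polynomial.natDegree_sum_le_of_forall_le _ _ fun j hj => ?_
    have := Finset.mem_range.1 hj
    exact (Polynomial.natDegree_C_mul_X_pow_le _ _).trans (by omega)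
  refine eq_zero_of_polynomial_sub_G_isLittleO hK.pos (p - s)
    ((Polynomial.natDegree_sub_le _ _).trans (max_le hdeg hsdeg)) βs ?_
  refine (hK.remainder_isLittleO.mono nhdsWithin_le_nhds).congr' ?_ ?_
  · filter_upwards [h, self_mem_nhdsWithin] with t ht ht0
    have ht0 : (0 : ℝ) < t := ht0
    simp only [remainder, abs_of_pos ht0, ht, Polynomial.eval_sub, hs, Polynomial.eval_finsetSum,
      Polynomial.eval_mul, Polynomial.eval_C, Polynomial.eval_pow, Polynomial.eval_X]
    ring
  · filter_upwards [self_mem_nhdsWithin] with t ht0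
    have ht0 : (0 : ℝ) < t := ht0
    rw [abs_of_pos ht0]

/-! ### Consequences of positive definiteness -/

section posdef

/- A stationary covariance function is the Gram kernel of a family of vectors `Z t`. -/
variable {H : Type*} [NormedAddCommGroup H] [InnerProductSpace ℝ H] {Z : ℝ → H} {K : ℝ → ℝ}

lemma ddKernel_eq_inner (hZ : ∀ x y, inner ℝ (Z x) (Z y) = K (x - y)) (ℓ : ℕ) (u v : ℕ → ℝ) :
    ddKernel ℓ u v K = inner ℝ (∑ k ∈ Finset.range (ℓ + 1), ddWeight ℓ u k • Z (u k))
      (∑ k ∈ Finset.range (ℓ + 1), ddWeight ℓ v k • Z (v k)) := by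
  simp only [ddKernel, sum_inner, inner_sum, real_inner_smul_left, real_inner_smul_right, hZ]
  rw [Finset.sum_comm]
  exact Finset.sum_congr rfl fun _ _ => Finset.sum_congr rfl fun _ _ => by ring

lemma ddKernel_self_nonneg (hZ : ∀ x y, inner ℝ (Z x) (Z y) = K (x - y)) (ℓ : ℕ) (u : ℕ → ℝ) :
    0 ≤ ddKernel ℓ u u K := by
  rw [ddKernel_eq_inner hZ]
  exact real_inner_self_nonneg

lemma ddKernel_comm (hZ : ∀ x y, inner ℝ (Z x) (Z y) = K (x - y)) (ℓ : ℕ) (u v : ℕ → ℝ) :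
    ddKernel ℓ u v K = ddKernel ℓ v u K := by
  rw [ddKernel_eq_inner hZ, ddKernel_eq_inner hZ, real_inner_comm]

lemma ddKernel_sq_le (hZ : ∀ x y, inner ℝ (Z x) (Z y) = K (x - y)) (ℓ : ℕ) (u v : ℕ → ℝ) :
    ddKernel ℓ u v K ^ 2 ≤ ddKernel ℓ u u K * ddKernel ℓ v v K := by
  rw [ddKernel_eq_inner hZ ℓ u v, ddKernel_eq_inner hZ ℓ u u, ddKernel_eq_inner hZ ℓ v v, sq]
  exact real_inner_mul_inner_self_le _ _

/-- The squared norms of the iterated differences of a stationary family are log-convex in the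
order, by summation by parts and the Cauchy–Schwarz inequality. -/
lemma norm_fwdDiff_sq_le (hZ : ∀ x y, inner ℝ (Z x) (Z y) = K (x - y)) (h : ℝ) (j : ℕ) :
    ‖(fwdDiff h)^[j + 1] Z 0‖ ^ 2 ≤ ‖(fwdDiff h)^[j] Z 0‖ * ‖(fwdDiff h)^[j + 2] Z 0‖ := by
  have hsucc : ∀ i y, (fwdDiff h)^[i + 1] Z y =
      (fwdDiff h)^[i] Z (y + h) - (fwdDiff h)^[i] Z y := fun i y => by
    rw [Function.iterate_succ_apply', fwdDiff]
  have hstat : ∀ i k : ℕ, ∀ y y' s : ℝ,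
      inner ℝ ((fwdDiff h)^[i] Z (y + s)) ((fwdDiff h)^[k] Z (y' + s)) =
        inner ℝ ((fwdDiff h)^[i] Z y) ((fwdDiff h)^[k] Z y') := by
    intro i
    induction i with
    | zero =>
      intro k
      induction k with
      | zero => intro y y' s; simp [hZ]
      | succ k ih =>
        intro y y' s
        rw [hsucc, hsucc, inner_sub_right, inner_sub_right, ih, add_right_comm, ih]
    | succ i ih =>
      intro k y y' s
      rw [hsucc, hsucc, inner_sub_left, inner_sub_left, ih, add_right_comm, ih]
  have h1 : ‖(fwdDiff h)^[j + 1] Z 0‖ ^ 2 =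
      -inner ℝ ((fwdDiff h)^[j] Z (0 + h)) ((fwdDiff h)^[j + 2] Z 0) := by
    rw [← real_inner_self_eq_norm_sq]
    conv_lhs => rw [hsucc j 0, inner_sub_left]
    rw [← hsucc j 0, ← hstat j (j + 1) 0 0 h, ← inner_sub_right, ← inner_neg_right]
    congr 1
    rw [hsucc (j + 1) 0, neg_sub]
  have h2 : ‖(fwdDiff h)^[j] Z (0 + h)‖ = ‖(fwdDiff h)^[j] Z 0‖ := by
    rw [← sq_eq_sq₀ (norm_nonneg _) (norm_nonneg _), ← real_inner_self_eq_norm_sq,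
      ← real_inner_self_eq_norm_sq, hstat]
  rw [h1, ← h2]
  exact (neg_le_abs _).trans (abs_real_inner_le_norm _ _)

lemma ddWeight_natCast (ℓ k : ℕ) (hk : k ≤ ℓ) :
    ddWeight ℓ (fun m => (m : ℝ)) k = (-1) ^ (ℓ - k) * (ℓ.choose k : ℝ) := by
  have h1 : ∏ j ∈ (Finset.range (ℓ + 1)).erase k, ((k : ℝ) - j) =
      (k.factorial : ℝ) * ((-1) ^ (ℓ - k) * ((ℓ - k).factorial : ℝ)) := by
    obtain ⟨d, rfl⟩ := Nat.exists_eq_add_of_le hk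
    have hsplit : (Finset.range (k + d + 1)).erase k =
        Finset.range k ∪ (Finset.range d).image (fun i => k + 1 + i) := by
      ext m
      simp only [Finset.mem_erase, Finset.mem_range, Finset.mem_union, Finset.mem_image]
      constructor
      · rintro ⟨h1, h2⟩
        rcases lt_or_gt_of_ne h1 with h | h
        · exact Or.inl h
        · exact Or.inr ⟨m - (k + 1), by omega, by omega⟩
      · rintro (h | ⟨a, ha, rfl⟩) <;> omega
    rw [hsplit, Finset.prod_union, Finset.prod_image (fun a _ b _ hab => by simpa using hab)]
    · congr 1
      · have : ∀ n : ℕ, ∏ j ∈ Finset.range n, ((n : ℝ) - j) = n.factorial := by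
          intro n
          induction n with
          | zero => simp
          | succ n ih =>
            rw [Finset.prod_range_succ', Nat.factorial_succ]
            push_cast
            rw [← ih]
            simp only [add_sub_add_right_eq_sub, sub_zero]
            ring
        exact this k
      · rw [Nat.add_sub_cancel_left]
        clear hsplit hk
        induction d with
        | zero => simp
        | succ d ih =>
          rw [Finset.prod_range_succ, ih, Nat.factorial_succ, pow_succ]
          push_cast
          ring
    · rw [Finset.disjoint_left]
      intro m hm
      simp only [Finset.mem_range, Finset.mem_image, not_exists, not_and] at hm ⊢
      intro a _
      omega
  rw [ddWeight, h1, Nat.cast_choose ℝ hk]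
  have h2 : ((-1 : ℝ) ^ (ℓ - k)) * (-1) ^ (ℓ - k) = 1 := by rw [← mul_pow]; simp
  have h3 : (k.factorial : ℝ) ≠ 0 := by exact_mod_cast k.factorial_ne_zero
  have h4 : ((ℓ - k).factorial : ℝ) ≠ 0 := by exact_mod_cast (ℓ - k).factorial_ne_zero
  rw [div_eq_iff (mul_ne_zero h3 (mul_ne_zero (by simp) h4))]
  field_simp
  linear_combination -h2

lemma norm_fwdDiff_sq_eq (hZ : ∀ x y, inner ℝ (Z x) (Z y) = K (x - y)) (h : ℝ) (hh : h ≠ 0)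
    (j : ℕ) :
    ‖(fwdDiff h)^[j] Z 0‖ ^ 2 / h ^ (2 * j) =
      ddKernel j (fun k => 0 + h * (k : ℝ)) (fun k => 0 + h * (k : ℝ)) K := by
  have hsum : (fwdDiff h)^[j] Z 0 = h ^ j • ∑ k ∈ Finset.range (j + 1),
      ddWeight j (fun k => 0 + h * (k : ℝ)) k • Z (0 + h * (k : ℝ)) := by
    rw [fwdDiff_iter_eq_sum_shift, Finset.smul_sum]
    refine Finset.sum_congr rfl fun k hk => ?_
    have hk : k ≤ j := by have := Finset.mem_range.1 hk; omega
    rw [ddWeight_scale j (fun k => (k : ℝ)) 0 h hh k hk, ddWeight_natCast j k hk, smul_smul,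
      ← mul_assoc, mul_inv_cancel₀ (pow_ne_zero _ hh), one_mul, nsmul_eq_mul, mul_comm h,
      ← Int.cast_smul_eq_zsmul ℝ]
    push_cast
    rfl
  rw [ddKernel_eq_inner hZ, real_inner_self_eq_norm_sq, hsum, norm_smul, mul_pow, pow_mul,
    norm_pow, ← pow_mul, mul_comm j 2, pow_mul, Real.norm_eq_abs, sq_abs]
  field_simp

/-- The `ℓ`-th mean square derivative of a stationary process with irregular covariance does not
vanish. Otherwise log-convexity of the norms of its derivatives in the order would force the first
derivative to vanish as well, so that the process and its covariance would be constant. -/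
theorem HasSmoothness.coeff_ne_zero {ν βs : ℝ} {β : ℕ → ℝ} (hK : HasSmoothness K ν β βs)
    (hZ : ∀ x y, inner ℝ (Z x) (Z y) = K (x - y)) {ℓ : ℕ} (hℓ : 1 ≤ ℓ) (hνℓ : (ℓ : ℝ) < ν) :
    β ℓ ≠ 0 := by
  intro hβ
  have hpos : ∀ᶠ h in 𝓝[>] (0 : ℝ), 0 < h := self_mem_nhdsWithin
  set r : ℕ → ℝ → ℝ := fun j h => ‖(fwdDiff h)^[j] Z 0‖ ^ 2 / h ^ (2 * j) with hr
  have hlim : ∀ j, 1 ≤ j → j ≤ ℓ → Tendsto (r j) (𝓝[>] 0)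
      (𝓝 (β j * ((-1) ^ j * ((2 * j).factorial : ℝ)))) := by
    intro j hj hjℓ
    refine (hK.tendsto_ddKernel_of_gt (L := 𝓝[>] (0 : ℝ)) (ℓ := j) (c := fun _ => 0)
      (h := fun h => h) (U := fun _ k => (k : ℝ)) hj
      (lt_of_le_of_lt (by exact_mod_cast hjℓ) hνℓ) tendsto_id
      (fun k _ => tendsto_const_nhds)
      (Eventually.of_forall fun _ k _ => by push_cast; linarith)).congr' ?_
    filter_upwards [hpos] with h hh
    exact (norm_fwdDiff_sq_eq hZ h hh.ne' j).symm
  have hr0 : Tendsto (r 0) (𝓝[>] 0) (𝓝 (‖Z 0‖ ^ 2)) := by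
    simp only [hr, Function.iterate_zero, id_eq, mul_zero, pow_zero, div_one]
    exact tendsto_const_nhds
  have hconv : ∀ j, ∀ᶠ h in 𝓝[>] (0 : ℝ), r (j + 1) h ^ 2 ≤ r j h * r (j + 2) h := by
    intro j
    filter_upwards [hpos] with h hh
    have h1 := norm_fwdDiff_sq_le hZ h j
    have h2 := pow_le_pow_left₀ (sq_nonneg _) h1 2
    simp only [hr]
    rw [div_pow, div_mul_div_comm, ← mul_pow, ← pow_add,
      show 2 * j + 2 * (j + 2) = 2 * (j + 1) * 2 by ring, pow_mul h _ 2]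
    exact div_le_div_of_nonneg_right h2 (by positivity)
  have hdesc : ∀ j, 1 ≤ j → j ≤ ℓ → β j = 0 → β 1 = 0 := by
    intro j hj
    induction j, hj using Nat.le_induction with
    | base => exact fun _ h => h
    | succ j hj ih =>
      intro hjℓ h0
      refine ih (by omega) ?_
      obtain ⟨i, rfl⟩ : ∃ i, j = i + 1 := ⟨j - 1, by omega⟩
      have hl1 := (hlim (i + 1) (by omega) (by omega)).pow 2
      have hl2 := hlim (i + 2) (by omega) hjℓ
      obtain ⟨b, hb⟩ : ∃ b, Tendsto (r i) (𝓝[>] 0) (𝓝 b) := by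
        rcases Nat.eq_zero_or_pos i with rfl | hi
        · exact ⟨_, hr0⟩
        · exact ⟨_, hlim i hi (by omega)⟩
      have hle := le_of_tendsto_of_tendsto hl1 (hb.mul hl2) (hconv i)
      rw [h0, zero_mul, mul_zero] at hle
      have h3 := pow_eq_zero_iff (two_ne_zero) |>.1 (le_antisymm hle (sq_nonneg _))
      have h4 : ((2 * (i + 1)).factorial : ℝ) ≠ 0 := by exact_mod_cast Nat.factorial_ne_zero _
      simpa [h4] using h3
  have hβ1 := hdesc ℓ hℓ le_rfl hβ
  have hr1 := hlim 1 le_rfl hℓ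
  rw [hβ1, zero_mul] at hr1
  -- The increments of `Z` over a step `h` are `o(h)`, so `Z` is constant.
  have hstep : ∀ (h : ℝ) (n : ℕ), ‖Z (n * h) - Z 0‖ ≤ n * ‖Z h - Z 0‖ := by
    intro h n
    induction n with
    | zero => simp
    | succ n ih =>
      have h1 : ‖Z ((n + 1 : ℕ) * h) - Z (n * h)‖ = ‖Z h - Z 0‖ := by
        rw [← sq_eq_sq₀ (norm_nonneg _) (norm_nonneg _), norm_sub_sq_real, norm_sub_sq_real,
          ← real_inner_self_eq_norm_sq, ← real_inner_self_eq_norm_sq,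
          ← real_inner_self_eq_norm_sq, ← real_inner_self_eq_norm_sq]
        simp only [hZ, sub_self, sub_zero]
        rw [show ((n + 1 : ℕ) : ℝ) * h - n * h = h by push_cast; ring]
      calc ‖Z ((n + 1 : ℕ) * h) - Z 0‖
          = ‖(Z ((n + 1 : ℕ) * h) - Z (n * h)) + (Z (n * h) - Z 0)‖ := by congr 1; abel
        _ ≤ ‖Z h - Z 0‖ + n * ‖Z h - Z 0‖ := (norm_add_le _ _).trans (by rw [h1]; gcongr)
        _ = ((n + 1 : ℕ) : ℝ) * ‖Z h - Z 0‖ := by push_cast; ring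
  have hconst : ∀ t, 0 < t → K t = K 0 := by
    intro t ht
    have hseq : Tendsto (fun n : ℕ => t / ((n : ℝ) + 1)) atTop (𝓝[>] 0) := by
      refine tendsto_nhdsWithin_iff.2 ⟨?_, Eventually.of_forall fun n => ?_⟩
      · exact tendsto_const_nhds.div_atTop
          (tendsto_atTop_add_const_right _ _ tendsto_natCast_atTop_atTop)
      · exact div_pos ht (by positivity)
    have h1 := (hr1.comp hseq).const_mul (t ^ 2)
    rw [mul_zero] at h1
    have h2 : ‖Z t - Z 0‖ ^ 2 ≤ 0 := by
      refine ge_of_tendsto h1 (Eventually.of_forall fun n => ?_)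
      have h3 := hstep (t / ((n : ℝ) + 1)) (n + 1)
      have hn : (n : ℝ) + 1 ≠ 0 := by positivity
      rw [show ((n + 1 : ℕ) : ℝ) * (t / ((n : ℝ) + 1)) = t by push_cast; field_simp] at h3
      have h4 := pow_le_pow_left₀ (norm_nonneg _) h3 2
      refine h4.trans (le_of_eq ?_)
      simp only [hr, Function.comp_apply, Function.iterate_one, fwdDiff, zero_add, mul_one]
      push_cast
      field_simp
    have h3 : Z t = Z 0 := by
      rw [← sub_eq_zero, ← norm_eq_zero]
      exact pow_eq_zero_iff two_ne_zero |>.1 (le_antisymm h2 (sq_nonneg _))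
    have h4 := hZ t 0
    rw [h3, hZ] at h4
    simpa using h4.symm
  refine hK.irregular_ne_zero (hK.eq_zero_of_polynomial (Polynomial.C (K 0)) (by simp) ?_)
  filter_upwards [hpos] with t ht
  rw [hconst t ht, Polynomial.eval_C]

end posdef

/-! ### Sums of squared covariances -/

/-- The partial sums `∑_{m=1}^n m^{-p}`. -/
def powerSum (p : ℝ) (n : ℕ) : ℝ := ∑ m ∈ Finset.range n, ((m : ℝ) + 1) ^ (-p)

lemma powerSum_nonneg (p : ℝ) (n : ℕ) : 0 ≤ powerSum p n :=
  Finset.sum_nonneg fun _ _ => Real.rpow_nonneg (by positivity) _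

lemma one_le_powerSum (p : ℝ) {n : ℕ} (hn : 1 ≤ n) : 1 ≤ powerSum p n := by
  have h := Finset.single_le_sum (f := fun m : ℕ => ((m : ℝ) + 1) ^ (-p)) (s := Finset.range n)
    (fun _ _ => Real.rpow_nonneg (by positivity) _) (Finset.mem_range.2 (show 0 < n by omega))
  simpa [powerSum] using h

lemma exists_powerSum_le_of_one_lt {p : ℝ} (hp : 1 < p) : ∃ C, ∀ n, powerSum p n ≤ C := by
  have h1 : Summable fun m : ℕ => ((m : ℝ) + 1) ^ (-p) := by
    have := (summable_nat_add_iff 1).2 (Real.summable_nat_rpow.2 (show -p < -1 by linarith))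
    simpa using this
  exact ⟨_, fun n => h1.sum_le_tsum _ fun _ _ => Real.rpow_nonneg (by positivity) _⟩

lemma powerSum_one_le (n : ℕ) : powerSum 1 n ≤ 1 + Real.log n := by
  have h := harmonic_le_one_add_log n
  have h2 : ((harmonic n : ℚ) : ℝ) = powerSum 1 n := by
    simp only [harmonic, powerSum, Real.rpow_neg_one]
    push_cast
    rfl
  rwa [h2] at h

lemma powerSum_le_of_lt_one {p : ℝ} (hp0 : 0 ≤ p) (hp : p < 1) (n : ℕ) :
    powerSum p n ≤ (n : ℝ) ^ (1 - p) / (1 - p) := by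
  induction n with
  | zero => simp [powerSum, Real.zero_rpow (show 1 - p ≠ 0 by linarith)]
  | succ n ih =>
    have hn : (0 : ℝ) < (n : ℝ) + 1 := by positivity
    rw [powerSum, Finset.sum_range_succ, ← powerSum, le_div_iff₀ (by linarith), add_mul]
    rw [le_div_iff₀ (by linarith)] at ih
    -- Bernoulli's inequality for `n ^ (1 - p) = (n + 1) ^ (1 - p) * (1 - 1 / (n + 1)) ^ (1 - p)`.
    have h1 := rpow_one_add_le_one_add_mul_self (s := -(1 / ((n : ℝ) + 1))) (p := 1 - p)
      (by rw [neg_le_neg_iff, div_le_one hn]; linarith [(Nat.cast_nonneg n : (0 : ℝ) ≤ n)])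
      (by linarith) (by linarith)
    have h2 : 1 + -(1 / ((n : ℝ) + 1)) = n / (n + 1) := by field_simp; ring
    rw [h2, Real.div_rpow (Nat.cast_nonneg n) hn.le, div_le_iff₀ (by positivity)] at h1
    have h3 : ((n : ℝ) + 1) ^ (-p) * (n + 1) = ((n : ℝ) + 1) ^ (1 - p) := by
      rw [← Real.rpow_add_one hn.ne']
      congr 1
      ring
    push_cast
    have h4 : (1 + (1 - p) * -(1 / ((n : ℝ) + 1))) * ((n : ℝ) + 1) ^ (1 - p) =
        ((n : ℝ) + 1) ^ (1 - p) - (1 - p) * ((n : ℝ) + 1) ^ (-p) := by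
      rw [← h3]; field_simp; ring
    rw [h4] at h1
    linarith

/-- The sum over the indices in an interval of a function of the distance to a given index. -/
lemma sum_dist_le (f : ℕ → ℝ) (hf : ∀ d, 0 ≤ f d) (n i : ℕ) (s : Finset ℕ)
    (hs : s ⊆ Finset.range n) (hi : i < n) :
    ∑ j ∈ s, f ((i - j) + (j - i)) ≤ 2 * ∑ d ∈ Finset.range n, f d := by
  have hsub : ∑ j ∈ s, f ((i - j) + (j - i)) ≤
      ∑ j ∈ s.filter (· ≤ i), f (i - j) + ∑ j ∈ s.filter (fun j => ¬ j ≤ i), f (j - i) := by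
    rw [← Finset.sum_filter_add_sum_filter_not s (· ≤ i)]
    refine (add_le_add (Finset.sum_le_sum fun j hj => ?_) (Finset.sum_le_sum fun j hj => ?_))
    · rw [Finset.mem_filter] at hj
      rw [show j - i = 0 by omega, add_zero]
    · rw [Finset.mem_filter] at hj
      rw [show i - j = 0 by omega, zero_add]
  have h1 : ∑ j ∈ s.filter (· ≤ i), f (i - j) ≤ ∑ d ∈ Finset.range n, f d := by
    rw [← Finset.sum_image (f := f) (g := fun j => i - j)]
    · refine Finset.sum_le_sum_of_subset_of_nonneg ?_ fun d _ _ => hf d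
      intro d hd
      simp only [Finset.mem_image, Finset.mem_filter, Finset.mem_range] at hd ⊢
      omega
    · intro a ha b hb hab
      simp only [Finset.coe_filter, Set.mem_ofPred_eq] at ha hb hab
      omega
  have h2 : ∑ j ∈ s.filter (fun j => ¬ j ≤ i), f (j - i) ≤ ∑ d ∈ Finset.range n, f d := by
    rw [← Finset.sum_image (f := f) (g := fun j => j - i)]
    · refine Finset.sum_le_sum_of_subset_of_nonneg ?_ fun d _ _ => hf d
      intro d hd
      simp only [Finset.mem_image, Finset.mem_filter, Finset.mem_range] at hd ⊢
      obtain ⟨a, ⟨ha, _⟩, rfl⟩ := hd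
      have := Finset.mem_range.1 (hs ha)
      omega
    · intro a ha b hb hab
      simp only [Finset.coe_filter, Set.mem_ofPred_eq] at ha hb hab
      omega
  linarith

/-- The covariance of the `i`-th and `j`-th generalized increment for sample size `n`. -/
def incrCov (φ K : ℝ → ℝ) (θ ℓ n i j : ℕ) : ℝ :=
  ddKernel ℓ (node φ θ (n, i)) (node φ θ (n, j)) K

/-- The sum of the squared covariances of all pairs of generalized increments. -/
def sumCovSq (φ K : ℝ → ℝ) (θ ℓ n : ℕ) : ℝ :=
  ∑ i ∈ Finset.Icc 1 (n - θ * ℓ), ∑ j ∈ Finset.Icc 1 (n - θ * ℓ), incrCov φ K θ ℓ n i j ^ 2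

lemma sumCovSq_nonneg (φ K : ℝ → ℝ) (θ ℓ n : ℕ) : 0 ≤ sumCovSq φ K θ ℓ n :=
  Finset.sum_nonneg fun _ _ => Finset.sum_nonneg fun _ _ => sq_nonneg _

section bounds

variable {H : Type*} [NormedAddCommGroup H] [InnerProductSpace ℝ H] {Z : ℝ → H} {K φ : ℝ → ℝ}

/-- Covariances of increments with disjoint ranges are controlled by the `2ℓ`-th derivative. -/
lemma IsDesign.incrCov_sq_le (hφ : IsDesign φ) {θ ℓ : ℕ} (hθ : 1 ≤ θ) (hℓ : 1 ≤ ℓ)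
    {a b : ℝ} (hsm : SmoothOnInterval K (2 * ℓ) a b) {C q : ℝ} (hC : 0 ≤ C) (hq : 0 ≤ q)
    (hbd : ∀ t ∈ Set.Ioc (0 : ℝ) 1, |iteratedDeriv (2 * ℓ) K t| ≤ C * t ^ (-q))
    {c : ℝ} (hc : 0 < c) (hsep : ∀ n i j : ℕ, 2 ≤ n → 1 ≤ i → i ≤ j → j ≤ n →
      c * (((j : ℝ) - i) / n) ≤ site φ n j - site φ n i)
    {n i j : ℕ} (hn : 2 ≤ n) (hi : i ∈ Finset.Icc 1 (n - θ * ℓ))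
    (hj : j ∈ Finset.Icc 1 (n - θ * ℓ)) (hij : j + θ * ℓ < i) :
    incrCov φ K θ ℓ n i j ^ 2 ≤
      C ^ 2 * c ^ (-(2 * q)) * (n : ℝ) ^ (2 * q) * ((i - j - θ * ℓ : ℕ) : ℝ) ^ (-(2 * q)) := by
  have hi' := Finset.mem_Icc.1 hi
  have hj' := Finset.mem_Icc.1 hj
  have hn0 : (0 : ℝ) < n := by exact_mod_cast (show 0 < n by omega)
  have hsep1 := hsep n (j + θ * ℓ) i hn (by omega) hij.le (by omega)
  have hgap : (0 : ℝ) < ((i - j - θ * ℓ : ℕ) : ℝ) := by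
    exact_mod_cast (show 0 < i - j - θ * ℓ by omega)
  have hcast : (i : ℝ) - ((j + θ * ℓ : ℕ) : ℝ) = ((i - j - θ * ℓ : ℕ) : ℝ) := by
    rw [Nat.sub_sub, Nat.cast_sub hij.le]
  rw [hcast] at hsep1
  have hgap' : 0 < c * (((i - j - θ * ℓ : ℕ) : ℝ) / n) := by positivity
  have hnode0 : node φ θ (n, i) 0 = site φ n i := by simp [node]
  have hnodeℓ : node φ θ (n, j) ℓ = site φ n (j + θ * ℓ) := rfl
  have hle1 : node φ θ (n, i) ℓ ≤ 1 := by
    rw [← hφ.site_self hn]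
    exact hφ.site_le hn (by dsimp only; omega) (by dsimp only; omega) le_rfl
  have hge0 : 0 ≤ node φ θ (n, j) 0 := by
    rw [← hφ.site_one n]
    exact hφ.site_le hn le_rfl (by dsimp only; omega) (by dsimp only; omega)
  have hsub : ∀ t, 0 < t → t ≤ 1 → t ∈ Set.Ioo a b := fun t h0 h1 => hsm.1 ⟨h0, h1⟩
  have ha : a ≤ 0 := by
    by_contra h
    push Not at h
    have hlt := (hsub (min a 1) (lt_min h one_pos) (min_le_right _ _)).1
    exact absurd (min_le_left a 1) (not_le.2 hlt)
  have hb : 1 < b := (hsub 1 one_pos le_rfl).2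
  obtain ⟨ξ, hξ, η, hη, h⟩ := exists_ddKernel_eq_iteratedDeriv ℓ hℓ (node φ θ (n, i))
    (node φ θ (n, j)) (hφ.node_lt hθ hn hi) (hφ.node_lt hθ hn hj) K a b (by exact_mod_cast hsm.2)
    (by rw [hnode0, hnodeℓ]; linarith) (by linarith)
  rw [hnode0] at hξ
  rw [hnodeℓ] at hη
  have hlow : c * (((i - j - θ * ℓ : ℕ) : ℝ) / n) ≤ ξ - η := by linarith [hξ.1, hη.2]
  have hpos : 0 < ξ - η := hgap'.trans_le hlow
  have hle : ξ - η ≤ 1 := by linarith [hξ.2, hη.1]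
  have h1 : |incrCov φ K θ ℓ n i j| ≤ C * (c * (((i - j - θ * ℓ : ℕ) : ℝ) / n)) ^ (-q) := by
    rw [incrCov, h, abs_mul, abs_pow, abs_neg, abs_one, one_pow, one_mul]
    refine (hbd _ ⟨hpos, hle⟩).trans (mul_le_mul_of_nonneg_left ?_ hC)
    exact Real.rpow_le_rpow_of_nonpos hgap' hlow (by linarith)
  calc incrCov φ K θ ℓ n i j ^ 2 = |incrCov φ K θ ℓ n i j| ^ 2 := (sq_abs _).symm
    _ ≤ (C * (c * (((i - j - θ * ℓ : ℕ) : ℝ) / n)) ^ (-q)) ^ 2 :=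
        pow_le_pow_left₀ (abs_nonneg _) h1 2
    _ = _ := by
        rw [mul_pow, ← Real.rpow_mul_natCast hgap'.le, Real.mul_rpow hc.le (by positivity),
          Real.div_rpow hgap.le hn0.le, show -q * ((2 : ℕ) : ℝ) = -(2 * q) by push_cast; ring,
          Real.rpow_neg hn0.le]
        field_simp

/-- Upper bound for the sum of the squared covariances: nearby increments are treated by the
Cauchy–Schwarz inequality, the others by the bound on the `2ℓ`-th derivative. -/
theorem IsDesign.sumCovSq_le (hφ : IsDesign φ) (hZ : ∀ x y, inner ℝ (Z x) (Z y) = K (x - y))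
    {θ ℓ : ℕ} (hθ : 1 ≤ θ) (hℓ : 1 ≤ ℓ) {a b : ℝ} (hsm : SmoothOnInterval K (2 * ℓ) a b)
    {C q : ℝ} (hC : 0 ≤ C) (hq : 0 ≤ q)
    (hbd : ∀ t ∈ Set.Ioc (0 : ℝ) 1, |iteratedDeriv (2 * ℓ) K t| ≤ C * t ^ (-q))
    (B : ℕ → ℝ)
    (hB : ∀ᶠ n in atTop, ∀ i ∈ Finset.Icc 1 (n - θ * ℓ), incrCov φ K θ ℓ n i i ≤ B n) :
    ∃ A, 0 < A ∧ ∀ᶠ n : ℕ in atTop, sumCovSq φ K θ ℓ n ≤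
      A * (n * B n ^ 2 + (n : ℝ) ^ (1 + 2 * q) * powerSum (2 * q) n) := by
  obtain ⟨c, C', hc, -, hsep⟩ := hφ.site_sub_bounds
  set D : ℝ := C ^ 2 * c ^ (-(2 * q)) with hD
  have hD0 : 0 ≤ D := by positivity
  refine ⟨2 * ((θ * ℓ : ℕ) + 1) + 2 * D, by positivity, ?_⟩
  filter_upwards [hB, eventually_ge_atTop 2] with n hBn hn
  have hn0 : (0 : ℝ) < n := by exact_mod_cast (show 0 < n by omega)
  set T := θ * ℓ with hT
  set f : ℕ → ℝ := fun d =>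
    if d ≤ T then B n ^ 2 else D * (n : ℝ) ^ (2 * q) * ((d - T : ℕ) : ℝ) ^ (-(2 * q)) with hf
  have hf0 : ∀ d, 0 ≤ f d := by
    intro d
    simp only [hf]
    split_ifs <;> positivity
  have hcomm : ∀ i j, incrCov φ K θ ℓ n i j = incrCov φ K θ ℓ n j i := fun i j =>
    ddKernel_comm hZ ℓ _ _
  have hterm : ∀ i ∈ Finset.Icc 1 (n - T), ∀ j ∈ Finset.Icc 1 (n - T),
      incrCov φ K θ ℓ n i j ^ 2 ≤ f ((i - j) + (j - i)) := by
    intro i hi j hj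
    simp only [hf]
    split_ifs with hd
    · have h1 := ddKernel_sq_le hZ ℓ (node φ θ (n, i)) (node φ θ (n, j))
      refine h1.trans ?_
      rw [sq]
      exact mul_le_mul (hBn i hi) (hBn j hj) (ddKernel_self_nonneg hZ _ _)
        ((ddKernel_self_nonneg hZ _ _).trans (hBn i hi))
    · push Not at hd
      rcases le_total j i with hji | hij
      · rw [show i - j + (j - i) - T = i - j - T by omega]
        exact hφ.incrCov_sq_le hθ hℓ hsm hC hq hbd hc
          (fun n i j h1 h2 h3 h4 => (hsep n i j h1 h2 h3 h4).1) hn hi hj (by omega)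
      · rw [show i - j + (j - i) - T = j - i - T by omega, hcomm]
        exact hφ.incrCov_sq_le hθ hℓ hsm hC hq hbd hc
          (fun n i j h1 h2 h3 h4 => (hsep n i j h1 h2 h3 h4).1) hn hj hi (by omega)
  have hsumf : ∑ d ∈ Finset.range (n + 1), f d ≤
      ((T : ℝ) + 1) * B n ^ 2 + D * (n : ℝ) ^ (2 * q) * powerSum (2 * q) n := by
    have h1 : ∑ d ∈ Finset.range (n + 1), f d ≤ ∑ d ∈ Finset.range (T + 1 + n), f d :=
      Finset.sum_le_sum_of_subset_of_nonneg (Finset.range_mono (by omega)) fun d _ _ => hf0 d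
    rw [Finset.sum_range_add f (T + 1) n] at h1
    refine h1.trans (add_le_add ?_ ?_)
    · have h2 : ∀ d ∈ Finset.range (T + 1), f d = B n ^ 2 := by
        intro d hd
        have := Finset.mem_range.1 hd
        simp only [hf]
        rw [if_pos (by omega)]
      rw [Finset.sum_congr rfl h2, Finset.sum_const, Finset.card_range, nsmul_eq_mul]
      push_cast
      exact le_rfl
    · rw [powerSum, Finset.mul_sum]
      refine Finset.sum_le_sum fun m _ => ?_
      simp only [hf]
      rw [if_neg (by omega), show T + 1 + m - T = m + 1 by omega]
      push_cast
      exact le_rfl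
  have hrow : ∀ i ∈ Finset.Icc 1 (n - T),
      ∑ j ∈ Finset.Icc 1 (n - T), incrCov φ K θ ℓ n i j ^ 2 ≤
        2 * (((T : ℝ) + 1) * B n ^ 2 + D * (n : ℝ) ^ (2 * q) * powerSum (2 * q) n) := by
    intro i hi
    refine (Finset.sum_le_sum fun j hj => hterm i hi j hj).trans ?_
    refine (sum_dist_le f hf0 (n + 1) i _ (fun j hj => ?_) ?_).trans
      (mul_le_mul_of_nonneg_left hsumf zero_le_two)
    · have := Finset.mem_Icc.1 hj
      exact Finset.mem_range.2 (by omega)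
    · have := Finset.mem_Icc.1 hi
      omega
  have hP := powerSum_nonneg (2 * q) n
  have hnq : 0 ≤ (n : ℝ) ^ (2 * q) := Real.rpow_nonneg hn0.le _
  calc sumCovSq φ K θ ℓ n ≤ ∑ i ∈ Finset.Icc 1 (n - T),
        2 * (((T : ℝ) + 1) * B n ^ 2 + D * (n : ℝ) ^ (2 * q) * powerSum (2 * q) n) :=
        Finset.sum_le_sum hrow
    _ = ((n - T : ℕ) : ℝ) *
        (2 * (((T : ℝ) + 1) * B n ^ 2 + D * (n : ℝ) ^ (2 * q) * powerSum (2 * q) n)) := by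
        rw [Finset.sum_const, Nat.card_Icc, nsmul_eq_mul, Nat.add_sub_cancel]
    _ ≤ (n : ℝ) *
        (2 * (((T : ℝ) + 1) * B n ^ 2 + D * (n : ℝ) ^ (2 * q) * powerSum (2 * q) n)) := by
        refine mul_le_mul_of_nonneg_right (by exact_mod_cast Nat.sub_le n T) (by positivity)
    _ ≤ _ := by
        rw [Real.rpow_add hn0, Real.rpow_one]
        have h1 : 0 ≤ (n : ℝ) * B n ^ 2 := by positivity
        have h2 : 0 ≤ (n : ℝ) * (n : ℝ) ^ (2 * q) * powerSum (2 * q) n := by positivity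
        have h3 : (0 : ℝ) ≤ T := Nat.cast_nonneg T
        nlinarith [mul_nonneg hD0 h1, mul_nonneg h3 h2]

end bounds

/-- The `2ℓ`-th derivative of an irregular covariance does not vanish identically on `(0, 1)`:
otherwise the covariance would be a polynomial there. -/
lemma HasSmoothness.exists_iteratedDeriv_ne_zero {K : ℝ → ℝ} {ν βs : ℝ} {β : ℕ → ℝ}
    (hK : HasSmoothness K ν β βs) {ℓ : ℕ} (hℓ : 1 ≤ ℓ) (hνℓ : (ℓ : ℝ) < ν) {a b : ℝ}
    (hsm : SmoothOnInterval K (2 * ℓ) a b) :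
    ∃ t ∈ Set.Ioo (0 : ℝ) 1, iteratedDeriv (2 * ℓ) K t ≠ 0 := by
  by_contra! h0
  have hfl : ℓ ≤ ⌊ν⌋₊ := Nat.le_floor hνℓ.le
  obtain ⟨m, hm⟩ : ∃ m, 2 * ℓ = m + 1 := ⟨2 * ℓ - 1, by omega⟩
  set p : Polynomial ℝ := ∑ k ∈ Finset.range (m + 1), Polynomial.C (((k.factorial : ℝ)⁻¹) *
    iteratedDeriv k K (1 / 2)) * (Polynomial.X - Polynomial.C (1 / 2)) ^ k with hp
  refine hK.irregular_ne_zero (hK.eq_zero_of_polynomial p ?_ ?_)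
  · refine Polynomial.natDegree_sum_le_of_forall_le _ _ fun k hk => ?_
    have := Finset.mem_range.1 hk
    refine (Polynomial.natDegree_C_mul_le _ _).trans ?_
    rw [Polynomial.natDegree_pow, Polynomial.natDegree_X_sub_C]
    omega
  · filter_upwards [Ioo_mem_nhdsGT (show (0 : ℝ) < 1 / 2 by norm_num)] with t ht
    have hsub : Set.uIcc (1 / 2) t ⊆ Set.Ioo (0 : ℝ) 1 := by
      rw [Set.uIcc_of_ge ht.2.le]
      intro x hx
      exact ⟨ht.1.trans_le hx.1, hx.2.trans_lt (by norm_num)⟩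
    have hsub' : Set.Ioo (0 : ℝ) 1 ⊆ Set.Ioo a b := Set.Ioo_subset_Ioc_self.trans hsm.1
    have hcd : ContDiffOn ℝ (m + 1 : ℕ) K (Set.Ioo a b) := by
      rw [← hm]; exact_mod_cast hsm.2
    obtain ⟨x, hx, hrem⟩ := taylor_mean_remainder_lagrange_iteratedDeriv (n := m)
      (f := K) (x₀ := 1 / 2) (x := t) ht.2.ne'
      (by exact_mod_cast hcd.mono (hsub.trans hsub'))
    have hx' : x ∈ Set.Ioo (0 : ℝ) 1 := hsub (Set.Ioo_subset_Icc_self hx)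
    rw [← hm, h0 x hx', zero_mul, zero_div, sub_eq_zero] at hrem
    rw [hrem, taylor_within_apply, hp, Polynomial.eval_finsetSum]
    refine Finset.sum_congr rfl fun k hk => ?_
    have hk := Finset.mem_range.1 hk
    have hmem : (1 / 2 : ℝ) ∈ Set.Ioo a b := hsub' ⟨by norm_num, by norm_num⟩
    rw [iteratedDerivWithin_eq_iteratedDeriv (uniqueDiffOn_uIcc ht.2.ne')
      ((hcd.contDiffAt (isOpen_Ioo.mem_nhds hmem)).of_le (by exact_mod_cast hk.le))
      Set.left_mem_uIcc]
    simp only [smul_eq_mul, Polynomial.eval_mul, Polynomial.eval_C, Polynomial.eval_pow,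
      Polynomial.eval_sub, Polynomial.eval_X]
    ring

/-- Below the smoothness order, a positive proportion of all pairs of increments has covariances
bounded away from zero. -/
theorem IsDesign.exists_le_sumCovSq {φ K : ℝ → ℝ} (hφ : IsDesign φ) {θ ℓ : ℕ} (hθ : 1 ≤ θ)
    (hℓ : 1 ≤ ℓ) {a b : ℝ} (hsm : SmoothOnInterval K (2 * ℓ) a b) {t₀ : ℝ}
    (ht₀ : t₀ ∈ Set.Ioo (0 : ℝ) 1) (hne : iteratedDeriv (2 * ℓ) K t₀ ≠ 0) :
    ∃ c, 0 < c ∧ ∀ᶠ n : ℕ in atTop, c * (n : ℝ) ^ 2 ≤ sumCovSq φ K θ ℓ n := by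
  have hsub' : Set.Ioo (0 : ℝ) 1 ⊆ Set.Ioo a b := Set.Ioo_subset_Ioc_self.trans hsm.1
  have hcd : ContDiffOn ℝ (2 * ℓ : ℕ) K (Set.Ioo a b) := by exact_mod_cast hsm.2
  have hcont : ContinuousOn (iteratedDeriv (2 * ℓ) K) (Set.Ioo a b) := by
    have h1 := hcd.continuousOn_iteratedDerivWithin (m := 2 * ℓ) le_rfl
      isOpen_Ioo.uniqueDiffOn
    exact h1.congr fun x hx => (iteratedDerivWithin_of_isOpen isOpen_Ioo hx).symm
  have hcont' := (hcont.continuousAt (isOpen_Ioo.mem_nhds (hsub' ht₀))).abs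
  set κ := |iteratedDeriv (2 * ℓ) K t₀| / 2 with hκ
  have hκ0 : 0 < κ := by have := abs_pos.2 hne; positivity
  have hκlt : κ < |iteratedDeriv (2 * ℓ) K t₀| := by have := abs_pos.2 hne; linarith
  obtain ⟨δ, hδ, hball⟩ := Metric.eventually_nhds_iff.1
    ((hcont'.eventually (lt_mem_nhds hκlt)).and (isOpen_Ioo.mem_nhds ht₀))
  -- Pairs of parameters near `(x₀, 0)` correspond to pairs of sites at distance close to `t₀`.
  obtain ⟨x₀, hx₀, hφx₀⟩ : ∃ x₀ ∈ Set.Ioo (0 : ℝ) 1, φ x₀ = t₀ := by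
    have := intermediate_value_Ioo (zero_le_one (α := ℝ)) hφ.contDiff.continuous.continuousOn
    rw [hφ.map_zero, hφ.map_one] at this
    exact this ht₀
  have hF : ContinuousAt (fun z : ℝ × ℝ => φ z.1 - φ z.2) (x₀, 0) :=
    ((hφ.contDiff.continuous.comp continuous_fst).sub
      (hφ.contDiff.continuous.comp continuous_snd)).continuousAt
  obtain ⟨ε₀, hε₀, hclose⟩ := Metric.continuousAt_iff.1 hF δ hδ
  obtain ⟨ε, hε, hε1, hε2⟩ : ∃ ε : ℝ, 0 < ε ∧ 2 * ε ≤ ε₀ ∧ x₀ + 2 * ε ≤ 1 :=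
    ⟨min (ε₀ / 2) ((1 - x₀) / 2), lt_min (by positivity) (by linarith [hx₀.2]),
      by linarith [min_le_left (ε₀ / 2) ((1 - x₀) / 2)],
      by linarith [min_le_right (ε₀ / 2) ((1 - x₀) / 2)]⟩
  refine ⟨(ε / 4 * κ) ^ 2, by positivity, ?_⟩
  set T := θ * ℓ with hT
  have hlim : ∀ C : ℝ, Tendsto (fun n : ℕ => C / ((n : ℝ) - 1)) atTop (𝓝 0) := fun C =>
    tendsto_const_nhds.div_atTop
      (tendsto_atTop_add_const_right _ _ tendsto_natCast_atTop_atTop)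
  filter_upwards [eventually_ge_atTop 2, (hlim (T + 1)).eventually (gt_mem_nhds hε),
    (hlim 2).eventually (gt_mem_nhds hε)] with n hn hnT hn2
  have hn' : (2 : ℝ) ≤ n := by exact_mod_cast hn
  have hn1 : (0 : ℝ) < (n : ℝ) - 1 := by linarith
  set N := ⌊ε * ((n : ℝ) - 1)⌋₊ with hN
  set M := ⌈x₀ * ((n : ℝ) - 1)⌉₊ with hM
  have hN1 : (N : ℝ) ≤ ε * (n - 1) := Nat.floor_le (by positivity)
  have hN2 : ε / 4 * n ≤ N := by
    have h1 := Nat.lt_floor_add_one (ε * ((n : ℝ) - 1))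
    rw [div_lt_iff₀ hn1] at hn2
    have h2 : ε * n ≤ 2 * (ε * (n - 1)) := by nlinarith
    linarith
  have hM1 : x₀ * (n - 1) ≤ M := Nat.le_ceil _
  have hM2 : (M : ℝ) < x₀ * (n - 1) + 1 := Nat.ceil_lt_add_one (by nlinarith [hx₀.1])
  rw [div_lt_iff₀ hn1] at hnT
  have hMN : M + N + T < n := by
    have h1 : (M : ℝ) + N + T < n - 1 + 1 := by
      have : (x₀ + 2 * ε) * (n - 1) ≤ 1 * (n - 1) := mul_le_mul_of_nonneg_right hε2 hn1.le
      nlinarith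
    rw [sub_add_cancel] at h1
    exact_mod_cast h1
  have hparam : ∀ i : ℕ, ∀ y : ℝ, y * (n - 1) ≤ (i : ℝ) - 1 → (i : ℝ) - 1 < (y + 2 * ε) * (n - 1) →
      dist (param n i) y < ε₀ := by
    intro i y h1 h2
    have h3 : y ≤ param n i := (le_div_iff₀ hn1).2 h1
    have h4 : param n i < y + 2 * ε := (div_lt_iff₀ hn1).2 h2
    rw [Real.dist_eq, abs_of_nonneg (by linarith)]
    linarith
  have hpair : ∀ i j : ℕ, M + 1 ≤ i → i < M + 1 + N + T + 1 → 1 ≤ j → j < 1 + N + T + 1 →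
      dist (site φ n i - site φ n j) t₀ < δ := by
    intro i j hi1 hi2 hj1 hj2
    have e1 : ((M : ℝ) + 1) ≤ i := by exact_mod_cast hi1
    have e2 : (i : ℝ) ≤ M + 1 + N + T := by exact_mod_cast (show i ≤ M + 1 + N + T by omega)
    have e3 : (1 : ℝ) ≤ j := by exact_mod_cast hj1
    have e4 : (j : ℝ) ≤ 1 + N + T := by exact_mod_cast (show j ≤ 1 + N + T by omega)
    have h1 := hclose (x := (param n i, param n j)) (by
      rw [Prod.dist_eq]
      refine max_lt (hparam i x₀ (by linarith) (by linarith)) (hparam j 0 (by linarith) ?_)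
      linarith)
    simpa [hφx₀, hφ.map_zero, site, param] using h1
  have hterm : ∀ i ∈ Finset.Ico (M + 1) (M + 1 + N), ∀ j ∈ Finset.Ico 1 (1 + N),
      κ ^ 2 ≤ incrCov φ K θ ℓ n i j ^ 2 := by
    intro i hi j hj
    rw [Finset.mem_Ico] at hi hj
    have hu := hφ.node_lt (ℓ := ℓ) hθ hn (i := i) (Finset.mem_Icc.2 ⟨by omega, by omega⟩)
    have hv := hφ.node_lt (ℓ := ℓ) hθ hn (i := j) (Finset.mem_Icc.2 ⟨by omega, by omega⟩)
    have hd1 := hpair i (j + T) (by omega) (by omega) (by omega) (by omega)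
    have hd2 := hpair (i + T) j (by omega) (by omega) (by omega) (by omega)
    rw [Real.dist_eq, abs_lt] at hd1 hd2
    have hnode : ∀ i, node φ θ (n, i) 0 = site φ n i := fun i => by simp [node]
    have hnodeℓ : ∀ i, node φ θ (n, i) ℓ = site φ n (i + T) := fun i => rfl
    have hcdδ : ContDiffOn ℝ (2 * ℓ : ℕ) K (Set.Ioo (t₀ - δ) (t₀ + δ)) := by
      refine hcd.mono fun x hx => hsub' (hball (y := x) ?_).2
      rw [Real.dist_eq, abs_lt]
      exact ⟨by linarith [hx.1], by linarith [hx.2]⟩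
    obtain ⟨ξ, hξ, η, hη, h⟩ := exists_ddKernel_eq_iteratedDeriv ℓ hℓ _ _ hu hv K _ _ hcdδ
      (by rw [hnode, hnodeℓ]; linarith) (by rw [hnode, hnodeℓ]; linarith)
    rw [hnode, hnodeℓ] at hξ hη
    have h1 := (hball (y := ξ - η) (by
      rw [Real.dist_eq, abs_lt]
      exact ⟨by linarith [hξ.1, hη.2], by linarith [hξ.2, hη.1]⟩)).1
    rw [incrCov, h, mul_pow, ← pow_mul, mul_comm ℓ 2, pow_mul, neg_one_sq, one_pow, one_mul,
      ← sq_abs (iteratedDeriv _ _ _)]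
    exact pow_le_pow_left₀ hκ0.le h1.le 2
  have hsubI : Finset.Ico (M + 1) (M + 1 + N) ⊆ Finset.Icc 1 (n - T) := fun i hi => by
    rw [Finset.mem_Ico] at hi
    exact Finset.mem_Icc.2 ⟨by omega, by omega⟩
  have hsubJ : Finset.Ico 1 (1 + N) ⊆ Finset.Icc 1 (n - T) := fun i hi => by
    rw [Finset.mem_Ico] at hi
    exact Finset.mem_Icc.2 ⟨by omega, by omega⟩
  calc (ε / 4 * κ) ^ 2 * (n : ℝ) ^ 2 = (ε / 4 * n) ^ 2 * κ ^ 2 := by ring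
    _ ≤ (N : ℝ) ^ 2 * κ ^ 2 := by gcongr
    _ = ∑ i ∈ Finset.Ico (M + 1) (M + 1 + N), ∑ j ∈ Finset.Ico 1 (1 + N), κ ^ 2 := by
        simp only [Finset.sum_const, Nat.card_Ico, nsmul_eq_mul, Nat.add_sub_cancel_left]
        ring
    _ ≤ ∑ i ∈ Finset.Ico (M + 1) (M + 1 + N), ∑ j ∈ Finset.Ico 1 (1 + N),
          incrCov φ K θ ℓ n i j ^ 2 :=
        Finset.sum_le_sum fun i hi => Finset.sum_le_sum fun j hj => hterm i hi j hj
    _ ≤ ∑ i ∈ Finset.Ico (M + 1) (M + 1 + N), ∑ j ∈ Finset.Icc 1 (n - T),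
          incrCov φ K θ ℓ n i j ^ 2 :=
        Finset.sum_le_sum fun i _ =>
          Finset.sum_le_sum_of_subset_of_nonneg hsubJ fun _ _ _ => sq_nonneg _
    _ ≤ sumCovSq φ K θ ℓ n :=
        Finset.sum_le_sum_of_subset_of_nonneg hsubI fun _ _ _ =>
          Finset.sum_nonneg fun _ _ => sq_nonneg _

/-! ### Squares of Gaussian variables -/

lemma integral_pow_four_gaussianReal : ∫ x, x ^ 4 ∂gaussianReal 0 1 = 3 := by
  have hstep : ∀ p p' : ℝ → ℝ, (∀ t, HasDerivAt p (p' t) t) →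
      deriv (fun t => p t * Real.exp (t ^ 2 / 2)) =
        fun t => (p' t + t * p t) * Real.exp (t ^ 2 / 2) := by
    intro p p' hp
    ext t
    have h1 : HasDerivAt (fun t : ℝ => Real.exp (t ^ 2 / 2)) (Real.exp (t ^ 2 / 2) * t) t := by
      have := (((hasDerivAt_id t).pow 2).div_const 2).exp
      simpa using this
    rw [((hp t).fun_mul h1).deriv]
    ring
  have h1 : ∫ x, x ^ 4 ∂gaussianReal 0 1 =
      iteratedDeriv 4 (mgf (fun x => x) (gaussianReal 0 1)) 0 := by
    rw [iteratedDeriv_mgf_zero] <;> simp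
  have h2 : mgf (fun x => x) (gaussianReal 0 1) = 
      fun t => (fun _ => 1) t * Real.exp (t ^ 2 / 2) := by
    rw [mgf_fun_id_gaussianReal]
    ext t
    simp
  rw [h1, h2, iteratedDeriv_succ', iteratedDeriv_succ', iteratedDeriv_succ', iteratedDeriv_succ',
    iteratedDeriv_zero, hstep (fun _ => 1) (fun _ => 0) (fun t => hasDerivAt_const _ _),
    hstep (fun t => 0 + t * 1) (fun _ => 1) (fun t => by simpa using hasDerivAt_id' t),
    hstep (fun t => 1 + t * (0 + t * 1)) (fun t => 2 * t) (fun t => by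
      have := ((hasDerivAt_id t).pow 2).const_add 1
      convert! this using 1 <;> simp [sq]),
    hstep (fun t => 2 * t + t * (1 + t * (0 + t * 1))) (fun t => 3 + 3 * t ^ 2) (fun t => by
      have := ((hasDerivAt_id t).const_mul 3).add ((hasDerivAt_id t).pow 3)
      convert! this using 1
      · ext x; simp; ring
      · simp)]
  norm_num

lemma integral_exp_sq_gaussianReal {r : ℝ} (hr : r < 1 / 2) :
    ∫ x, Real.exp (r * x ^ 2) ∂gaussianReal 0 1 = (Real.sqrt (1 - 2 * r))⁻¹ := by
  rw [integral_gaussianReal_eq_integral_smul one_ne_zero]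
  have h1 : ∀ x : ℝ, gaussianPDFReal 0 1 x • Real.exp (r * x ^ 2) =
      (Real.sqrt (2 * Real.pi))⁻¹ * Real.exp (-(1 / 2 - r) * x ^ 2) := by
    intro x
    rw [gaussianPDFReal, smul_eq_mul, mul_assoc, ← Real.exp_add]
    simp only [NNReal.coe_one, mul_one, sub_zero]
    congr 2
    ring
  simp_rw [h1]
  rw [integral_const_mul, integral_gaussian, ← Real.sqrt_inv, ← Real.sqrt_mul (by positivity),
    ← Real.sqrt_inv]
  congr 1
  have h2 : 1 / 2 - r ≠ 0 := by linarith
  have h3 : 1 - 2 * r ≠ 0 := by linarith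
  have := Real.pi_pos.ne'
  field_simp

/-- The centred square of a standard Gaussian variable is sub-exponential. -/
lemma inv_sqrt_mul_exp_le {r : ℝ} (hr : |r| ≤ 1 / 6) :
    (Real.sqrt (1 - 2 * r))⁻¹ * Real.exp (-r) ≤ Real.exp (2 * r ^ 2) := by
  rw [abs_le] at hr
  have h0 : 0 < 1 - 2 * r := by linarith
  have hkey : 1 ≤ (1 - 2 * r) * Real.exp (2 * r + 4 * r ^ 2) := by
    rcases le_total r 0 with hr0 | hr0
    · have h1 := Real.add_one_le_exp (2 * r + 4 * r ^ 2)
      have h2 : (1 - 2 * r) * (2 * r + 4 * r ^ 2 + 1) = 1 - 8 * r ^ 3 := by ring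
      have h3 : r ^ 3 ≤ 0 := by
        rw [pow_succ]; exact mul_nonpos_of_nonneg_of_nonpos (sq_nonneg r) hr0
      nlinarith [mul_le_mul_of_nonneg_left h1 h0.le]
    · have h1 := Real.quadratic_le_exp_of_nonneg (x := 2 * r + 4 * r ^ 2) (by positivity)
      have h2 : 1 + 2 * r + 6 * r ^ 2 ≤ Real.exp (2 * r + 4 * r ^ 2) := by
        nlinarith [pow_nonneg hr0 3, pow_nonneg hr0 4]
      have h3 : (1 - 2 * r) * (1 + 2 * r + 6 * r ^ 2) = 1 + 2 * r ^ 2 * (1 - 6 * r) := by ring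
      nlinarith [mul_le_mul_of_nonneg_left h2 h0.le,
        mul_nonneg (sq_nonneg r) (show 0 ≤ 1 - 6 * r by linarith)]
  have hs : 0 < Real.sqrt (1 - 2 * r) := Real.sqrt_pos.2 h0
  rw [inv_mul_le_iff₀ hs]
  have h4 : Real.exp (-r) ^ 2 ≤ (Real.sqrt (1 - 2 * r) * Real.exp (2 * r ^ 2)) ^ 2 := by
    rw [mul_pow, Real.sq_sqrt h0.le, ← Real.exp_nat_mul, ← Real.exp_nat_mul]
    have h5 : Real.exp (((2 : ℕ) : ℝ) * (2 * r ^ 2)) =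
        Real.exp (2 * r + 4 * r ^ 2) * Real.exp (((2 : ℕ) : ℝ) * -r) := by
      rw [← Real.exp_add]
      congr 1
      push_cast
      ring
    rw [h5, ← mul_assoc]
    exact le_mul_of_one_le_left (Real.exp_pos _).le hkey
  exact (pow_le_pow_iff_left₀ (Real.exp_pos _).le (by positivity) two_ne_zero).1 h4

section square

variable {Ω : Type*} [MeasurableSpace Ω] {P : Measure Ω} {W : Ω → ℝ}

lemma map_eq_map_gaussianReal (hW : HasGaussianLaw W P) (h0 : P[W] = 0) :
    P.map W = (gaussianReal 0 1).map (fun x => Real.sqrt Var[W; P] * x) := by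
  rw [hW.map_eq_gaussianReal, h0, gaussianReal_map_const_mul, mul_zero, mul_one]
  congr 1
  ext
  simp [Real.sq_sqrt (variance_nonneg W P), variance_nonneg]

lemma integral_comp_of_gaussian (hW : HasGaussianLaw W P) (h0 : P[W] = 0) (g : ℝ → ℝ)
    (hg : Continuous g) :
    ∫ ω, g (W ω) ∂P = ∫ x, g (Real.sqrt Var[W; P] * x) ∂gaussianReal 0 1 := by
  rw [← integral_map hW.aemeasurable (f := g) hg.aestronglyMeasurable,
    map_eq_map_gaussianReal hW h0,
    integral_map (by fun_prop) hg.aestronglyMeasurable]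

lemma memLp_sq_of_gaussian (hW : HasGaussianLaw W P) : MemLp (fun ω => W ω ^ 2) 2 P := by
  have h := hW.memLp (p := 4) (by simp)
  rw [memLp_two_iff_integrable_sq (hW.aemeasurable.pow_const 2).aestronglyMeasurable]
  have h4 := h.integrable_norm_pow (by norm_num)
  refine h4.congr (Eventually.of_forall fun ω => ?_)
  simp only [Real.norm_eq_abs]
  rw [← pow_mul, show |W ω| ^ 4 = (|W ω| ^ 2) ^ 2 by ring, sq_abs]
  ring

lemma integral_sq_of_gaussian (hW : HasGaussianLaw W P) (h0 : P[W] = 0) :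
    ∫ ω, W ω ^ 2 ∂P = Var[W; P] := by
  have := variance_of_integral_eq_zero hW.aemeasurable h0
  rw [this]

lemma variance_sq_of_gaussian [IsProbabilityMeasure P] (hW : HasGaussianLaw W P) (h0 : P[W] = 0) :
    Var[fun ω => W ω ^ 2; P] = 2 * Var[W; P] ^ 2 := by
  rw [variance_eq_sub (memLp_sq_of_gaussian hW)]
  have h1 : P[(fun ω => W ω ^ 2) ^ 2] = 3 * Var[W; P] ^ 2 := by
    have h2 := integral_comp_of_gaussian hW h0 (fun x => x ^ 4) (by fun_prop)
    have h3 : ∀ x : ℝ, (Real.sqrt Var[W; P] * x) ^ 4 = Var[W; P] ^ 2 * x ^ 4 := fun x => by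
      rw [mul_pow, show Real.sqrt Var[W; P] ^ 4 = (Real.sqrt Var[W; P] ^ 2) ^ 2 by ring,
        Real.sq_sqrt (variance_nonneg W P)]
    simp only [h3] at h2
    rw [integral_const_mul, integral_pow_four_gaussianReal] at h2
    rw [show (fun ω => W ω ^ 2) ^ 2 = fun ω => W ω ^ 4 by ext ω; simp [← pow_mul], h2]
    ring
  rw [h1, integral_sq_of_gaussian hW h0]
  ring

lemma mgf_sq_sub_of_gaussian (hW : HasGaussianLaw W P) (h0 : P[W] = 0) {s : ℝ}
    (hs : |s * Var[W; P]| ≤ 1 / 6) :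
    0 < mgf (fun ω => W ω ^ 2 - Var[W; P]) P s ∧
      mgf (fun ω => W ω ^ 2 - Var[W; P]) P s ≤ Real.exp (2 * (s * Var[W; P]) ^ 2) := by
  set v := Var[W; P] with hv
  have h1 : mgf (fun ω => W ω ^ 2 - v) P s =
      (Real.sqrt (1 - 2 * (s * v)))⁻¹ * Real.exp (-(s * v)) := by
    rw [mgf, integral_comp_of_gaussian hW h0 (fun x => Real.exp (s * (x ^ 2 - v))) (by fun_prop),
      ← integral_exp_sq_gaussianReal (by linarith [(abs_le.1 hs).2]), ← integral_mul_const]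
    congr 1
    ext x
    rw [← Real.exp_add, mul_pow, Real.sq_sqrt (variance_nonneg W P)]
    congr 1
    ring
  rw [h1]
  have h2 : 0 < 1 - 2 * (s * v) := by linarith [(abs_le.1 hs).2]
  exact ⟨by positivity, inv_sqrt_mul_exp_le hs⟩

end square

/-! ### Quadratic forms in Gaussian vectors -/

section quadratic

variable {Ω : Type*} [MeasurableSpace Ω] {P : Measure Ω} {ι : Type*} [Fintype ι]

open Matrix in
/-- The sum of squares of a centred Gaussian vector is the sum of squares of independent centred
Gaussian variables, whose variances are the eigenvalues of the covariance matrix. -/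
theorem exists_indep_sum_sq_eq [IsProbabilityMeasure P] {Y : ι → Ω → ℝ}
    (hY : HasGaussianLaw (fun ω => (Y · ω)) P) (h0 : ∀ i, P[Y i] = 0) :
    ∃ Z : ι → Ω → ℝ, iIndepFun Z P ∧ (∀ m, HasGaussianLaw (Z m) P) ∧ (∀ m, P[Z m] = 0) ∧
      (∀ ω, ∑ i, Y i ω ^ 2 = ∑ m, Z m ω ^ 2) ∧
      (∑ m, Var[Z m; P] = ∑ i, Var[Y i; P]) ∧
      ∑ m, Var[Z m; P] ^ 2 = ∑ i, ∑ j, cov[Y i, Y j; P] ^ 2 := by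
  classical
  set M : Matrix ι ι ℝ := fun i j => cov[Y i, Y j; P] with hM
  have hMT : Mᵀ = M := by
    ext i j
    exact covariance_comm (Y j) (Y i)
  have hH : M.IsHermitian := by
    rw [IsHermitian, conjTranspose_eq_transpose_of_trivial, hMT]
  set d := hH.eigenvalues
  set U : Matrix ι ι ℝ := (hH.eigenvectorUnitary : Matrix ι ι ℝ) with hU
  have hUT : star U = Uᵀ := by
    rw [star_eq_conjTranspose, conjTranspose_eq_transpose_of_trivial]
  have hU1 : Uᵀ * U = 1 := by
    rw [← hUT]; exact Unitary.coe_star_mul_self _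
  have hU2 : U * Uᵀ = 1 := by
    rw [← hUT]; exact Unitary.coe_mul_star_self _
  have hspec : M = U * diagonal d * Uᵀ := by
    have := hH.spectral_theorem
    rw [Unitary.conjStarAlgAut_apply, ← hU, hUT] at this
    simpa using this
  have hdiag : Uᵀ * M * U = diagonal d := by
    rw [hspec]
    calc Uᵀ * (U * diagonal d * Uᵀ) * U = (Uᵀ * U) * diagonal d * (Uᵀ * U) := by
          simp only [Matrix.mul_assoc]
      _ = diagonal d := by rw [hU1, Matrix.one_mul, Matrix.mul_one]
  set Z : ι → Ω → ℝ := fun m ω => (Uᵀ *ᵥ fun i => Y i ω) m with hZ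
  have hZe : ∀ m, Z m = fun ω => ∑ i, U i m * Y i ω := by
    intro m
    ext ω
    simp [hZ, mulVec, dotProduct]
  have hYe : ∀ i, HasGaussianLaw (Y i) P := fun i => hY.eval i
  have hZG : HasGaussianLaw (fun ω => (Z · ω)) P :=
    hY.map_fun (LinearMap.toContinuousLinearMap (Matrix.toLin' Uᵀ))
  have hcov : ∀ m k, cov[Z m, Z k; P] = diagonal d m k := by
    intro m k
    rw [hZe, hZe, covariance_fun_sum_fun_sum (fun i => (hYe i).memLp_two.const_mul _)
      (fun i => (hYe i).memLp_two.const_mul _), ← hdiag]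
    simp only [covariance_const_mul_left, covariance_const_mul_right, Matrix.mul_apply,
      transpose_apply, Finset.sum_mul]
    rw [Finset.sum_comm]
    exact Finset.sum_congr rfl fun i _ => Finset.sum_congr rfl fun j _ => by
      simp only [hM]
      ring
  have hvar : ∀ m, Var[Z m; P] = d m := by
    intro m
    rw [← covariance_self (hZG.eval m).aemeasurable, hcov, diagonal_apply_eq]
  refine ⟨Z, ?_, fun m => hZG.eval m, fun m => ?_, fun ω => ?_, ?_, ?_⟩
  · exact hZG.iIndepFun_of_covariance_eq_zero fun i j hij => by
      rw [hcov, diagonal_apply_ne _ hij]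
  · rw [hZe, integral_finsetSum _ fun i _ => (hYe i).integrable.const_mul _]
    refine Finset.sum_eq_zero fun i _ => ?_
    rw [integral_const_mul, h0, mul_zero]
  · have h1 : (Uᵀ *ᵥ fun i => Y i ω) ⬝ᵥ (Uᵀ *ᵥ fun i => Y i ω) =
        (fun i => Y i ω) ⬝ᵥ fun i => Y i ω := by
      rw [dotProduct_mulVec, vecMul_transpose, mulVec_mulVec, hU2, one_mulVec]
    simp only [dotProduct, ← sq] at h1
    exact h1.symm
  · simp only [hvar]
    have h1 := hH.trace_eq_sum_eigenvalues
    simp only [RCLike.ofReal_real_eq_id, id_eq] at h1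
    rw [← h1, trace]
    exact Finset.sum_congr rfl fun i _ => covariance_self (hYe i).aemeasurable
  · simp only [hvar]
    have h1 : (M * M).trace = ∑ m, d m ^ 2 := by
      have h2 : M * M = U * (diagonal d * diagonal d) * Uᵀ := by
        rw [hspec]
        calc U * diagonal d * Uᵀ * (U * diagonal d * Uᵀ)
            = U * diagonal d * (Uᵀ * U) * diagonal d * Uᵀ := by simp only [Matrix.mul_assoc]
          _ = _ := by rw [hU1, Matrix.mul_one]; simp only [Matrix.mul_assoc]
      rw [h2, trace_mul_comm, ← Matrix.mul_assoc, hU1, Matrix.one_mul, diagonal_mul_diagonal,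
        trace_diagonal]
      exact Finset.sum_congr rfl fun m _ => (sq _).symm
    rw [← h1, trace]
    refine Finset.sum_congr rfl fun i _ => ?_
    rw [diag_apply, Matrix.mul_apply]
    refine Finset.sum_congr rfl fun j _ => ?_
    rw [sq]
    congr 1
    exact covariance_comm (Y j) (Y i)

variable {Y : ι → Ω → ℝ}

lemma integral_sum_sq_of_gaussian (hY : HasGaussianLaw (fun ω => (Y · ω)) P)
    (h0 : ∀ i, P[Y i] = 0) : ∫ ω, ∑ i, Y i ω ^ 2 ∂P = ∑ i, Var[Y i; P] := by
  have := hY.isProbabilityMeasure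
  rw [integral_finsetSum _ fun i _ =>
    (memLp_sq_of_gaussian (hY.eval i)).integrable (by norm_num)]
  exact Finset.sum_congr rfl fun i _ => integral_sq_of_gaussian (hY.eval i) (h0 i)

lemma variance_sum_sq_of_gaussian [IsProbabilityMeasure P]
    (hY : HasGaussianLaw (fun ω => (Y · ω)) P) (h0 : ∀ i, P[Y i] = 0) :
    Var[fun ω => ∑ i, Y i ω ^ 2; P] = 2 * ∑ i, ∑ j, cov[Y i, Y j; P] ^ 2 := by
  obtain ⟨Z, hind, hZ, hZ0, hsum, -, hsq⟩ := exists_indep_sum_sq_eq hY h0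
  have h1 : (fun ω => ∑ i, Y i ω ^ 2) = ∑ m, fun ω => Z m ω ^ 2 := by
    ext ω
    rw [hsum, Finset.sum_apply]
  rw [h1, IndepFun.variance_sum (fun m _ => memLp_sq_of_gaussian (hZ m)), ← hsq, Finset.mul_sum]
  · exact Finset.sum_congr rfl fun m _ => variance_sq_of_gaussian (hZ m) (hZ0 m)
  · intro m _ k _ hmk
    exact (hind.indepFun hmk).comp (measurable_id.pow_const 2) (measurable_id.pow_const 2)

/-- The moment generating function of a centred Gaussian quadratic form is bounded on a range of the
order of the reciprocal standard deviation. -/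
lemma mgf_sum_sq_sub_of_gaussian [IsProbabilityMeasure P]
    (hY : HasGaussianLaw (fun ω => (Y · ω)) P) (h0 : ∀ i, P[Y i] = 0) {s : ℝ}
    (hs : s ^ 2 * ∑ i, ∑ j, cov[Y i, Y j; P] ^ 2 ≤ 1 / 36) :
    Integrable (fun ω => Real.exp (s * (∑ i, Y i ω ^ 2 - ∑ i, Var[Y i; P]))) P ∧
      mgf (fun ω => ∑ i, Y i ω ^ 2 - ∑ i, Var[Y i; P]) P s ≤ Real.exp 1 := by
  obtain ⟨Z, hind, hZ, hZ0, hsum, hlin, hsq⟩ := exists_indep_sum_sq_eq hY h0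
  rw [← hsq] at hs
  have h1 : (fun ω => ∑ i, Y i ω ^ 2 - ∑ i, Var[Y i; P]) =
      ∑ m, fun ω => Z m ω ^ 2 - Var[Z m; P] := by
    ext ω
    rw [hsum, ← hlin, Finset.sum_apply, Finset.sum_sub_distrib]
  have hind' : iIndepFun (fun m ω => Z m ω ^ 2 - Var[Z m; P]) P :=
    hind.comp (fun m x => x ^ 2 - Var[Z m; P]) (fun m => (measurable_id.pow_const 2).sub_const _)
  have hmgf := hind'.mgf_sum₀ (t := s)
    (fun m => ((hZ m).aemeasurable.pow_const 2).sub_const _) Finset.univ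
  -- Each single eigenvalue is bounded by the Hilbert-Schmidt norm of the covariance matrix.
  have hsmall : ∀ m, |s * Var[Z m; P]| ≤ 1 / 6 := by
    intro m
    refine abs_le_of_sq_le_sq (a := s * Var[Z m; P]) (b := 1 / 6) ?_ (by norm_num)
    have h2 := Finset.single_le_sum (f := fun m => Var[Z m; P] ^ 2) (fun m _ => sq_nonneg _)
      (Finset.mem_univ m)
    rw [mul_pow]
    calc s ^ 2 * Var[Z m; P] ^ 2 ≤ s ^ 2 * ∑ m, Var[Z m; P] ^ 2 :=
          mul_le_mul_of_nonneg_left h2 (sq_nonneg s)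
      _ ≤ (1 / 6) ^ 2 := by norm_num at hs ⊢; exact hs
  have hpos : 0 < mgf (fun ω => ∑ i, Y i ω ^ 2 - ∑ i, Var[Y i; P]) P s := by
    rw [h1, hmgf]
    exact Finset.prod_pos fun m _ => (mgf_sq_sub_of_gaussian (hZ m) (hZ0 m) (hsmall m)).1
  refine ⟨Integrable.of_integral_ne_zero hpos.ne', ?_⟩
  rw [h1, hmgf]
  calc ∏ m, mgf (fun ω => Z m ω ^ 2 - Var[Z m; P]) P s
      ≤ ∏ m, Real.exp (2 * (s * Var[Z m; P]) ^ 2) :=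
        Finset.prod_le_prod (fun m _ => mgf_nonneg)
          fun m _ => (mgf_sq_sub_of_gaussian (hZ m) (hZ0 m) (hsmall m)).2
    _ = Real.exp (2 * (s ^ 2 * ∑ m, Var[Z m; P] ^ 2)) := by
        rw [← Real.exp_sum, Finset.mul_sum, Finset.mul_sum]
        congr 1
        exact Finset.sum_congr rfl fun m _ => by ring
    _ ≤ Real.exp 1 := Real.exp_le_exp.2 (by linarith)

end quadratic

/-! ### Moments of the quadratic variation -/

lemma sum_ddWeight_eq_zero {ℓ : ℕ} (hℓ : 1 ≤ ℓ) {u : ℕ → ℝ} (hu : ∀ k < ℓ, u k < u (k + 1)) :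
    ∑ k ∈ Finset.range (ℓ + 1), ddWeight ℓ u k = 0 := by
  obtain ⟨ξ, -, h⟩ := exists_sum_ddWeight_eq_iteratedDeriv ℓ hℓ u hu (fun _ => 1)
    continuousOn_const contDiffOn_const
  simp only [mul_one] at h
  rw [h, iteratedDeriv_const, if_neg (by omega)]

section process

variable {Ω : Type*} [MeasurableSpace Ω] {P : Measure Ω} {X : ℝ → Ω → ℝ}
  {K φ : ℝ → ℝ} {θ ℓ : ℕ} {μ : ℝ}

/-- The centred process, as a curve in `L²`, represents the covariance as an inner product. -/
lemma exists_inner_eq [IsProbabilityMeasure P] (hX : IsGaussianProcess X P)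
    (hcov : ∀ x y, cov[X x, X y; P] = K (x - y)) :
    ∃ Z : ℝ → Lp ℝ 2 P, ∀ x y, inner ℝ (Z x) (Z y) = K (x - y) := by
  have hm : ∀ t, MemLp (fun ω => X t ω - P[X t]) 2 P := fun t =>
    (hX.hasGaussianLaw_eval t).memLp_two.sub (memLp_const _)
  refine ⟨fun t => (hm t).toLp, fun x y => ?_⟩
  rw [← hcov, L2.inner_def, covariance]
  refine integral_congr_ae ?_
  filter_upwards [(hm x).coeFn_toLp, (hm y).coeFn_toLp] with ω h1 h2
  rw [h1, h2]
  simp [mul_comm]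

lemma isGaussianProcess_nabla (hX : IsGaussianProcess X P) (t : ℕ → ℝ) (θ ℓ : ℕ) :
    IsGaussianProcess (fun i ω => nabla t θ ℓ (fun s => X s ω) i) P := by
  classical
  refine hX.of_isGaussianProcess fun i =>
    ⟨(Finset.range (ℓ + 1)).image fun k => t (i + θ * k),
      ∑ k ∈ (Finset.range (ℓ + 1)).attach, coeff t θ ℓ i k •
        ContinuousLinearMap.proj ⟨t (i + θ * k), Finset.mem_image_of_mem _ k.2⟩, fun ω => ?_⟩
  simp only [sum_apply, smul_apply,
    ContinuousLinearMap.proj_apply, smul_eq_mul, Finset.restrict]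
  rw [nabla, ← Finset.sum_attach]

lemma integral_nabla (hX : IsGaussianProcess X P) (hmean : ∀ t, P[X t] = μ) (hφ : IsDesign φ)
    (hθ : 1 ≤ θ) (hℓ : 1 ≤ ℓ) {n i : ℕ} (hn : 2 ≤ n) (hi : i ∈ Finset.Icc 1 (n - θ * ℓ)) :
    ∫ ω, nabla (site φ n) θ ℓ (fun s => X s ω) i ∂P = 0 := by
  simp only [nabla]
  rw [integral_finsetSum _ fun k _ => (hX.hasGaussianLaw_eval _).integrable.const_mul _]
  simp only [integral_const_mul, hmean]
  rw [← Finset.sum_mul]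
  have := sum_ddWeight_eq_zero hℓ (hφ.node_lt hθ hn hi)
  simp only [coeff_eq_ddWeight]
  exact (congrArg (· * μ) this).trans (zero_mul μ)

lemma covariance_nabla [IsProbabilityMeasure P] (hX : IsGaussianProcess X P)
    (hcov : ∀ x y, cov[X x, X y; P] = K (x - y)) (n i j : ℕ) :
    cov[fun ω => nabla (site φ n) θ ℓ (fun s => X s ω) i,
      fun ω => nabla (site φ n) θ ℓ (fun s => X s ω) j; P] = incrCov φ K θ ℓ n i j := by
  simp only [nabla]
  rw [covariance_fun_sum_fun_sum' (fun k _ => (hX.hasGaussianLaw_eval _).memLp_two.const_mul _)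
    (fun k _ => (hX.hasGaussianLaw_eval _).memLp_two.const_mul _)]
  simp only [covariance_const_mul_left, covariance_const_mul_right, hcov, incrCov, ddKernel]
  refine Finset.sum_congr rfl fun k _ => Finset.sum_congr rfl fun l _ => ?_
  rw [coeff_eq_ddWeight, coeff_eq_ddWeight, mul_left_comm, ← mul_assoc]
  rfl

lemma quadVar_eq_sum_coe {Ω : Type*} (φ : ℝ → ℝ) (X : ℝ → Ω → ℝ) (θ ℓ n : ℕ) :
    quadVar φ X θ ℓ n = fun ω =>
      ∑ i : Finset.Icc 1 (n - θ * ℓ), nabla (site φ n) θ ℓ (fun s => X s ω) i ^ 2 := by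
  ext ω
  rw [quadVar, ← Finset.sum_coe_sort]

lemma sum_variance_nabla [IsProbabilityMeasure P] (hX : IsGaussianProcess X P)
    (hcov : ∀ x y, cov[X x, X y; P] = K (x - y)) (n : ℕ) :
    ∑ i : Finset.Icc 1 (n - θ * ℓ), Var[fun ω => nabla (site φ n) θ ℓ (fun s => X s ω) i; P] =
      ∑ i ∈ Finset.Icc 1 (n - θ * ℓ), incrCov φ K θ ℓ n i i := by
  rw [← Finset.sum_coe_sort (Finset.Icc 1 (n - θ * ℓ)) fun i => incrCov φ K θ ℓ n i i]
  refine Finset.sum_congr rfl fun i _ => ?_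
  rw [← covariance_self ((isGaussianProcess_nabla hX _ θ ℓ).aemeasurable _),
    covariance_nabla hX hcov]

lemma integral_quadVar [IsProbabilityMeasure P] (hX : IsGaussianProcess X P)
    (hmean : ∀ t, P[X t] = μ)
    (hcov : ∀ x y, cov[X x, X y; P] = K (x - y)) (hφ : IsDesign φ)
    (hθ : 1 ≤ θ) (hℓ : 1 ≤ ℓ) {n : ℕ} (hn : 2 ≤ n) :
    P[quadVar φ X θ ℓ n] = ∑ i ∈ Finset.Icc 1 (n - θ * ℓ), incrCov φ K θ ℓ n i i := by
  rw [quadVar_eq_sum_coe, ← sum_variance_nabla hX hcov]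
  exact integral_sum_sq_of_gaussian ((isGaussianProcess_nabla hX (site φ n) θ ℓ).hasGaussianLaw _)
    fun i => integral_nabla hX hmean hφ hθ hℓ hn i.2

lemma sum_covariance_nabla_sq [IsProbabilityMeasure P] (hX : IsGaussianProcess X P)
    (hcov : ∀ x y, cov[X x, X y; P] = K (x - y)) (n : ℕ) :
    ∑ i : Finset.Icc 1 (n - θ * ℓ), ∑ j : Finset.Icc 1 (n - θ * ℓ),
      cov[fun ω => nabla (site φ n) θ ℓ (fun s => X s ω) i,
        fun ω => nabla (site φ n) θ ℓ (fun s => X s ω) j; P] ^ 2 = sumCovSq φ K θ ℓ n := by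
  rw [sumCovSq, ← Finset.sum_coe_sort (Finset.Icc 1 (n - θ * ℓ)) fun i =>
    ∑ j ∈ Finset.Icc 1 (n - θ * ℓ), incrCov φ K θ ℓ n i j ^ 2]
  refine Finset.sum_congr rfl fun i _ => ?_
  rw [← Finset.sum_coe_sort (Finset.Icc 1 (n - θ * ℓ)) fun j => incrCov φ K θ ℓ n i j ^ 2]
  exact Finset.sum_congr rfl fun j _ => by rw [covariance_nabla hX hcov]

lemma normVar_eq [IsProbabilityMeasure P] (hX : IsGaussianProcess X P) (hmean : ∀ t, P[X t] = μ)
    (hcov : ∀ x y, cov[X x, X y; P] = K (x - y)) (hφ : IsDesign φ)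
    (hθ : 1 ≤ θ) (hℓ : 1 ≤ ℓ) {n : ℕ} (hn : 2 ≤ n) :
    normVar P φ X θ ℓ n = 2 * sumCovSq φ K θ ℓ n / P[quadVar φ X θ ℓ n] ^ 2 := by
  have h1 : Var[quadVar φ X θ ℓ n; P] = 2 * sumCovSq φ K θ ℓ n := by
    rw [quadVar_eq_sum_coe, ← sum_covariance_nabla_sq hX hcov]
    exact variance_sum_sq_of_gaussian
      ((isGaussianProcess_nabla hX (site φ n) θ ℓ).hasGaussianLaw _)
      fun i => integral_nabla hX hmean hφ hθ hℓ hn i.2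
  simp only [normVar, div_eq_mul_inv]
  rw [variance_mul_const, h1, inv_pow]

lemma mgf_quadVar_sub [IsProbabilityMeasure P] (hX : IsGaussianProcess X P)
    (hmean : ∀ t, P[X t] = μ)
    (hcov : ∀ x y, cov[X x, X y; P] = K (x - y)) (hφ : IsDesign φ)
    (hθ : 1 ≤ θ) (hℓ : 1 ≤ ℓ) {n : ℕ} (hn : 2 ≤ n) {s : ℝ}
    (hs : s ^ 2 * sumCovSq φ K θ ℓ n ≤ 1 / 36) :
    Integrable (fun ω => Real.exp (s * (quadVar φ X θ ℓ n ω - P[quadVar φ X θ ℓ n]))) P ∧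
      mgf (fun ω => quadVar φ X θ ℓ n ω - P[quadVar φ X θ ℓ n]) P s ≤ Real.exp 1 := by
  rw [integral_quadVar hX hmean hcov hφ hθ hℓ hn, ← sum_variance_nabla hX hcov,
    quadVar_eq_sum_coe]
  exact mgf_sum_sq_sub_of_gaussian ((isGaussianProcess_nabla hX (site φ n) θ ℓ).hasGaussianLaw _)
    (fun i => integral_nabla hX hmean hφ hθ hℓ hn i.2)
    (le_of_eq_of_le (congrArg (s ^ 2 * ·) (sum_covariance_nabla_sq hX hcov n)) hs)

/-! ### Almost sure convergence -/

lemma ae_tendsto_of_summable [IsFiniteMeasure P] {W : ℕ → Ω → ℝ} {c : ℝ}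
    (h : ∀ ε, 0 < ε → Summable fun n => P.real {ω | ε ≤ |W n ω - c|}) :
    ∀ᵐ ω ∂P, Tendsto (fun n => W n ω) atTop (𝓝 c) := by
  have h1 : ∀ m : ℕ, ∀ᵐ ω ∂P, ∀ᶠ n in atTop, |W n ω - c| < 1 / ((m : ℝ) + 1) := by
    intro m
    have h2 : P {ω | ∃ᶠ n in atTop, 1 / ((m : ℝ) + 1) ≤ |W n ω - c|} = 0 := by
      refine measure_setOfPred_frequently_eq_zero ?_
      have h3 := (h (1 / ((m : ℝ) + 1)) (by positivity)).tsum_ofReal_ne_top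
      simpa only [ofReal_measureReal (measure_ne_top P _)] using h3
    rw [ae_iff]
    convert h2 using 3
    simp only [not_eventually, not_lt]
  filter_upwards [ae_all_iff.2 h1] with ω hω
  rw [Metric.tendsto_nhds]
  intro ε hε
  obtain ⟨m, hm⟩ := exists_nat_one_div_lt hε
  filter_upwards [hω m] with n hn
  rw [Real.dist_eq]
  exact hn.trans hm

lemma summable_exp_neg_mul_rpow {κ δ : ℝ} (hκ : 0 < κ) (hδ : 0 < δ) :
    Summable fun n : ℕ => Real.exp (-(κ * (n : ℝ) ^ δ)) := by
  have h1 : (fun x : ℝ => Real.exp (-(κ * x))) =o[atTop] fun x : ℝ => x ^ (-2 / δ) := by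
    simpa only [neg_mul] using isLittleO_exp_neg_mul_rpow_atTop hκ (-2 / δ)
  have h2 : Tendsto (fun n : ℕ => (n : ℝ) ^ δ) atTop atTop :=
    (tendsto_rpow_atTop hδ).comp tendsto_natCast_atTop_atTop
  refine summable_of_isBigO_nat (g := fun n : ℕ => (n : ℝ) ^ (-2 : ℝ))
    (Real.summable_nat_rpow.2 (by norm_num)) ((h1.comp_tendsto h2).isBigO.congr_right fun n => ?_)
  simp only [Function.comp]
  rw [← Real.rpow_mul (Nat.cast_nonneg n)]
  congr 1
  field_simp

/-- A polynomial rate for the variance of the normalized quadratic variation gives almost sure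
convergence, because the tails of Gaussian quadratic forms decay exponentially in the number of
standard deviations. -/
theorem ae_tendsto_quadVar_div [IsProbabilityMeasure P] (hX : IsGaussianProcess X P)
    (hmean : ∀ t, P[X t] = μ)
    (hcov : ∀ x y, cov[X x, X y; P] = K (x - y)) (hφ : IsDesign φ)
    (hθ : 1 ≤ θ) (hℓ : 1 ≤ ℓ) (hpos : ∀ᶠ n in atTop, 0 < P[quadVar φ X θ ℓ n]) {C δ : ℝ}
    (hδ : 0 < δ) (hvar : ∀ᶠ n : ℕ in atTop, normVar P φ X θ ℓ n ≤ C * (n : ℝ) ^ (-δ)) :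
    ∀ᵐ ω ∂P, Tendsto (fun n => quadVar φ X θ ℓ n ω / P[quadVar φ X θ ℓ n]) atTop (𝓝 1) := by
  refine ae_tendsto_of_summable fun ε hε => ?_
  -- The constant `κ` is small enough for the exponential moment at `s = κ * n ^ (δ / 2) / E V`.
  set κ : ℝ := 1 / (6 * (|C| + 1)) with hκdef
  have hκ : 0 < κ := by positivity
  have hκC : κ ^ 2 * C ≤ 1 / 18 := by
    have h1 : κ * (|C| + 1) = 1 / 6 := by rw [hκdef]; field_simp
    have h2 : κ ≤ 1 / 6 := by nlinarith [abs_nonneg C]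
    nlinarith [le_abs_self C, abs_nonneg C]
  refine summable_of_isBigO_nat ((summable_exp_neg_mul_rpow (mul_pos hκ hε)
    (half_pos hδ)).mul_left (2 * Real.exp 1)) (IsBigO.of_bound 1 ?_)
  filter_upwards [hpos, hvar, eventually_ge_atTop 2] with n hE hV hn
  have hn0 : (0 : ℝ) < n := by exact_mod_cast (show 0 < n by omega)
  set E := P[quadVar φ X θ ℓ n] with hEdef
  set s : ℝ := κ * (n : ℝ) ^ (δ / 2) / E with hs
  have hs0 : 0 < s := by positivity
  have hsS : s ^ 2 * sumCovSq φ K θ ℓ n ≤ 1 / 36 := by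
    rw [normVar_eq hX hmean hcov hφ hθ hℓ hn, ← hEdef, Real.rpow_neg hn0.le] at hV
    have hp : ((n : ℝ) ^ (δ / 2)) ^ 2 = (n : ℝ) ^ δ := by
      rw [← Real.rpow_mul_natCast hn0.le]
      congr 1
      push_cast
      ring
    have hnδ : 0 < (n : ℝ) ^ δ := Real.rpow_pos_of_pos hn0 δ
    calc s ^ 2 * sumCovSq φ K θ ℓ n
        = κ ^ 2 * (n : ℝ) ^ δ / 2 * (2 * sumCovSq φ K θ ℓ n / E ^ 2) := by
          rw [hs, div_pow, mul_pow, hp]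
          field_simp
      _ ≤ κ ^ 2 * (n : ℝ) ^ δ / 2 * (C * ((n : ℝ) ^ δ)⁻¹) :=
          mul_le_mul_of_nonneg_left hV (by positivity)
      _ = κ ^ 2 * C / 2 := by field_simp
      _ ≤ 1 / 36 := by linarith
  have hsE : s * (ε * E) = κ * ε * (n : ℝ) ^ (δ / 2) := by
    rw [hs]
    field_simp
  have hup := mgf_quadVar_sub hX hmean hcov hφ hθ hℓ hn hsS
  have hlo := mgf_quadVar_sub hX hmean hcov hφ hθ hℓ hn (s := -s) (by rwa [neg_sq])
  rw [← hEdef] at hup hlo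
  have h1 := measure_ge_le_exp_mul_mgf (ε * E) hs0.le hup.1
  have h2 := measure_le_le_exp_mul_mgf (-(ε * E)) (neg_nonpos.2 hs0.le) hlo.1
  rw [neg_mul, hsE] at h1
  rw [neg_mul_neg, neg_mul, hsE] at h2
  rw [Real.norm_of_nonneg measureReal_nonneg, Real.norm_of_nonneg (by positivity), one_mul]
  have hexp := Real.exp_pos (-(κ * ε * (n : ℝ) ^ (δ / 2)))
  calc P.real {ω | ε ≤ |quadVar φ X θ ℓ n ω / E - 1|}
      ≤ P.real ({ω | ε * E ≤ quadVar φ X θ ℓ n ω - E} ∪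
          {ω | quadVar φ X θ ℓ n ω - E ≤ -(ε * E)}) := by
        refine measureReal_mono fun ω hω => ?_
        have hω : ε ≤ |quadVar φ X θ ℓ n ω / E - 1| := hω
        rw [div_sub_one hE.ne', abs_div, abs_of_pos hE, le_div_iff₀ hE, le_abs] at hω
        rcases hω with h | h
        · exact Or.inl h
        · exact Or.inr (show quadVar φ X θ ℓ n ω - E ≤ -(ε * E) by linarith)
    _ ≤ _ := measureReal_union_le _ _
    _ ≤ 2 * Real.exp 1 * Real.exp (-(κ * ε * (n : ℝ) ^ (δ / 2))) := by
        have h3 := mul_le_mul_of_nonneg_left hup.2 hexp.le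
        have h4 := mul_le_mul_of_nonneg_left hlo.2 hexp.le
        linarith

end process

/-! ### Variances of the increments -/

section increments

variable {K φ : ℝ → ℝ} {ν βs : ℝ} {β : ℕ → ℝ} {θ ℓ : ℕ}

lemma IsDesign.eventually_shape_lt (hφ : IsDesign φ) (hθ : 1 ≤ θ) (ℓ : ℕ) :
    ∀ᶠ x in cells θ ℓ, ∀ k < ℓ, shape φ θ x k < shape φ θ x (k + 1) := by
  have h1 : ∀ᶠ x in cells θ ℓ, ∀ k < ℓ, node φ θ x k < node φ θ x (k + 1) := by
    rw [eventually_cells]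
    filter_upwards [eventually_ge_atTop 2] with n hn i hi
    exact hφ.node_lt hθ hn hi
  filter_upwards [h1, hφ.spacing_pos hθ ℓ] with x hx hx0 k hk
  exact shape_lt hx0 (hx k hk)

lemma IsDesign.eventually_grid_eq_node (hφ : IsDesign φ) (hθ : 1 ≤ θ) (ℓ : ℕ) :
    ∀ᶠ x in cells θ ℓ,
      (fun k => node φ θ x 0 + spacing φ θ x * shape φ θ x k) = node φ θ x := by
  filter_upwards [hφ.spacing_pos hθ ℓ] with x hx
  exact (node_eq_shape φ θ x hx.ne').symm

lemma HasSmoothness.tendsto_incrCov_of_lt (hK : HasSmoothness K ν β βs) (hφ : IsDesign φ)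
    (hθ : 1 ≤ θ) (hνℓ : ν < ℓ) :
    Tendsto (fun x => spacing φ θ x ^ (2 * (ℓ : ℝ) - 2 * ν) *
      incrCov φ K θ ℓ x.1 x.2 x.2) (cells θ ℓ)
      (𝓝 (βs * ddKernel ℓ (fun k => (k : ℝ)) (fun k => (k : ℝ)) (fun x => G ν |x|))) := by
  refine (hK.tendsto_ddKernel_of_lt (c := fun x => node φ θ x 0) hνℓ (hφ.tendsto_spacing hθ ℓ)
    (hφ.tendsto_shape hθ ℓ) (hφ.eventually_shape_lt hθ ℓ)).congr' ?_
  filter_upwards [hφ.eventually_grid_eq_node hθ ℓ] with x hx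
  rw [hx]
  rfl

lemma HasSmoothness.tendsto_incrCov_of_gt (hK : HasSmoothness K ν β βs) (hφ : IsDesign φ)
    (hθ : 1 ≤ θ) (hℓ : 1 ≤ ℓ) (hνℓ : ℓ < ν) :
    Tendsto (fun x => incrCov φ K θ ℓ x.1 x.2 x.2) (cells θ ℓ)
      (𝓝 (β ℓ * ((-1) ^ ℓ * ((2 * ℓ).factorial : ℝ)))) := by
  refine (hK.tendsto_ddKernel_of_gt (c := fun x => node φ θ x 0) hℓ hνℓ (hφ.tendsto_spacing hθ ℓ)
    (hφ.tendsto_shape hθ ℓ) (hφ.eventually_shape_lt hθ ℓ)).congr' ?_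
  filter_upwards [hφ.eventually_grid_eq_node hθ ℓ] with x hx
  rw [hx]
  rfl

lemma tendsto_log_fst_cells (θ ℓ : ℕ) :
    Tendsto (fun x : ℕ × ℕ => Real.log x.1) (cells θ ℓ) atTop :=
  Real.tendsto_log_atTop.comp (tendsto_natCast_atTop_atTop.comp (tendsto_fst_cells θ ℓ))

lemma IsDesign.tendsto_log_spacing_div (hφ : IsDesign φ) (hθ : 1 ≤ θ) (ℓ : ℕ) :
    Tendsto (fun x => Real.log (spacing φ θ x) / Real.log x.1) (cells θ ℓ) (𝓝 (-1)) := by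
  obtain ⟨c, C, hc, hC, h⟩ := hφ.spacing_bounds hθ ℓ
  have hlog := tendsto_log_fst_cells θ ℓ
  have hlow : Tendsto (fun x : ℕ × ℕ => Real.log c / Real.log x.1 - 1) (cells θ ℓ) (𝓝 (-1)) := by
    simpa using (tendsto_const_nhds (x := Real.log c)).div_atTop hlog |>.sub_const 1
  have hupp : Tendsto (fun x : ℕ × ℕ => Real.log C / Real.log x.1 - 1) (cells θ ℓ) (𝓝 (-1)) := by
    simpa using (tendsto_const_nhds (x := Real.log C)).div_atTop hlog |>.sub_const 1
  have hev : ∀ᶠ x in cells θ ℓ, Real.log c / Real.log x.1 - 1 ≤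
      Real.log (spacing φ θ x) / Real.log x.1 ∧
      Real.log (spacing φ θ x) / Real.log x.1 ≤ Real.log C / Real.log x.1 - 1 := by
    rw [eventually_cells]
    filter_upwards [eventually_ge_atTop 2] with n hn i hi
    have hn0 : (0 : ℝ) < n := by exact_mod_cast (show 0 < n by omega)
    have hl : 0 < Real.log n := Real.log_pos (by exact_mod_cast (show 1 < n by omega))
    obtain ⟨h1, h2⟩ := h n i hn hi
    have h0 : 0 < spacing φ θ (n, i) := (div_pos hc hn0).trans_le h1
    have h3 := Real.log_le_log (div_pos hc hn0) h1
    have h4 := Real.log_le_log h0 h2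
    rw [Real.log_div hc.ne' hn0.ne'] at h3
    rw [Real.log_div hC.ne' hn0.ne'] at h4
    have h5 : ∀ y : ℝ, y / Real.log n - 1 = (y - Real.log n) / Real.log n := fun y => by
      field_simp
    rw [h5, h5]
    exact ⟨div_le_div_of_nonneg_right h3 hl.le, div_le_div_of_nonneg_right h4 hl.le⟩
  exact tendsto_of_tendsto_of_tendsto_of_le_of_le' hlow hupp (hev.mono fun _ h => h.1)
    (hev.mono fun _ h => h.2)

lemma HasSmoothness.tendsto_incrCov_of_eq (hK : HasSmoothness K ℓ β βs) (hφ : IsDesign φ)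
    (hθ : 1 ≤ θ) :
    Tendsto (fun x => incrCov φ K θ ℓ x.1 x.2 x.2 / Real.log x.1) (cells θ ℓ)
      (𝓝 ((-1) ^ (ℓ + 1) * βs * ((2 * ℓ).factorial : ℝ))) := by
  have h1 := (hK.tendsto_ddKernel_of_eq (c := fun x => node φ θ x 0) (hφ.tendsto_spacing hθ ℓ)
    (hφ.tendsto_shape hθ ℓ) (hφ.eventually_shape_lt hθ ℓ)).mul (hφ.tendsto_log_spacing_div hθ ℓ)
  have hlog : Tendsto (fun x => Real.log (spacing φ θ x)) (cells θ ℓ) atBot :=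
    Real.tendsto_log_nhdsGT_zero.comp (hφ.tendsto_spacing hθ ℓ)
  rw [show βs * ((-1) ^ ℓ * ((2 * ℓ).factorial : ℝ)) * -1 =
    (-1) ^ (ℓ + 1) * βs * ((2 * ℓ).factorial : ℝ) by ring] at h1
  refine h1.congr' ?_
  filter_upwards [hφ.eventually_grid_eq_node hθ ℓ,
    hlog.eventually (eventually_lt_atBot 0)] with x hx hx0
  rw [hx, div_mul_div_cancel₀ hx0.ne]
  rfl

end increments

/-! ### Sums over the increments -/

/-- Unweighted averages over the increments inherit uniform limits, also when the number `n - θℓ` of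
increments is replaced by `n`. -/
lemma tendsto_sum_cells_div {θ ℓ : ℕ} {g : ℕ × ℕ → ℝ} {A : ℝ}
    (hg : Tendsto g (cells θ ℓ) (𝓝 A)) :
    Tendsto (fun n : ℕ => (∑ i ∈ Finset.Icc 1 (n - θ * ℓ), g (n, i)) / n) atTop (𝓝 A) := by
  have h1 := tendsto_weighted_average (fun _ => 1) g A (Eventually.of_forall fun _ => one_pos) hg
  have h2 : Tendsto (fun n : ℕ => 1 - ((θ * ℓ : ℕ) : ℝ) / (n : ℝ)) atTop (𝓝 1) := by
    simpa using (tendsto_const_div_atTop_nhds_zero_nat ((θ * ℓ : ℕ) : ℝ)).const_sub 1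
  have h3 := h1.mul h2
  rw [mul_one] at h3
  refine h3.congr' ?_
  filter_upwards [eventually_gt_atTop (θ * ℓ)] with n hn
  have hn0 : (0 : ℝ) < n := by exact_mod_cast (show 0 < n by omega)
  have hsub : (0 : ℝ) < (n : ℝ) - ((θ * ℓ : ℕ) : ℝ) := sub_pos.2 (by exact_mod_cast hn)
  simp only [one_mul, Finset.sum_const, Nat.card_Icc, nsmul_eq_mul, mul_one, Nat.add_sub_cancel]
  rw [Nat.cast_sub hn.le]
  field_simp

lemma IsDesign.sum_spacing_rpow_bounds {φ : ℝ → ℝ} (hφ : IsDesign φ) {θ : ℕ} (hθ : 1 ≤ θ) (ℓ : ℕ)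
    {r : ℝ} (hr : 0 ≤ r) : ∃ c C : ℝ, 0 < c ∧ 0 < C ∧ ∀ᶠ n : ℕ in atTop,
      c * (n : ℝ) ^ (r + 1) ≤ ∑ i ∈ Finset.Icc 1 (n - θ * ℓ), spacing φ θ (n, i) ^ (-r) ∧
        ∑ i ∈ Finset.Icc 1 (n - θ * ℓ), spacing φ θ (n, i) ^ (-r) ≤ C * (n : ℝ) ^ (r + 1) := by
  obtain ⟨c, C, hc, hC, h⟩ := hφ.spacing_bounds hθ ℓ
  refine ⟨C ^ (-r) / 2, c ^ (-r), by positivity, by positivity, ?_⟩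
  filter_upwards [eventually_ge_atTop 2, eventually_ge_atTop (2 * (θ * ℓ))] with n hn hn2
  have hn0 : (0 : ℝ) < n := by exact_mod_cast (show 0 < n by omega)
  have hcard : ((Finset.Icc 1 (n - θ * ℓ)).card : ℝ) = n - ((θ * ℓ : ℕ) : ℝ) := by
    rw [Nat.card_Icc, Nat.add_sub_cancel, Nat.cast_sub (by omega)]
  have hhalf : 2 * ((θ * ℓ : ℕ) : ℝ) ≤ n := by exact_mod_cast hn2
  have hnn : (0 : ℝ) ≤ ((θ * ℓ : ℕ) : ℝ) := Nat.cast_nonneg _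
  have hscale : ∀ d : ℝ, 0 < d → (d / n) ^ (-r) = d ^ (-r) * (n : ℝ) ^ r := fun d hd => by
    rw [Real.div_rpow hd.le hn0.le, Real.rpow_neg hn0.le, div_inv_eq_mul]
  have hp : 0 < (n : ℝ) ^ r := Real.rpow_pos_of_pos hn0 r
  have hcp : 0 < c ^ (-r) := Real.rpow_pos_of_pos hc _
  have hCp : 0 < C ^ (-r) := Real.rpow_pos_of_pos hC _
  rw [Real.rpow_add_one hn0.ne']
  constructor
  · have h1 : ∀ i ∈ Finset.Icc 1 (n - θ * ℓ), C ^ (-r) * (n : ℝ) ^ r ≤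
        spacing φ θ (n, i) ^ (-r) := fun i hi => by
      obtain ⟨h2, h3⟩ := h n i hn hi
      rw [← hscale C hC]
      exact Real.rpow_le_rpow_of_nonpos ((div_pos hc hn0).trans_le h2) h3 (by linarith)
    have h2 := Finset.card_nsmul_le_sum _ _ _ h1
    rw [nsmul_eq_mul, hcard] at h2
    refine le_trans ?_ h2
    have h3 := mul_le_mul_of_nonneg_right (show (n : ℝ) / 2 ≤ n - ((θ * ℓ : ℕ) : ℝ) by linarith)
      (mul_pos hCp hp).le
    linarith
  · have h1 : ∀ i ∈ Finset.Icc 1 (n - θ * ℓ), spacing φ θ (n, i) ^ (-r) ≤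
        c ^ (-r) * (n : ℝ) ^ r := fun i hi => by
      rw [← hscale c hc]
      exact Real.rpow_le_rpow_of_nonpos (div_pos hc hn0) (h n i hn hi).1 (by linarith)
    have h2 := Finset.sum_le_card_nsmul _ _ _ h1
    rw [nsmul_eq_mul, hcard] at h2
    refine h2.trans ?_
    have h3 := mul_le_mul_of_nonneg_right (show (n : ℝ) - ((θ * ℓ : ℕ) : ℝ) ≤ n by linarith)
      (mul_pos hcp hp).le
    linarith

lemma sum_range_range_eq_two_mul (h : ℕ → ℕ → ℝ) (hsymm : ∀ k l, h k l = h l k)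
    (hdiag : ∀ k, h k k = 0) (N : ℕ) :
    ∑ k ∈ Finset.range N, ∑ l ∈ Finset.range N, h k l =
      2 * ∑ k ∈ Finset.range N, ∑ l ∈ Finset.range k, h l k := by
  induction N with
  | zero => simp
  | succ N ih =>
    rw [Finset.sum_range_succ, Finset.sum_range_succ (fun k => ∑ l ∈ Finset.range k, h l k),
      Finset.sum_range_succ (fun l => h N l), hdiag, add_zero]
    simp only [Finset.sum_range_succ (fun l => h _ l) N, Finset.sum_add_distrib]
    rw [ih, Finset.sum_congr rfl fun l _ => hsymm N l]
    ring

/-- The approximation `f` of the mean is the mean for the covariance `βs * G ν |t|`. -/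
lemma IsDesign.f_eq_sum {φ : ℝ → ℝ} (hφ : IsDesign φ) {θ : ℕ} (hθ : 1 ≤ θ) (ℓ : ℕ) (βs ν : ℝ)
    {n : ℕ} (hn : 2 ≤ n) :
    f φ βs θ ℓ ν n =
      ∑ i ∈ Finset.Icc 1 (n - θ * ℓ), incrCov φ (fun t => βs * G ν |t|) θ ℓ n i i := by
  rw [f, Finset.mul_sum]
  refine Finset.sum_congr rfl fun i hi => ?_
  rw [incrCov, ddKernel_const_mul, ddKernel, sum_range_range_eq_two_mul]
  · rw [mul_comm 2 βs, mul_assoc]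
    congr 2
    refine Finset.sum_congr rfl fun k hk => Finset.sum_congr rfl fun l hl => ?_
    rw [Finset.mem_range] at hk hl
    rw [Finset.mem_Icc] at hi
    have hlt : node φ θ (n, i) l < node φ θ (n, i) k := by
      have h1 : θ * k ≤ θ * ℓ := Nat.mul_le_mul_left _ (by omega)
      have h2 : θ * l < θ * k := Nat.mul_lt_mul_of_pos_left hl hθ
      exact hφ.site_lt hn (by dsimp only; omega) (by dsimp only; omega) (by dsimp only; omega)
    rw [abs_of_neg (sub_neg.2 hlt), neg_sub]
    rfl
  · intro k l
    rw [abs_sub_comm]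
    ring
  · intro k
    rw [sub_self, abs_zero, G_zero, mul_zero]

lemma hasSmoothness_G {ν βs : ℝ} (hν : 0 < ν) (hβs : βs ≠ 0) :
    HasSmoothness (fun t => βs * G ν |t|) ν 0 βs where
  pos := hν
  irregular_ne_zero := hβs
  expansion := ⟨1, one_pos, by simpa using isBigO_zero _ _⟩

lemma orderAsymp_of_bounds {a b : ℕ → ℝ} {c C : ℝ} (hc : 0 < c)
    (h1 : ∀ᶠ n in atTop, c ≤ a n / b n) (h2 : ∀ᶠ n in atTop, a n / b n ≤ C) :
    OrderAsymp a b := by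
  constructor
  · refine lt_of_lt_of_le (EReal.coe_pos.2 hc) (le_liminf_of_le (by isBoundedDefault) ?_)
    exact h1.mono fun n hn => EReal.coe_le_coe_iff.2 hn
  · refine lt_of_le_of_lt (limsup_le_of_le (a := (C : EReal)) (by isBoundedDefault) ?_)
      (EReal.coe_lt_top C)
    exact h2.mono fun n hn => EReal.coe_le_coe_iff.2 hn

lemma simAsymp_of_tendsto_div {a b : ℕ → ℝ} {A : ℝ} (hA : A ≠ 0)
    (h : Tendsto (fun n => a n / b n) atTop (𝓝 A)) : SimAsymp a (fun n => A * b n) := by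
  have := h.div_const A
  rw [div_self hA] at this
  refine this.congr fun n => ?_
  rw [div_div, mul_comm]

/-! ### Asymptotics of the normalized variance -/

lemma powerSum_le_powerSum {p p' : ℝ} (h : p' ≤ p) (n : ℕ) : powerSum p n ≤ powerSum p' n :=
  Finset.sum_le_sum fun m _ => Real.rpow_le_rpow_of_exponent_le
    (by linarith [(Nat.cast_nonneg m : (0 : ℝ) ≤ m)]) (by linarith)

section main

variable {Ω : Type*} [MeasurableSpace Ω] {P : Measure Ω} {X : ℝ → Ω → ℝ}
  {K φ : ℝ → ℝ} {ν βs : ℝ} {β : ℕ → ℝ} {θ ℓ : ℕ} {μ : ℝ}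

lemma normVar_nonneg (n : ℕ) : 0 ≤ normVar P φ X θ ℓ n := variance_nonneg _ _

/-- Upper bound for the normalized variance when the variances of the increments are of the common
order `b n`. -/
theorem exists_normVar_le [IsProbabilityMeasure P] (hX : IsGaussianProcess X P)
    (hmean : ∀ t, P[X t] = μ)
    (hcov : ∀ x y, cov[X x, X y; P] = K (x - y)) (hφ : IsDesign φ)
    (hθ : 1 ≤ θ) (hℓ : 1 ≤ ℓ) {a₀ b₀ : ℝ} (hsm : SmoothOnInterval K (2 * ℓ) a₀ b₀) {C q : ℝ}
    (hq : 0 ≤ q) (hbd : ∀ t ∈ Set.Ioc (0 : ℝ) 1, |iteratedDeriv (2 * ℓ) K t| ≤ C * t ^ (-q))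
    {b : ℕ → ℝ} {c B : ℝ} (hc : 0 < c) (hb : ∀ᶠ n in atTop, 0 < b n)
    (hE : ∀ᶠ n in atTop, c * (n * b n) ≤ P[quadVar φ X θ ℓ n])
    (hB : ∀ᶠ n in atTop, ∀ i ∈ Finset.Icc 1 (n - θ * ℓ), incrCov φ K θ ℓ n i i ≤ B * b n) :
    ∃ A, 0 < A ∧ ∀ᶠ n : ℕ in atTop, normVar P φ X θ ℓ n ≤
      A * ((n : ℝ)⁻¹ + (n : ℝ) ^ (2 * q - 1) * powerSum (2 * q) n / b n ^ 2) := by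
  obtain ⟨Z, hZ⟩ := exists_inner_eq hX hcov
  have hC : 0 ≤ C := by
    have := (abs_nonneg _).trans (hbd 1 ⟨one_pos, le_rfl⟩)
    rwa [Real.one_rpow, mul_one] at this
  obtain ⟨A, hA, h⟩ := hφ.sumCovSq_le hZ hθ hℓ hsm hC hq hbd (fun n => B * b n) hB
  refine ⟨2 * A * (B ^ 2 + 1) / c ^ 2, by positivity, ?_⟩
  filter_upwards [h, hb, hE, eventually_ge_atTop 2] with n hS hbn hEn hn
  have hn0 : (0 : ℝ) < n := by exact_mod_cast (show 0 < n by omega)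
  have hP := powerSum_nonneg (2 * q) n
  have hnq : 0 < (n : ℝ) ^ (2 * q) := Real.rpow_pos_of_pos hn0 _
  have hpos : 0 < c * (n * b n) := by positivity
  rw [normVar_eq hX hmean hcov hφ hθ hℓ hn]
  calc 2 * sumCovSq φ K θ ℓ n / P[quadVar φ X θ ℓ n] ^ 2
      ≤ 2 * (A * (n * (B * b n) ^ 2 + (n : ℝ) ^ (1 + 2 * q) * powerSum (2 * q) n)) /
          (c * (n * b n)) ^ 2 :=
        div_le_div₀ (by positivity) (by linarith) (by positivity)
          (pow_le_pow_left₀ hpos.le hEn 2)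
    _ = 2 * A / c ^ 2 * (B ^ 2 * (n : ℝ)⁻¹ +
          (n : ℝ) ^ (2 * q - 1) * powerSum (2 * q) n / b n ^ 2) := by
        rw [Real.rpow_add hn0, Real.rpow_sub hn0, Real.rpow_one]
        field_simp
    _ ≤ 2 * A / c ^ 2 * ((B ^ 2 + 1) * (n : ℝ)⁻¹ +
          (B ^ 2 + 1) * ((n : ℝ) ^ (2 * q - 1) * powerSum (2 * q) n / b n ^ 2)) := by
        refine mul_le_mul_of_nonneg_left (add_le_add ?_ ?_) (by positivity)
        · exact mul_le_mul_of_nonneg_right (by linarith) (by positivity)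
        · exact le_mul_of_one_le_left (by positivity) (by nlinarith [sq_nonneg B])
    _ = _ := by ring

/-- The mean of the quadratic variation when the variances of the increments are uniformly
asymptotic to `A * b n`. -/
lemma tendsto_integral_quadVar_div [IsProbabilityMeasure P] (hX : IsGaussianProcess X P)
    (hmean : ∀ t, P[X t] = μ)
    (hcov : ∀ x y, cov[X x, X y; P] = K (x - y)) (hφ : IsDesign φ) (hθ : 1 ≤ θ) (hℓ : 1 ≤ ℓ)
    {b : ℕ → ℝ} {A : ℝ}
    (h : Tendsto (fun x => incrCov φ K θ ℓ x.1 x.2 x.2 / b x.1) (cells θ ℓ) (𝓝 A)) :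
    Tendsto (fun n => P[quadVar φ X θ ℓ n] / (n * b n)) atTop (𝓝 A) := by
  refine (tendsto_sum_cells_div h).congr' ?_
  filter_upwards [eventually_ge_atTop 2] with n hn
  rw [integral_quadVar hX hmean hcov hφ hθ hℓ hn, ← Finset.sum_div, div_div, mul_comm (b n)]

lemma integral_quadVar_nonneg (n : ℕ) : 0 ≤ P[quadVar φ X θ ℓ n] :=
  integral_nonneg fun _ => Finset.sum_nonneg fun _ _ => sq_nonneg _

/-- If the irregular term dominates, mean and approximate mean are both asymptotic to the same
positive multiple of `∑ i, h_i ^ (2ν - 2ℓ)`, with `h_i` the local spacing. -/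
lemma exists_tendsto_of_lt [IsProbabilityMeasure P] (hX : IsGaussianProcess X P)
    (hmean : ∀ t, P[X t] = μ)
    (hcov : ∀ x y, cov[X x, X y; P] = K (x - y)) (hK : HasSmoothness K ν β βs) (hφ : IsDesign φ)
    (hθ : 1 ≤ θ) (hℓ : 1 ≤ ℓ) (hνℓ : ν < ℓ) :
    ∃ A, 0 < A ∧
      Tendsto (fun n => P[quadVar φ X θ ℓ n] /
        ∑ i ∈ Finset.Icc 1 (n - θ * ℓ), spacing φ θ (n, i) ^ (-(2 * (ℓ : ℝ) - 2 * ν)))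
        atTop (𝓝 A) ∧
      Tendsto (fun n => f φ βs θ ℓ ν n /
        ∑ i ∈ Finset.Icc 1 (n - θ * ℓ), spacing φ θ (n, i) ^ (-(2 * (ℓ : ℝ) - 2 * ν)))
        atTop (𝓝 A) := by
  have hw : ∀ᶠ x in cells θ ℓ, 0 < spacing φ θ x ^ (-(2 * (ℓ : ℝ) - 2 * ν)) :=
    (hφ.spacing_pos hθ ℓ).mono fun x hx => Real.rpow_pos_of_pos hx _
  have hcancel : ∀ᶠ n in atTop, ∀ i ∈ Finset.Icc 1 (n - θ * ℓ), ∀ y : ℝ,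
      spacing φ θ (n, i) ^ (-(2 * (ℓ : ℝ) - 2 * ν)) *
        (spacing φ θ (n, i) ^ (2 * (ℓ : ℝ) - 2 * ν) * y) = y := by
    refine (eventually_cells.1 (hφ.spacing_pos hθ ℓ)).mono fun n hn i hi y => ?_
    rw [← mul_assoc, ← Real.rpow_add (hn i hi), neg_add_cancel, Real.rpow_zero, one_mul]
  have h1 := tendsto_weighted_average _ _ _ hw (hK.tendsto_incrCov_of_lt hφ hθ hνℓ)
  have h2 := tendsto_weighted_average _ _ _ hw
    ((hasSmoothness_G hK.pos hK.irregular_ne_zero).tendsto_incrCov_of_lt hφ hθ hνℓ)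
  set A := βs * ddKernel ℓ (fun k => (k : ℝ)) (fun k => (k : ℝ)) (fun x => G ν |x|)
  have hE : Tendsto (fun n => P[quadVar φ X θ ℓ n] /
      ∑ i ∈ Finset.Icc 1 (n - θ * ℓ), spacing φ θ (n, i) ^ (-(2 * (ℓ : ℝ) - 2 * ν)))
      atTop (𝓝 A) := by
    refine h1.congr' ?_
    filter_upwards [hcancel, eventually_ge_atTop 2] with n hn hn2
    rw [integral_quadVar hX hmean hcov hφ hθ hℓ hn2]
    congr 1
    exact Finset.sum_congr rfl fun i hi => hn i hi _
  have hA0 : 0 ≤ A := by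
    refine ge_of_tendsto hE ?_
    filter_upwards [eventually_cells.1 hw] with n hn
    exact div_nonneg (integral_quadVar_nonneg n) (Finset.sum_nonneg fun i hi => (hn i hi).le)
  have hA : A ≠ 0 := mul_ne_zero hK.irregular_ne_zero (ddKernel_G_ne_zero hK.pos ℓ hνℓ)
  refine ⟨A, hA0.lt_of_ne' hA, hE, h2.congr' ?_⟩
  filter_upwards [hcancel, eventually_ge_atTop 2] with n hn hn2
  rw [hφ.f_eq_sum hθ ℓ βs ν hn2]
  congr 1
  exact Finset.sum_congr rfl fun i hi => hn i hi _

lemma integral_quadVar_asymptotics_of_lt [IsProbabilityMeasure P] (hX : IsGaussianProcess X P)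
    (hmean : ∀ t, P[X t] = μ)
    (hcov : ∀ x y, cov[X x, X y; P] = K (x - y)) (hK : HasSmoothness K ν β βs) (hφ : IsDesign φ)
    (hθ : 1 ≤ θ) (hℓ : 1 ≤ ℓ) (hνℓ : ν < ℓ) :
    SimAsymp (fun n => P[quadVar φ X θ ℓ n]) (fun n => f φ βs θ ℓ ν n) ∧
      OrderAsymp (fun n => f φ βs θ ℓ ν n) (fun n => (n : ℝ) ^ (2 * (ℓ : ℝ) + 1 - 2 * ν)) ∧
      (∃ c, 0 < c ∧ ∀ᶠ n : ℕ in atTop,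
        c * (n * (n : ℝ) ^ (2 * (ℓ : ℝ) - 2 * ν)) ≤ P[quadVar φ X θ ℓ n]) := by
  obtain ⟨A, hA, hE, hf⟩ := exists_tendsto_of_lt hX hmean hcov hK hφ hθ hℓ hνℓ
  obtain ⟨c, C, hc, hC, hH⟩ := hφ.sum_spacing_rpow_bounds hθ ℓ
    (show 0 ≤ 2 * (ℓ : ℝ) - 2 * ν by linarith)
  have hpow : ∀ n : ℕ, 2 ≤ n → 0 < (n : ℝ) ^ (2 * (ℓ : ℝ) - 2 * ν + 1) := fun n hn =>
    Real.rpow_pos_of_pos (by exact_mod_cast (show 0 < n by omega)) _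
  have hexp : 2 * (ℓ : ℝ) + 1 - 2 * ν = 2 * (ℓ : ℝ) - 2 * ν + 1 := by ring
  refine ⟨?_, ?_, A / 2 * c, by positivity, ?_⟩
  · have h1 := hE.div hf hA.ne'
    rw [div_self hA.ne'] at h1
    refine h1.congr' ?_
    filter_upwards [hH, eventually_ge_atTop 2] with n hn hn2
    have := (mul_pos hc (hpow n hn2)).trans_le hn.1
    exact div_div_div_cancel_right₀ this.ne' _ _
  · refine orderAsymp_of_bounds (c := A / 2 * c) (C := 2 * A * C) (by positivity) ?_ ?_
    · filter_upwards [hH, hf.eventually (lt_mem_nhds (half_lt_self hA)), eventually_ge_atTop 2]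
        with n hn hfn hn2
      have hpos := (mul_pos hc (hpow n hn2)).trans_le hn.1
      rw [lt_div_iff₀ hpos] at hfn
      rw [hexp, le_div_iff₀ (hpow n hn2)]
      nlinarith [mul_le_mul_of_nonneg_left hn.1 (half_pos hA).le]
    · filter_upwards [hH, hf.eventually (gt_mem_nhds (show A < 2 * A by linarith)),
        eventually_ge_atTop 2] with n hn hfn hn2
      have hpos := (mul_pos hc (hpow n hn2)).trans_le hn.1
      rw [div_lt_iff₀ hpos] at hfn
      rw [hexp, div_le_iff₀ (hpow n hn2)]
      nlinarith [mul_le_mul_of_nonneg_left hn.2 (show 0 ≤ 2 * A by linarith)]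
  · filter_upwards [hH, hE.eventually (lt_mem_nhds (half_lt_self hA)), eventually_ge_atTop 2]
      with n hn hEn hn2
    have hpos := (mul_pos hc (hpow n hn2)).trans_le hn.1
    have hn0 : (0 : ℝ) < n := by exact_mod_cast (show 0 < n by omega)
    rw [lt_div_iff₀ hpos] at hEn
    have h2 := mul_le_mul_of_nonneg_left hn.1 (half_pos hA).le
    rw [Real.rpow_add_one hn0.ne'] at h2
    linarith

lemma exists_incrCov_le_of_lt (hK : HasSmoothness K ν β βs) (hφ : IsDesign φ) (hθ : 1 ≤ θ)
    (hνℓ : ν < ℓ) : ∃ B, ∀ᶠ n : ℕ in atTop, ∀ i ∈ Finset.Icc 1 (n - θ * ℓ),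
      incrCov φ K θ ℓ n i i ≤ B * (n : ℝ) ^ (2 * (ℓ : ℝ) - 2 * ν) := by
  have h1 := hK.tendsto_incrCov_of_lt hφ hθ hνℓ
  set A := βs * ddKernel ℓ (fun k => (k : ℝ)) (fun k => (k : ℝ)) (fun x => G ν |x|)
  obtain ⟨c, C, hc, hC, h⟩ := hφ.spacing_bounds hθ ℓ
  set r := 2 * (ℓ : ℝ) - 2 * ν with hr
  have hr0 : 0 < r := by linarith
  refine ⟨(|A| + 1) * c ^ (-r), ?_⟩
  have h2 := eventually_cells.1
    (h1.eventually (gt_mem_nhds (show A < |A| + 1 by linarith [le_abs_self A])))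
  filter_upwards [h2, eventually_ge_atTop 2] with n hn hn2 i hi
  have hn0 : (0 : ℝ) < n := by exact_mod_cast (show 0 < n by omega)
  have hs := (h n i hn2 hi).1
  have hs0 : 0 < spacing φ θ (n, i) := (div_pos hc hn0).trans_le hs
  have h3 := hn i hi
  have h4 : 0 < spacing φ θ (n, i) ^ r := Real.rpow_pos_of_pos hs0 r
  calc incrCov φ K θ ℓ n i i
      ≤ (|A| + 1) * spacing φ θ (n, i) ^ (-r) := by
        rw [Real.rpow_neg hs0.le, ← div_eq_mul_inv, le_div_iff₀ h4, mul_comm]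
        exact h3.le
    _ ≤ (|A| + 1) * (c / n) ^ (-r) :=
        mul_le_mul_of_nonneg_left
          (Real.rpow_le_rpow_of_nonpos (div_pos hc hn0) hs (by linarith)) (by positivity)
    _ = _ := by
        rw [Real.div_rpow hc.le hn0.le, Real.rpow_neg hn0.le, div_inv_eq_mul, mul_assoc]

/-- The normalized variance when the irregular term dominates, for all regimes at once. -/
lemma exists_normVar_le_of_lt [IsProbabilityMeasure P] (hX : IsGaussianProcess X P)
    (hmean : ∀ t, P[X t] = μ)
    (hcov : ∀ x y, cov[X x, X y; P] = K (x - y)) (hK : HasSmoothness K ν β βs) (hφ : IsDesign φ)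
    (hθ : 1 ≤ θ) (hℓ : 1 ≤ ℓ) (hνℓ : ν < ℓ) {a b C : ℝ} (hsm : SmoothOnInterval K (2 * ℓ) a b)
    (hbd : ∀ t ∈ Set.Ioc (0 : ℝ) 1,
      |iteratedDeriv (2 * ℓ) K t| ≤ C * t ^ (2 * ν - 2 * (ℓ : ℝ))) :
    ∃ A, 0 < A ∧ ∀ᶠ n : ℕ in atTop,
      normVar P φ X θ ℓ n ≤ A * ((n : ℝ)⁻¹ * powerSum (4 * ℓ - 4 * ν) n) := by
  obtain ⟨-, -, c, hc, hE⟩ := integral_quadVar_asymptotics_of_lt hX hmean hcov hK hφ hθ hℓ hνℓ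
  obtain ⟨B, hB⟩ := exists_incrCov_le_of_lt hK hφ hθ hνℓ
  obtain ⟨A, hA, h⟩ := exists_normVar_le hX hmean hcov hφ hθ hℓ hsm
    (q := 2 * (ℓ : ℝ) - 2 * ν) (by linarith) (by simpa only [neg_sub] using hbd)
    (b := fun n => (n : ℝ) ^ (2 * (ℓ : ℝ) - 2 * ν)) hc
    (by filter_upwards [eventually_gt_atTop 0] with n hn
        exact Real.rpow_pos_of_pos (by exact_mod_cast hn) _) hE hB
  refine ⟨2 * A, by positivity, ?_⟩
  filter_upwards [h, eventually_ge_atTop 1] with n hn hn1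
  have hn0 : (0 : ℝ) < n := by exact_mod_cast (show 0 < n by omega)
  rw [show 2 * (2 * (ℓ : ℝ) - 2 * ν) = 4 * ℓ - 4 * ν by ring, Real.rpow_sub hn0,
    Real.rpow_one, ← Real.rpow_mul_natCast hn0.le,
    show (2 * (ℓ : ℝ) - 2 * ν) * ((2 : ℕ) : ℝ) = 4 * ℓ - 4 * ν by push_cast; ring] at hn
  have h1 := one_le_powerSum (4 * (ℓ : ℝ) - 4 * ν) hn1
  have h2 : 0 < (n : ℝ) ^ (4 * (ℓ : ℝ) - 4 * ν) := Real.rpow_pos_of_pos hn0 _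
  refine hn.trans ?_
  have h3 : (n : ℝ) ^ (4 * (ℓ : ℝ) - 4 * ν) / n * powerSum (4 * ℓ - 4 * ν) n /
      (n : ℝ) ^ (4 * (ℓ : ℝ) - 4 * ν) = (n : ℝ)⁻¹ * powerSum (4 * ℓ - 4 * ν) n := by
    field_simp
  rw [h3]
  have h4 : (n : ℝ)⁻¹ ≤ (n : ℝ)⁻¹ * powerSum (4 * ℓ - 4 * ν) n :=
    le_mul_of_one_le_right (by positivity) h1
  nlinarith

lemma isBigO_normVar {g : ℕ → ℝ} {A : ℝ} (h : ∀ᶠ n in atTop, normVar P φ X θ ℓ n ≤ A * g n)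
    (hg : ∀ᶠ n in atTop, 0 ≤ g n) : (fun n => normVar P φ X θ ℓ n) =O[atTop] g := by
  refine IsBigO.of_bound A ?_
  filter_upwards [h, hg] with n hn hgn
  rwa [Real.norm_of_nonneg (normVar_nonneg n), Real.norm_of_nonneg hgn]

/-- Rates for the normalized variance and almost sure convergence when the irregular term
dominates. -/
theorem asymptotics_of_lt [IsProbabilityMeasure P] (hX : IsGaussianProcess X P)
    (hmean : ∀ t, P[X t] = μ)
    (hcov : ∀ x y, cov[X x, X y; P] = K (x - y)) (hK : HasSmoothness K ν β βs) (hφ : IsDesign φ)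
    (hθ : 1 ≤ θ) (hℓ : 1 ≤ ℓ) (hνℓ : ν < ℓ) {a b C : ℝ} (hsm : SmoothOnInterval K (2 * ℓ) a b)
    (hbd : ∀ t ∈ Set.Ioc (0 : ℝ) 1,
      |iteratedDeriv (2 * ℓ) K t| ≤ C * t ^ (2 * ν - 2 * (ℓ : ℝ))) :
    (ν < (4 * (ℓ : ℝ) - 1) / 4 →
      (fun n => normVar P φ X θ ℓ n) =O[atTop] fun n : ℕ => (n : ℝ)⁻¹) ∧
    (ν = (4 * (ℓ : ℝ) - 1) / 4 →
      (fun n => normVar P φ X θ ℓ n) =O[atTop] fun n : ℕ => (n : ℝ)⁻¹ * Real.log n) ∧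
    ((4 * (ℓ : ℝ) - 1) / 4 < ν →
      (fun n => normVar P φ X θ ℓ n)
        =O[atTop] fun n : ℕ => (n : ℝ) ^ (-4 * (ℓ : ℝ) + 4 * ν)) ∧
    ∀ᵐ ω ∂P, Tendsto
      (fun n => quadVar φ X θ ℓ n ω / P[quadVar φ X θ ℓ n]) atTop (𝓝 1) := by
  obtain ⟨A, hA, h⟩ := exists_normVar_le_of_lt hX hmean hcov hK hφ hθ hℓ hνℓ hsm hbd
  have hrate : ∀ p : ℝ, 0 ≤ p → p < 1 → p ≤ 4 * ℓ - 4 * ν → ∀ᶠ n : ℕ in atTop,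
      normVar P φ X θ ℓ n ≤ A / (1 - p) * (n : ℝ) ^ (-p) := by
    intro p hp0 hp1 hp
    filter_upwards [h, eventually_gt_atTop 0] with n hn hn1
    have hn0 : (0 : ℝ) < n := by exact_mod_cast hn1
    have h1 := (powerSum_le_powerSum hp n).trans (powerSum_le_of_lt_one hp0 hp1 n)
    calc normVar P φ X θ ℓ n ≤ A * ((n : ℝ)⁻¹ * powerSum (4 * ℓ - 4 * ν) n) := hn
      _ ≤ A * ((n : ℝ)⁻¹ * ((n : ℝ) ^ (1 - p) / (1 - p))) := by gcongr
      _ = A / (1 - p) * (n : ℝ) ^ (-p) := by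
          rw [sub_eq_add_neg 1 p, Real.rpow_add hn0, Real.rpow_one]
          field_simp
  refine ⟨fun hν => ?_, fun hν => ?_, fun hν => ?_, ?_⟩
  · obtain ⟨D, hD⟩ := exists_powerSum_le_of_one_lt (p := 4 * ℓ - 4 * ν) (by linarith)
    refine isBigO_normVar (A := A * D) ?_ (Eventually.of_forall fun n => by positivity)
    filter_upwards [h] with n hn
    refine hn.trans ?_
    rw [mul_assoc, mul_comm D]
    gcongr
    exact hD n
  · rw [show (4 : ℝ) * ℓ - 4 * ν = 1 by linarith] at h
    refine isBigO_normVar (A := A * 2) ?_ ?_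
    · filter_upwards [h, (Real.tendsto_log_atTop.comp
        tendsto_natCast_atTop_atTop).eventually (eventually_ge_atTop 1)] with n hn hlog
      have hlog : 1 ≤ Real.log n := hlog
      refine hn.trans ?_
      rw [show A * 2 * ((n : ℝ)⁻¹ * Real.log n) = A * ((n : ℝ)⁻¹ * (2 * Real.log n)) by ring]
      gcongr
      linarith [powerSum_one_le n]
    · filter_upwards with n
      exact mul_nonneg (by positivity) (Real.log_natCast_nonneg n)
  · refine isBigO_normVar (A := A / (1 - (4 * ℓ - 4 * ν))) ?_
      (Eventually.of_forall fun n => by positivity)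
    rw [show -4 * (ℓ : ℝ) + 4 * ν = -(4 * ℓ - 4 * ν) by ring]
    exact hrate _ (by linarith) (by linarith) le_rfl
  · obtain ⟨-, -, c, hc, hE⟩ := integral_quadVar_asymptotics_of_lt hX hmean hcov hK hφ hθ hℓ hνℓ
    -- A rate below `1` spares a separate treatment of the logarithm at `4 * ℓ - 4 * ν = 1`.
    refine ae_tendsto_quadVar_div hX hmean hcov hφ hθ hℓ ?_
      (δ := min (4 * ℓ - 4 * ν) (1 / 2)) (lt_min (by linarith) (by norm_num))
      (hrate _ (le_min (by linarith) (by norm_num))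
        ((min_le_right _ _).trans_lt (by norm_num)) (min_le_left _ _))
    filter_upwards [hE, eventually_gt_atTop 0] with n hn hn0
    have hn0 : (0 : ℝ) < n := by exact_mod_cast hn0
    exact lt_of_lt_of_le (by positivity) hn

/-- Mean and normalized variance at the critical order, where the variances of the increments grow
logarithmically. -/
theorem asymptotics_of_eq [IsProbabilityMeasure P] (hX : IsGaussianProcess X P)
    (hmean : ∀ t, P[X t] = μ)
    (hcov : ∀ x y, cov[X x, X y; P] = K (x - y)) (hK : HasSmoothness K ℓ β βs) (hφ : IsDesign φ)
    (hθ : 1 ≤ θ) (hℓ : 1 ≤ ℓ) :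
    SimAsymp (fun n => P[quadVar φ X θ ℓ n])
      (fun n => (-1) ^ (ℓ + 1) * βs * ((2 * ℓ).factorial : ℝ) * n * Real.log n) ∧
    ∀ a b C : ℝ, SmoothOnInterval K (2 * ℓ) a b →
      (∀ t ∈ Set.Ioc (0 : ℝ) 1, |iteratedDeriv (2 * ℓ) K t| ≤ C * Real.log (2 / t)) →
      (fun n => normVar P φ X θ ℓ n) =O[atTop] fun n : ℕ => (Real.log n ^ 2)⁻¹ := by
  have hinc := hK.tendsto_incrCov_of_eq hφ hθ
  have hA : (-1) ^ (ℓ + 1) * βs * ((2 * ℓ).factorial : ℝ) ≠ 0 :=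
    mul_ne_zero (mul_ne_zero (by simp) hK.irregular_ne_zero)
      (by exact_mod_cast (2 * ℓ).factorial_ne_zero)
  set A := (-1) ^ (ℓ + 1) * βs * ((2 * ℓ).factorial : ℝ)
  have hE := tendsto_integral_quadVar_div hX hmean hcov hφ hθ hℓ (b := fun n => Real.log n) hinc
  have hA0 : 0 < A := by
    refine (ge_of_tendsto hE (Eventually.of_forall fun n => ?_)).lt_of_ne' hA
    exact div_nonneg (integral_quadVar_nonneg n)
      (mul_nonneg (Nat.cast_nonneg n) (Real.log_natCast_nonneg n))
  have hlogpos : ∀ᶠ n : ℕ in atTop, 0 < Real.log n := by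
    filter_upwards [eventually_gt_atTop 1] with n hn
    exact Real.log_pos (by exact_mod_cast hn)
  refine ⟨?_, fun a b C hsm hbd => ?_⟩
  · simpa only [mul_assoc] using simAsymp_of_tendsto_div hA hE
  · have hC : 0 ≤ C := by
      have := (abs_nonneg _).trans (hbd 1 ⟨one_pos, le_rfl⟩)
      rw [div_one] at this
      exact nonneg_of_mul_nonneg_left this (Real.log_pos one_lt_two)
    -- Any exponent in `(0, 1/2)` would do in place of `1/4`.
    have hbd' : ∀ t ∈ Set.Ioc (0 : ℝ) 1, |iteratedDeriv (2 * ℓ) K t| ≤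
        C * (2 ^ (1 / 4 : ℝ) * 4) * t ^ (-(1 / 4) : ℝ) := by
      intro t ht
      have h1 := Real.log_le_rpow_div (x := 2 / t) (by have := ht.1; positivity)
        (show (0 : ℝ) < 1 / 4 by norm_num)
      rw [Real.div_rpow zero_le_two ht.1.le] at h1
      refine (hbd t ht).trans ?_
      rw [mul_assoc C, Real.rpow_neg ht.1.le]
      refine mul_le_mul_of_nonneg_left (h1.trans (le_of_eq ?_)) hC
      ring
    obtain ⟨D, hD, h⟩ := exists_normVar_le hX hmean hcov hφ hθ hℓ hsm (by norm_num) hbd'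
      (b := fun n => Real.log n) (c := A / 2) (B := A + 1) (half_pos hA0) hlogpos
      (by
        filter_upwards [hE.eventually (lt_mem_nhds (half_lt_self hA0)), hlogpos,
          eventually_gt_atTop 0] with n hn hl hn0
        have hn0 : (0 : ℝ) < n := by exact_mod_cast hn0
        rw [lt_div_iff₀ (by positivity)] at hn
        exact hn.le)
      (by
        filter_upwards [eventually_cells.1 (hinc.eventually (gt_mem_nhds (lt_add_one A))),
          hlogpos] with n hn hl i hi
        exact ((div_lt_iff₀ hl).1 (hn i hi)).le)
    refine isBigO_normVar (A := D * (64 + 2)) ?_ (Eventually.of_forall fun n => by positivity)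
    filter_upwards [h, hlogpos, eventually_gt_atTop 0] with n hn hl hn0
    have hn0 : (0 : ℝ) < n := by exact_mod_cast hn0
    refine hn.trans ?_
    rw [mul_assoc]
    refine mul_le_mul_of_nonneg_left ?_ hD.le
    rw [add_mul]
    refine add_le_add ?_ ?_
    · have h1 := Real.log_le_rpow_div hn0.le (show (0 : ℝ) < 1 / 4 by norm_num)
      have h2 : Real.log n ^ 2 ≤ 16 * n ^ (1 / 2 : ℝ) := by
        calc Real.log n ^ 2 ≤ ((n : ℝ) ^ (1 / 4 : ℝ) / (1 / 4)) ^ 2 :=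
              pow_le_pow_left₀ hl.le h1 2
          _ = 16 * ((n : ℝ) ^ (1 / 4 : ℝ)) ^ 2 := by ring
          _ = 16 * n ^ (1 / 2 : ℝ) := by
              rw [← Real.rpow_mul_natCast hn0.le]
              norm_num
      have h3 : (n : ℝ) ^ (1 / 2 : ℝ) ≤ n := by
        calc (n : ℝ) ^ (1 / 2 : ℝ) ≤ (n : ℝ) ^ (1 : ℝ) :=
              Real.rpow_le_rpow_of_exponent_le (by exact_mod_cast hn0) (by norm_num)
          _ = n := Real.rpow_one _
      rw [← div_eq_mul_inv, inv_eq_one_div, div_le_div_iff₀ hn0 (by positivity)]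
      linarith
    · have h1 := powerSum_le_of_lt_one (p := 2 * (1 / 4)) (by norm_num) (by norm_num) n
      rw [← div_eq_mul_inv]
      refine div_le_div_of_nonneg_right ?_ (by positivity)
      calc (n : ℝ) ^ (2 * (1 / 4) - 1 : ℝ) * powerSum (2 * (1 / 4)) n
          ≤ (n : ℝ) ^ (2 * (1 / 4) - 1 : ℝ) *
            ((n : ℝ) ^ (1 - 2 * (1 / 4) : ℝ) / (1 - 2 * (1 / 4))) := by gcongr
        _ = (n : ℝ) ^ (2 * (1 / 4) - 1 + (1 - 2 * (1 / 4)) : ℝ) * 2 := by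
            rw [Real.rpow_add hn0]; ring
        _ = 2 := by norm_num

/-- Mean and normalized variance when the `ℓ`-th mean square derivative exists: the quadratic
variation stays random in the limit. -/
theorem asymptotics_of_gt [IsProbabilityMeasure P] (hX : IsGaussianProcess X P)
    (hmean : ∀ t, P[X t] = μ)
    (hcov : ∀ x y, cov[X x, X y; P] = K (x - y)) (hK : HasSmoothness K ν β βs) (hφ : IsDesign φ)
    (hθ : 1 ≤ θ) (hℓ : 1 ≤ ℓ) (hνℓ : (ℓ : ℝ) < ν) :
    SimAsymp (fun n => P[quadVar φ X θ ℓ n])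
      (fun n => (-1) ^ ℓ * β ℓ * ((2 * ℓ).factorial : ℝ) * n) ∧
    ∀ a b : ℝ, SmoothOnInterval K (2 * ℓ) a b →
      0 < liminf (fun n => ((normVar P φ X θ ℓ n : ℝ) : EReal)) atTop := by
  obtain ⟨Z, hZ⟩ := exists_inner_eq hX hcov
  have hinc := hK.tendsto_incrCov_of_gt hφ hθ hℓ hνℓ
  rw [show β ℓ * ((-1) ^ ℓ * ((2 * ℓ).factorial : ℝ)) =
    (-1) ^ ℓ * β ℓ * ((2 * ℓ).factorial : ℝ) by ring] at hinc
  have hA : (-1) ^ ℓ * β ℓ * ((2 * ℓ).factorial : ℝ) ≠ 0 :=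
    mul_ne_zero (mul_ne_zero (by simp) (hK.coeff_ne_zero hZ hℓ hνℓ))
      (by exact_mod_cast (2 * ℓ).factorial_ne_zero)
  set A := (-1) ^ ℓ * β ℓ * ((2 * ℓ).factorial : ℝ)
  have hE := tendsto_integral_quadVar_div hX hmean hcov hφ hθ hℓ (b := fun _ => 1)
    (by simpa only [div_one] using hinc)
  simp only [mul_one] at hE
  have hA0 : 0 < A := (ge_of_tendsto hE (Eventually.of_forall fun n =>
    div_nonneg (integral_quadVar_nonneg n) (Nat.cast_nonneg n))).lt_of_ne' hA
  refine ⟨simAsymp_of_tendsto_div hA hE, fun a b hsm => ?_⟩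
  obtain ⟨t₀, ht₀, hne⟩ := hK.exists_iteratedDeriv_ne_zero hℓ hνℓ hsm
  obtain ⟨c, hc, hS⟩ := hφ.exists_le_sumCovSq hθ hℓ hsm ht₀ hne
  refine lt_of_lt_of_le (EReal.coe_pos.2 (show 0 < 2 * c / (A + 1) ^ 2 by positivity))
    (le_liminf_of_le (by isBoundedDefault) ?_)
  filter_upwards [hS, hE.eventually (gt_mem_nhds (lt_add_one A)), hE.eventually (lt_mem_nhds hA0),
    eventually_ge_atTop 2] with n hn h1 h2 hn2
  have hn0 : (0 : ℝ) < n := by exact_mod_cast (show 0 < n by omega)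
  rw [EReal.coe_le_coe_iff, normVar_eq hX hmean hcov hφ hθ hℓ hn2]
  have hEpos : 0 < P[quadVar φ X θ ℓ n] := (div_pos_iff_of_pos_right hn0).1 h2
  rw [div_lt_iff₀ hn0] at h1
  calc 2 * c / (A + 1) ^ 2 = 2 * (c * n ^ 2) / ((A + 1) * n) ^ 2 := by field_simp
    _ ≤ _ := div_le_div₀ (mul_nonneg zero_le_two (sumCovSq_nonneg _ _ _ _ _)) (by linarith)
        (by positivity) (pow_le_pow_left₀ hEpos.le h1.le 2)

end main

end LineTransect

end

open LineTransect
theorem theorem2p1 {Ω : Type*} [MeasurableSpace Ω] (P : Measure Ω) [IsProbabilityMeasure P]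
    (X : ℝ → Ω → ℝ) (hX : IsGaussianProcess X P)
    (μ : ℝ) (hmean : ∀ t, P[X t] = μ)
    (K : ℝ → ℝ) (hcov : ∀ x y, cov[X x, X y; P] = K (x - y))
    (ν : ℝ) (β : ℕ → ℝ) (βs : ℝ) (hK : HasSmoothness K ν β βs)
    (φ : ℝ → ℝ) (hφ : IsDesign φ)
    (θ : ℕ) (hθ : θ = 1 ∨ θ = 2) (ℓ : ℕ) (hℓ : 1 ≤ ℓ) :
    -- (a)
    (ν < ℓ → ℓ ≤ 10 →
      SimAsymp (fun n => P[quadVar φ X θ ℓ n]) (fun n => f φ βs θ ℓ ν n) ∧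
      OrderAsymp (fun n => f φ βs θ ℓ ν n) (fun n => (n : ℝ) ^ (2 * (ℓ : ℝ) + 1 - 2 * ν)) ∧
      ∀ a b C : ℝ, SmoothOnInterval K (2 * ℓ) a b →
        (∀ t ∈ Set.Ioc (0 : ℝ) 1,
          |iteratedDeriv (2 * ℓ) K t| ≤ C * t ^ (2 * ν - 2 * (ℓ : ℝ))) →
        (ν < (4 * (ℓ : ℝ) - 1) / 4 →
          (fun n => normVar P φ X θ ℓ n) =O[atTop] fun n : ℕ => (n : ℝ)⁻¹) ∧
        (ν = (4 * (ℓ : ℝ) - 1) / 4 →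
          (fun n => normVar P φ X θ ℓ n) =O[atTop] fun n : ℕ => (n : ℝ)⁻¹ * Real.log n) ∧
        ((4 * (ℓ : ℝ) - 1) / 4 < ν →
          (fun n => normVar P φ X θ ℓ n)
            =O[atTop] fun n : ℕ => (n : ℝ) ^ (-4 * (ℓ : ℝ) + 4 * ν)) ∧
        ∀ᵐ ω ∂P, Tendsto
          (fun n => quadVar φ X θ ℓ n ω / P[quadVar φ X θ ℓ n]) atTop (𝓝 1)) ∧
    -- (b)
    (ν = ℓ →
      SimAsymp (fun n => P[quadVar φ X θ ℓ n])
        (fun n => (-1) ^ (ℓ + 1) * βs * ((2 * ℓ).factorial : ℝ) * n * Real.log n) ∧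
      ∀ a b C : ℝ, SmoothOnInterval K (2 * ℓ) a b →
        (∀ t ∈ Set.Ioc (0 : ℝ) 1, |iteratedDeriv (2 * ℓ) K t| ≤ C * Real.log (2 / t)) →
        (fun n => normVar P φ X θ ℓ n) =O[atTop] fun n : ℕ => (Real.log n ^ 2)⁻¹) ∧
    -- (c)
    ((ℓ : ℝ) < ν →
      SimAsymp (fun n => P[quadVar φ X θ ℓ n])
        (fun n => (-1) ^ ℓ * β ℓ * ((2 * ℓ).factorial : ℝ) * n) ∧
      ∀ a b : ℝ, SmoothOnInterval K (2 * ℓ) a b →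
        (∃ t ∈ Set.Ioo a b, iteratedDeriv (2 * ℓ) K t ≠ 0) →
        0 < liminf (fun n => ((normVar P φ X θ ℓ n : ℝ) : EReal)) atTop) := by
  have hθ' : 1 ≤ θ := by omega
  refine ⟨fun hν _ => ?_, fun hν => ?_, fun hν => ?_⟩
  · obtain ⟨h1, h2, -⟩ := integral_quadVar_asymptotics_of_lt hX hmean hcov hK hφ hθ' hℓ hν
    exact ⟨h1, h2, fun a b C hsm hbd =>
      asymptotics_of_lt hX hmean hcov hK hφ hθ' hℓ hν hsm hbd⟩
  · subst hν
    exact asymptotics_of_eq hX hmean hcov hK hφ hθ' hℓ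
  · obtain ⟨h1, h2⟩ := asymptotics_of_gt hX hmean hcov hK hφ hθ' hℓ hν
    exact ⟨h1, fun a b hsm _ => h2 a b hsm⟩
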